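/- A domain is a nonempty open connected subset of $\mathbb{C}$. For an open set $G\subseteq\mathbb{C}$ let $\mathcal{H}(G)$ be the space of analytic functions on $G$ with the topology of uniform convergence on compact sets and its Borel $\sigma$-field; a random analytic function on $G$ is a random element of $\mathcal{H}(G)$. It is called locally bounded in $L^s$ if $z\mapsto \mathbb{E}|\Xi(z)|^s$ is locally bounded on $G$. Let $D\subseteq\mathbb{C}$ be a domain, $0<s\le 2$, and let $m\ge 1$, $n_0\ge 1$ be integers. Let $(X_n)_{n\ge 0}$ be random analytic functions on $D$ such that $$X_n \stackrel{d}{=} \sum_{r=1}^m A_r^{(n)}\cdot X^{(r)}_{I_r^{(n)}} + b^{(n)},\qquad n\ge n_0, \qquad (7.1)$$ where $\cdot$ is pointwise multiplication, $A_1^{(n)},\dots,A_m^{(n)}$ and $b^{(n)}$ are random analytic functions on $D$, $I^{(n)}=(I_1^{(n)},\dots,I_m^{(n)})$ is a vector of random integers with $I_r^{(n)}\in\{0,\dots,n\}$, $\mathcal{L}(X_j^{(r)})=\mathcal{L}(X_j)$ for all $r$ and $j$, and, for each $n \ge n_0$, $(A_1^{(n)},\dots,A_m^{(n)},b^{(n)},I^{(n)})$,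 $(X_j^{(1)})_{j\ge0},\dots,(X_j^{(m)})_{j\ge0}$ are independent. Assume that all $X_n$ ($n\ge0$) and all $A_r^{(n)}$, $b^{(n)}$ ($n\ge n_0$) are locally bounded in $L^s$ and, if $1<s\le 2$, that $\mathbb{E}X_n(z)=0$ for all $n\ge 0$ and $z\in D$. Let $A_1^*,\dots,A_m^*,b^*$ be random analytic functions on $D$ (defined on the same probability space as the $A_r^{(n)}$, $b^{(n)}$, $I^{(n)}$), and let $\Delta\subseteq D$ be a nonempty connected set such that for each $x\in\Delta$ there exist a neighborhood $U_x\subseteq D$ of $x$ and a number $0<s(x)\le s$ such that, as $n\to\infty$, for all $\ell\in\mathbb{N}$ and $r=1,\dots,m$, $$\sup_{z\in U_x}\mathbb{E}|A_r^{(n)}(z)-A_r^*(z)|^{s(x)}\to 0,\qquad \sup_{z\in U_x}\mathbb{E}|b^{(n)}(z)-b^*(z)|^{s(x)}\to 0,$$ $$\sup_{z\in U_x}\mathbb{E}|A_r^*(z)|^{s(x)}<\infty,\qquad \mathbb{E}\sum_{q=1}^m|A_q^*(x)|^{s(x)}<1,$$ $$\sup_{z\in U_x}\mathbb{E}\bigl[\mathbf{1}_{\{I_r^{(n)}\le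 \ell\}}|A_r^{(n)}(z)|^{s(x)}\bigr]\to 0.$$ Then there exist a domain $\tilde D$ with $\Delta\subseteq\tilde D\subseteq D$ and a random analytic function $X$ on $\tilde D$ such that $X_n|_{\tilde D}\xrightarrow{d}X$ in $\mathcal{H}(\tilde D)$ and $\mathcal{L}(X)$ is a fixed point of the map $T$ on the set of probability laws on $\mathcal{H}(\tilde D)$ given by $$T:\ \mathcal{L}(Z)\mapsto\mathcal{L}\Bigl(\sum_{r=1}^m A_r^*|_{\tilde D}\cdot Z^{(r)}+b^*|_{\tilde D}\Bigr),$$ where $\mathcal{L}(Z^{(r)})=\mathcal{L}(Z)$ and $(A_1^*,\dots,A_m^*,b^*),Z^{(1)},\dots,Z^{(m)}$ are independent. Moreover, for each $x\in\Delta$ there is a neighborhood $\tilde U_x\subseteq\tilde D$ of $x$ such that $\mathbb{E}\sup_{z\in\tilde U_x}|X(z)|^{s(x)}<\infty$ and, if $s(x)>1$, $\mathbb{E}X(z)=0$ for all $z\in\tilde U_x$. Finally, $\mathcal{L}(X)$ is the only fixed point of $T$ with this property, even if the property is required for a single $x\in\Delta$ only and the integrability condition is weakened to $\sup_{z\in\tilde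 U_x}\mathbb{E}|X(z)|^{s(x)}<\infty$: every fixed point $\mathcal{L}(Z)$ of $T$ for which there are some $x\in\Delta$ and some neighborhood $V\subseteq\tilde D$ of $x$ with $\sup_{z\in V}\mathbb{E}|Z(z)|^{s(x)}<\infty$ and, if $s(x)>1$, $\mathbb{E}Z(z)=0$ for all $z\in V$, equals $\mathcal{L}(X)$. -/

import Mathlib

open MeasureTheory ProbabilityTheory Filter Topology TopologicalSpace
open scoped ENNReal

noncomputable section

/-- The algebra of analytic functions on an open set `D ⊆ ℂ`, inside the continuous functions. -/
def analyticSubalgebra (D : Opens ℂ) : Subalgebra ℂ C(D, ℂ) where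
  carrier := {f | ∃ F : ℂ → ℂ, AnalyticOnNhd ℂ F D ∧ ∀ z : D, f z = F z}
  mul_mem' := by
    rintro f g ⟨F, hF, hf⟩ ⟨G, hG, hg⟩
    exact ⟨F * G, hF.mul hG, fun z => by simp [hf, hg]⟩
  add_mem' := by
    rintro f g ⟨F, hF, hf⟩ ⟨G, hG, hg⟩
    exact ⟨F + G, hF.add hG, fun z => by simp [hf, hg]⟩
  algebraMap_mem' := fun c => ⟨fun _ => c, analyticOnNhd_const, fun _ => rfl⟩

/-- The space `𝓗(D)` of analytic functions on `D`. Its topology is the one induced by the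
compact-open topology of `C(D, ℂ)`, i.e. uniform convergence on compact subsets of `D`. -/
abbrev HolSpace (D : Opens ℂ) : Type := analyticSubalgebra D

namespace HolSpace

variable {D D' : Opens ℂ}

instance : CoeFun (HolSpace D) (fun _ => D → ℂ) := ⟨fun f => f.1⟩

/-- `𝓗(D)` carries its Borel σ-field. A random analytic function on `D` is a measurable map
into `𝓗(D)`. -/
instance : MeasurableSpace (HolSpace D) := borel _

instance : BorelSpace (HolSpace D) := ⟨rfl⟩

/-- Restriction `𝓗(D) → 𝓗(D')` for `D' ⊆ D`. -/
def restrict (h : D' ≤ D) (f : HolSpace D) : HolSpace D' :=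
  ⟨⟨fun z => f ⟨z, h z.2⟩, f.1.continuous.comp (by fun_prop)⟩, by
    obtain ⟨F, hF, hf⟩ := f.2
    exact ⟨F, hF.mono h, fun z => hf ⟨z, h z.2⟩⟩⟩

end HolSpace

/-- A random analytic function `Ξ` on `D` is locally bounded in `L^s`:
the function `z ↦ 𝔼 |Ξ(z)|^s` is locally bounded on `D`. -/
def LocallyBoundedInLp {Ω : Type*} [MeasurableSpace Ω] (P : Measure Ω) {D : Opens ℂ}
    (Ξ : Ω → HolSpace D) (s : ℝ) : Prop :=
  ∀ x : D, ∃ V ∈ 𝓝 x, (⨆ z ∈ V, ∫⁻ ω, ‖Ξ ω z‖ₑ ^ s ∂P) < ⊤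

/-- The recurrence `X_n =ᵈ ∑_r A_r^{(n)} · X_{I_r^{(n)}}^{(r)} + b^{(n)}`, `n ≥ n₀`, with all its
standing conditions. `Y r j` stands for the copy `X_j^{(r)}` of `X_j`. -/
structure AnalyticRecurrence {Ω : Type*} [MeasurableSpace Ω] (P : Measure Ω) {D : Opens ℂ}
    {m : ℕ} (n₀ : ℕ) (X : ℕ → Ω → HolSpace D) (A : ℕ → Fin m → Ω → HolSpace D)
    (b : ℕ → Ω → HolSpace D) (I : ℕ → Fin m → Ω → ℕ) (Y : Fin m → ℕ → Ω → HolSpace D) :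
    Prop where
  measurable_X : ∀ n, Measurable (X n)
  measurable_A : ∀ n, n₀ ≤ n → ∀ r, Measurable (A n r)
  measurable_b : ∀ n, n₀ ≤ n → Measurable (b n)
  measurable_I : ∀ n, n₀ ≤ n → ∀ r, Measurable (I n r)
  measurable_Y : ∀ r j, Measurable (Y r j)
  I_le : ∀ n, n₀ ≤ n → ∀ r ω, I n r ω ≤ n
  /-- `𝓛(X_j^{(r)}) = 𝓛(X_j)`. -/
  identDistrib_copy : ∀ r j, IdentDistrib (Y r j) (X j) P P
  /-- The sequences `(X_j^{(1)})_j, …, (X_j^{(m)})_j` are independent ... -/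
  iIndepFun_copies : iIndepFun (fun r ω j => Y r j ω) P
  /-- ... and jointly independent of `(A_1^{(n)}, …, A_m^{(n)}, b^{(n)}, I^{(n)})`. -/
  indepFun_coeff : ∀ n, n₀ ≤ n →
    IndepFun (fun ω => ((fun r => A n r ω), b n ω, (fun r => I n r ω)))
      (fun ω r j => Y r j ω) P
  recurrence : ∀ n, n₀ ≤ n →
    IdentDistrib (X n) (fun ω => ∑ r, A n r ω * Y r (I n r ω) ω + b n ω) P P

/-- The map `T : 𝓛(Z) ↦ 𝓛(∑_r A_r · Z^{(r)} + b)` on laws on `𝓗(D)`, where `Z^{(1)}, …, Z^{(m)}`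
have the law `𝓛(Z) = ν` and `(A_1, …, A_m, b), Z^{(1)}, …, Z^{(m)}` are independent
(realized on the product of `P` and `m` copies of `ν`). -/
def contractionMap {Ω : Type*} [MeasurableSpace Ω] (P : Measure Ω) {D : Opens ℂ} {m : ℕ}
    (A : Fin m → Ω → HolSpace D) (b : Ω → HolSpace D) (ν : Measure (HolSpace D)) :
    Measure (HolSpace D) :=
  (P.prod (Measure.pi fun _ : Fin m => ν)).map
    fun p => ∑ r, A r p.1 * p.2 r + b p.1

/-- `T` maps probability laws to probability laws. -/
lemma isProbabilityMeasure_contractionMap {Ω : Type*} [MeasurableSpace Ω] (P : Measure Ω)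
    [IsProbabilityMeasure P] {D : Opens ℂ} {m : ℕ} {A : Fin m → Ω → HolSpace D}
    {b : Ω → HolSpace D} (hA : ∀ r, Measurable (A r)) (hb : Measurable b)
    (ν : Measure (HolSpace D)) [IsProbabilityMeasure ν] :
    IsProbabilityMeasure (contractionMap P A b ν) := by
  have : LocallyCompactSpace D := D.2.locallyCompactSpace
  have : SecondCountableTopology (HolSpace D) :=
    inferInstanceAs (SecondCountableTopology (analyticSubalgebra D : Set C(D, ℂ)))
  have : ContinuousMul (HolSpace D) := by infer_instance
  have : ContinuousAdd (HolSpace D) := by infer_instance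
  refine Measure.isProbabilityMeasure_map (Measurable.aemeasurable ?_)
  refine Measurable.add (Finset.measurable_sum _ fun r _ => ?_) (hb.comp measurable_fst)
  exact ((hA r).comp measurable_fst).mul ((measurable_pi_apply r).comp measurable_snd)

end

/-! The proof combines uniform moment bounds, complex analysis to pass from points to function
space, and a contraction argument for characteristic functions.

Moments. Near a point of `Δ` the sum of the `s`-th moments of the coefficients is eventually below
some `ξ < 1`, uniformly in `z`. The von Bahr–Esseen type inequality `|w + y|^s ≤ |w|^s + (linear in
y) + 6|y|^s` makes the linear term integrate to zero for centred variables. It shows that the excess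
`sup_w (E|w + X|^s - |w|^s)` is at most six times the moment, and this excess passes through the
recurrence with the sharp factor `ξ` (`momentExcess_recurrence`). The result is a bound on
`E|X_n(z)|^s` uniform in `n` and `z`. Since `|f|^s` has the sub-mean value property for every `s >
0`, expectation and supremum can be exchanged on concentric discs (`lintegral_iSup_ball_le`).
Montel's theorem and Markov's inequality then give tightness on the union of small discs centred in
`Δ`, which is connected because `Δ` is.

Reduction to one disc. On a connected domain, the identity theorem makes the values on any nonempty
open set `V` determine an analytic function, so the finite-dimensional distributions at points of
`V` determine its law (`ext_of_planeWave`). With tightness, convergence on the whole domain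
therefore follows from convergence of the characteristic functions at finitely many points of one
disc, around one point of `Δ`. The same reduction is why uniqueness needs its condition at a single
point only.

Characteristic functions. For the vector of values at such points, `φ_n(t) = E[exp(i Re⟨t, b_n⟩) ∏
φ_{I_r}(t A_r^{(n)})]`. Replacing the coefficients by their limits costs `o(1)`, and small indices
are negligible, so the limiting tail oscillation `g(t) = lim_ℓ sup_{j,k ≥ ℓ} |φ_j(t) - φ_k(t)|`
satisfies `g(t) ≤ ∑ E g(t A_r*)`. Also `g(t) ≤ C‖t‖^s`, by centring when `s > 1`. Iterating gives
`g(t) ≤ C θ^k ‖t‖^s` for some `θ < 1` and every `k`, hence `g = 0`. The same iteration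
(`eq_zero_of_le_sum_lintegral`) gives uniqueness, and passing to the limit in the recursion gives
the fixed-point equation. Handling several points at once requires the supremum over `z` inside the
expectation in the contraction condition; this follows from the condition at the centre by dominated
convergence on shrinking discs. -/

/-! ### Moment inequalities for translates and expansions of the exponential -/

/-- First-order expansion of `|·|^s` at `w`, with an error of order `|y|^s` uniform in `w`. The
middle term is linear in `y`, hence disappears when a centred variable is integrated. -/
lemma Complex.norm_add_rpow_le {s : ℝ} (hs1 : 1 < s) (hs2 : s ≤ 2) (w y : ℂ) :
    ‖w + y‖ ^ s ≤ ‖w‖ ^ s + s * ‖w‖ ^ (s - 2) * ((starRingEnd ℂ) w * y).re + 6 * ‖y‖ ^ s := by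
  have hs0 : 0 < s := by linarith
  rcases eq_or_ne w 0 with rfl | hw
  · have : (0 : ℝ) ≤ ‖y‖ ^ s := by positivity
    simp [Real.zero_rpow hs0.ne']
    linarith
  have hw0 : 0 < ‖w‖ := norm_pos_iff.2 hw
  have hsq : ‖w + y‖ ^ 2 = ‖w‖ ^ 2 + 2 * ((starRingEnd ℂ) w * y).re + ‖y‖ ^ 2 := by
    simp only [Complex.sq_norm, Complex.normSq_apply, Complex.add_re, Complex.add_im,
      Complex.mul_re, Complex.conj_re, Complex.conj_im]
    ring
  have hre : |((starRingEnd ℂ) w * y).re| ≤ ‖w‖ * ‖y‖ := by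
    simpa using Complex.abs_re_le_norm ((starRingEnd ℂ) w * y)
  set q := ((starRingEnd ℂ) w * y).re
  have hsplit : ‖w‖ ^ s = ‖w‖ ^ (s - 2) * ‖w‖ ^ 2 := by
    rw [← Real.rpow_natCast ‖w‖ 2, ← Real.rpow_add hw0]; norm_num
  rcases le_total ‖y‖ ‖w‖ with hyw | hyw
  · have hone : ‖w + y‖ ^ 2 = ‖w‖ ^ 2 * (1 + (2 * q + ‖y‖ ^ 2) / ‖w‖ ^ 2) := by
      rw [hsq]; field_simp; ring
    have hge : -1 ≤ (2 * q + ‖y‖ ^ 2) / ‖w‖ ^ 2 := by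
      have h0 : 0 ≤ 1 + (2 * q + ‖y‖ ^ 2) / ‖w‖ ^ 2 := by
        by_contra h
        have := mul_neg_of_pos_of_neg (pow_pos hw0 2) (not_le.1 h)
        rw [← hone] at this
        exact absurd this (not_lt.2 (by positivity))
      linarith
    -- Bernoulli's inequality with exponent `s / 2 ≤ 1`, applied to `|w + y|² / |w|²`. The quadratic
    -- remainder `|w|^(s-2) |y|²` is at most `|y|^s` because `|y| ≤ |w|` and `s ≤ 2`.
    have hb := rpow_one_add_le_one_add_mul_self (p := s / 2) hge (by positivity) (by linarith)
    have hL : ‖w + y‖ ^ s = ‖w‖ ^ s * (1 + (2 * q + ‖y‖ ^ 2) / ‖w‖ ^ 2) ^ (s / 2) := by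
      have h1 : ∀ a : ℝ, 0 ≤ a → a ^ s = (a ^ 2) ^ (s / 2) := fun a ha => by
        rw [← Real.rpow_natCast, ← Real.rpow_mul ha]; norm_num; congr 1; ring
      rw [h1 _ (norm_nonneg _), hone, h1 _ (norm_nonneg w), Real.mul_rpow (by positivity)
        (by linarith)]
    have hy2 : ‖w‖ ^ (s - 2) * ‖y‖ ^ 2 ≤ ‖y‖ ^ s := by
      rcases eq_or_ne y 0 with rfl | hy
      · simp [Real.zero_rpow hs0.ne']
      have hy0 : 0 < ‖y‖ := norm_pos_iff.2 hy
      have h1 : ‖w‖ ^ (s - 2) ≤ ‖y‖ ^ (s - 2) :=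
        Real.rpow_le_rpow_of_nonpos hy0 hyw (by linarith)
      have h2 : ‖y‖ ^ s = ‖y‖ ^ (s - 2) * ‖y‖ ^ 2 := by
        rw [← Real.rpow_natCast ‖y‖ 2, ← Real.rpow_add hy0]; norm_num
      rw [h2]; gcongr
    have hys : 0 ≤ ‖y‖ ^ s := by positivity
    have hws : 0 ≤ ‖w‖ ^ s := by positivity
    calc ‖w + y‖ ^ s ≤ ‖w‖ ^ s * (1 + s / 2 * ((2 * q + ‖y‖ ^ 2) / ‖w‖ ^ 2)) := by
          rw [hL]; gcongr
      _ = ‖w‖ ^ s + s * ‖w‖ ^ (s - 2) * q + s / 2 * (‖w‖ ^ (s - 2) * ‖y‖ ^ 2) := by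
          rw [hsplit]; field_simp; ring
      _ ≤ _ := by nlinarith
  -- Here `y` dominates. The left side costs `2^s ≤ 4` and a negative linear term costs at most `s ≤
  -- 2`, which is where the constant 6 comes from.
  · have h1 : ‖w + y‖ ^ s ≤ 4 * ‖y‖ ^ s := by
      calc ‖w + y‖ ^ s ≤ (2 * ‖y‖) ^ s := by
            gcongr; linarith [norm_add_le w y]
        _ = 2 ^ s * ‖y‖ ^ s := Real.mul_rpow (by norm_num) (by positivity)
        _ ≤ 4 * ‖y‖ ^ s := by
            gcongr
            calc (2 : ℝ) ^ s ≤ 2 ^ (2 : ℝ) := Real.rpow_le_rpow_of_exponent_le (by norm_num) hs2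
              _ = 4 := by norm_num
    have h2 : ‖w‖ ^ (s - 2) * |q| ≤ ‖y‖ ^ s := by
      calc ‖w‖ ^ (s - 2) * |q| ≤ ‖w‖ ^ (s - 2) * (‖w‖ * ‖y‖) := by gcongr
        _ = ‖w‖ ^ (s - 1) * ‖y‖ := by
            rw [show s - 1 = (s - 2) + 1 by ring, Real.rpow_add hw0, Real.rpow_one]; ring
        _ ≤ ‖y‖ ^ (s - 1) * ‖y‖ := by gcongr
        _ = ‖y‖ ^ s := by
            have hy0 : 0 < ‖y‖ := hw0.trans_le hyw
            nth_rewrite 2 [← Real.rpow_one ‖y‖]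
            rw [← Real.rpow_add hy0]; norm_num
    have h3 : -(‖w‖ ^ (s - 2) * q) ≤ ‖w‖ ^ (s - 2) * |q| := by
      rw [← mul_neg]; gcongr; exact neg_le_abs q
    have hws : 0 ≤ ‖w‖ ^ s := by positivity
    have hys : 0 ≤ ‖y‖ ^ s := by positivity
    nlinarith

lemma ENNReal.add_rpow_le_six {s : ℝ} (hs : 0 < s) (hs1 : s ≤ 1) (a b : ℝ≥0∞) :
    (a + b) ^ s ≤ a ^ s + 6 * b ^ s := by
  refine (ENNReal.rpow_add_le_add_rpow a b hs.le hs1).trans ?_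
  gcongr
  exact le_mul_of_one_le_left (zero_le) (by norm_num)

lemma enorm_rpow_eq_ofReal {E : Type*} [SeminormedAddCommGroup E] (x : E) {s : ℝ} (hs : 0 ≤ s) :
    ‖x‖ₑ ^ s = ENNReal.ofReal (‖x‖ ^ s) := by
  rw [← ofReal_norm, ENNReal.ofReal_rpow_of_nonneg (norm_nonneg _) hs]

section Moments

variable {S : Type*} [MeasurableSpace S] {μ : Measure S}

lemma integrable_norm_rpow_of_lintegral {E : Type*} [NormedAddCommGroup E] {g : S → E}
    (hg : AEStronglyMeasurable g μ) {s : ℝ} (hs : 0 ≤ s) (h : ∫⁻ y, ‖g y‖ₑ ^ s ∂μ ≠ ⊤) :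
    Integrable (fun y => ‖g y‖ ^ s) μ := by
  refine ⟨(hg.norm.aemeasurable.pow_const s).aestronglyMeasurable, ?_⟩
  rw [hasFiniteIntegral_iff_enorm]
  refine lt_of_le_of_lt (le_of_eq (lintegral_congr fun y => ?_)) h.lt_top
  rw [enorm_rpow_eq_ofReal _ hs, Real.enorm_of_nonneg (by positivity)]

lemma integrable_of_lintegral_rpow [IsFiniteMeasure μ] {E : Type*} [NormedAddCommGroup E]
    {g : S → E} (hg : AEStronglyMeasurable g μ) {s : ℝ} (hs : 1 ≤ s)
    (h : ∫⁻ y, ‖g y‖ₑ ^ s ∂μ ≠ ⊤) : Integrable g μ := by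
  refine Integrable.mono' ((integrable_norm_rpow_of_lintegral hg (by linarith) h).add
    (integrable_const (1 : ℝ))) hg (Eventually.of_forall fun y => ?_)
  rcases le_total ‖g y‖ 1 with h1 | h1
  · simp only [Pi.add_apply]
    have : 0 ≤ ‖g y‖ ^ s := by positivity
    linarith
  · simp only [Pi.add_apply]
    have := Real.self_le_rpow_of_one_le h1 hs
    linarith

/-- A von Bahr–Esseen type bound: translates of a (centred, if `s > 1`) random variable. -/
lemma lintegral_enorm_add_rpow_le [IsProbabilityMeasure μ] {s : ℝ} (hs : 0 < s) (hs2 : s ≤ 2)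
    {g : S → ℂ} (hg : Measurable g) (hc : 1 < s → ∫ y, g y ∂μ = 0) (w : ℂ) :
    ∫⁻ y, ‖w + g y‖ₑ ^ s ∂μ ≤ ‖w‖ₑ ^ s + 6 * ∫⁻ y, ‖g y‖ₑ ^ s ∂μ := by
  rcases eq_or_ne (∫⁻ y, ‖g y‖ₑ ^ s ∂μ) ⊤ with htop | htop
  · simp [htop]
  rcases le_or_gt s 1 with hs1 | hs1
  · calc ∫⁻ y, ‖w + g y‖ₑ ^ s ∂μ ≤ ∫⁻ y, (‖w‖ₑ ^ s + 6 * ‖g y‖ₑ ^ s) ∂μ := by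
          refine lintegral_mono fun y => ?_
          refine le_trans ?_ (ENNReal.add_rpow_le_six hs hs1 _ _)
          gcongr
          exact enorm_add_le _ _
      _ = _ := by
          rw [lintegral_add_left measurable_const, lintegral_const_mul _ (by fun_prop)]
          simp
  · have hgi : Integrable g μ := integrable_of_lintegral_rpow hg.aestronglyMeasurable hs1.le htop
    have hgs := integrable_norm_rpow_of_lintegral hg.aestronglyMeasurable hs.le htop
    have hlin : Integrable (fun y => s * ‖w‖ ^ (s - 2) * ((starRingEnd ℂ) w * g y).re) μ :=
      ((hgi.const_mul _).re).const_mul _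
    have hlin0 : ∫ y, s * ‖w‖ ^ (s - 2) * ((starRingEnd ℂ) w * g y).re ∂μ = 0 := by
      rw [integral_const_mul]
      have : ∫ y, ((starRingEnd ℂ) w * g y).re ∂μ = 0 := by
        rw [show (fun y => ((starRingEnd ℂ) w * g y).re) =
          fun y => RCLike.re ((starRingEnd ℂ) w * g y) from rfl,
          integral_re (hgi.const_mul _), integral_const_mul, hc hs1]
        simp
      rw [this, mul_zero]
    have hint : Integrable (fun y => ‖w‖ ^ s +
        s * ‖w‖ ^ (s - 2) * ((starRingEnd ℂ) w * g y).re + 6 * ‖g y‖ ^ s) μ :=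
      ((integrable_const _).add hlin).add (hgs.const_mul _)
    have hle : ∀ y, ‖w + g y‖ ^ s ≤ ‖w‖ ^ s +
        s * ‖w‖ ^ (s - 2) * ((starRingEnd ℂ) w * g y).re + 6 * ‖g y‖ ^ s :=
      fun y => Complex.norm_add_rpow_le hs1 hs2 w (g y)
    calc ∫⁻ y, ‖w + g y‖ₑ ^ s ∂μ ≤ ∫⁻ y, ENNReal.ofReal (‖w‖ ^ s +
        s * ‖w‖ ^ (s - 2) * ((starRingEnd ℂ) w * g y).re + 6 * ‖g y‖ ^ s) ∂μ := by
          refine lintegral_mono fun y => ?_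
          rw [enorm_rpow_eq_ofReal _ hs.le]
          exact ENNReal.ofReal_le_ofReal (hle y)
      _ = ENNReal.ofReal (∫ y, (‖w‖ ^ s +
        s * ‖w‖ ^ (s - 2) * ((starRingEnd ℂ) w * g y).re + 6 * ‖g y‖ ^ s) ∂μ) := by
          rw [ofReal_integral_eq_lintegral_ofReal hint]
          exact Eventually.of_forall fun y => le_trans (by positivity) (hle y)
      _ = ENNReal.ofReal (‖w‖ ^ s + 6 * ∫ y, ‖g y‖ ^ s ∂μ) := by
          have hwl : Integrable (fun y => ‖w‖ ^ s +
              s * ‖w‖ ^ (s - 2) * ((starRingEnd ℂ) w * g y).re) μ := (integrable_const _).add hlin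
          rw [integral_add hwl (hgs.const_mul _), integral_add (integrable_const _) hlin, hlin0, integral_const_mul]
          simp
      _ = _ := by
          have h0 : 0 ≤ ∫ y, ‖g y‖ ^ s ∂μ := integral_nonneg fun y => by positivity
          rw [ENNReal.ofReal_add (by positivity) (by positivity),
            ENNReal.ofReal_mul (by norm_num), enorm_rpow_eq_ofReal _ hs.le,
            ofReal_integral_eq_lintegral_ofReal hgs (Eventually.of_forall fun y => by positivity)]
          simp_rw [enorm_rpow_eq_ofReal _ hs.le]
          norm_num

/-- Interpolation between the bounds `|u|` and `2`, according to whether `|u| ≤ 1`. -/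
lemma norm_exp_I_mul_sub_one_le_rpow {s : ℝ} (hs : 0 < s) (hs1 : s ≤ 1) (u : ℝ) :
    ‖Complex.exp (Complex.I * u) - 1‖ ≤ 3 * |u| ^ s := by
  rcases le_total |u| 1 with h | h
  · calc _ ≤ |u| := Real.norm_exp_I_mul_ofReal_sub_one_le
      _ ≤ |u| ^ s := by
          rcases eq_or_ne u 0 with rfl | hu
          · simp [Real.zero_rpow hs.ne']
          · simpa using Real.rpow_le_rpow_of_exponent_ge (abs_pos.2 hu) h hs1
      _ ≤ _ := by linarith [show 0 ≤ |u| ^ s by positivity]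
  · calc _ ≤ ‖Complex.exp (Complex.I * u)‖ + ‖(1 : ℂ)‖ := norm_sub_le _ _
      _ = 2 := by rw [Complex.norm_exp_I_mul_ofReal]; norm_num
      _ ≤ _ := by linarith [Real.one_le_rpow h hs.le]

lemma norm_exp_I_mul_sub_one_sub_le_rpow {s : ℝ} (hs : 1 < s) (hs2 : s ≤ 2) (u : ℝ) :
    ‖Complex.exp (Complex.I * u) - 1 - Complex.I * u‖ ≤ 3 * |u| ^ s := by
  have hs0 : 0 < s := by linarith
  rcases le_total |u| 1 with h | h
  · calc _ ≤ ‖Complex.I * (u : ℂ)‖ ^ 2 := Complex.norm_exp_sub_one_sub_id_le (by simpa using h)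
      _ = |u| ^ (2 : ℝ) := by simp
      _ ≤ |u| ^ s := by
          rcases eq_or_ne u 0 with rfl | hu
          · simp [Real.zero_rpow hs0.ne']
          · exact Real.rpow_le_rpow_of_exponent_ge (abs_pos.2 hu) h hs2
      _ ≤ _ := by linarith [show 0 ≤ |u| ^ s by positivity]
  · calc _ ≤ ‖Complex.exp (Complex.I * u) - 1‖ + ‖Complex.I * (u : ℂ)‖ := norm_sub_le _ _
      _ ≤ |u| + |u| := by
          gcongr
          · exact Real.norm_exp_I_mul_ofReal_sub_one_le
          · simp
      _ ≤ _ := by linarith [Real.self_le_rpow_of_one_le h hs.le, abs_nonneg u]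

/-- Flatness of order `s` of a characteristic function at the origin. For `s > 1` centring allows
the linear term to be subtracted inside the integral for free. -/
lemma enorm_integral_exp_sub_one_le [IsProbabilityMeasure μ] {s : ℝ} (hs : 0 < s) (hs2 : s ≤ 2)
    {u : S → ℝ} (hu : Measurable u) (hc : 1 < s → ∫ y, u y ∂μ = 0) :
    ‖∫ y, Complex.exp (Complex.I * u y) ∂μ - 1‖ₑ ≤ 3 * ∫⁻ y, ‖u y‖ₑ ^ s ∂μ := by
  rcases eq_or_ne (∫⁻ y, ‖u y‖ₑ ^ s ∂μ) ⊤ with htop | htop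
  · simp [htop]
  have hexp : Integrable (fun y => Complex.exp (Complex.I * u y)) μ :=
    Integrable.of_bound (by fun_prop) 1 (Eventually.of_forall fun y =>
      (Complex.norm_exp_I_mul_ofReal _).le)
  have key : ∀ h : S → ℂ, ∫ y, Complex.exp (Complex.I * u y) ∂μ - 1 = ∫ y, h y ∂μ →
      (∀ y, ‖h y‖ ≤ 3 * |u y| ^ s) →
      ‖∫ y, Complex.exp (Complex.I * u y) ∂μ - 1‖ₑ ≤ 3 * ∫⁻ y, ‖u y‖ₑ ^ s ∂μ := by
    intro h h1 h2
    rw [h1]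
    refine (enorm_integral_le_lintegral_enorm _).trans ?_
    rw [← lintegral_const_mul _ (by fun_prop)]
    refine lintegral_mono fun y => ?_
    rw [enorm_rpow_eq_ofReal _ hs.le, ← ofReal_norm,
      show (3 : ℝ≥0∞) = ENNReal.ofReal 3 by norm_num, ← ENNReal.ofReal_mul (by norm_num)]
    exact ENNReal.ofReal_le_ofReal (h2 y)
  rcases le_or_gt s 1 with hs1 | hs1
  · refine key (fun y => Complex.exp (Complex.I * u y) - 1) ?_
      fun y => norm_exp_I_mul_sub_one_le_rpow hs hs1 _
    rw [integral_sub hexp (integrable_const _)]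
    simp
  · have hui : Integrable u μ := integrable_of_lintegral_rpow hu.aestronglyMeasurable hs1.le htop
    refine key (fun y => Complex.exp (Complex.I * u y) - 1 - Complex.I * u y) ?_
      fun y => norm_exp_I_mul_sub_one_sub_le_rpow hs1 hs2 _
    have hexp1 : Integrable (fun y => Complex.exp (Complex.I * u y) - 1) μ :=
      hexp.sub (integrable_const _)
    have hlin : Integrable (fun y => Complex.I * (u y : ℂ)) μ := hui.ofReal.const_mul _
    rw [integral_sub hexp1 hlin, integral_sub hexp (integrable_const _), integral_const_mul, integral_complex_ofReal, hc hs1]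
    simp

end Moments

/-- The bound of `lintegral_enorm_add_rpow_le` for independent weighted sums. -/
lemma lintegral_pi_enorm_add_sum_rpow_le {S : Type*} [MeasurableSpace S] {s : ℝ} (hs : 0 < s) :
    ∀ {m : ℕ} (Q : Fin m → Measure S) [∀ r, IsProbabilityMeasure (Q r)] (g : Fin m → S → ℂ)
      (_ : ∀ r, Measurable (g r)) (a : Fin m → ℂ) (N : Fin m → ℝ≥0∞)
      (_ : ∀ r w, ∫⁻ y, ‖w + g r y‖ₑ ^ s ∂(Q r) ≤ ‖w‖ₑ ^ s + N r) (w : ℂ),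
      ∫⁻ y, ‖w + ∑ r, a r * g r (y r)‖ₑ ^ s ∂(Measure.pi Q) ≤
        ‖w‖ₑ ^ s + ∑ r, ‖a r‖ₑ ^ s * N r
  | 0, Q, _, g, hg, a, N, hN, w => by simp
  | m + 1, Q, _, g, hg, a, N, hN, w => by
    have hscale : ∀ r w, ∫⁻ y, ‖w + a r * g r y‖ₑ ^ s ∂(Q r) ≤ ‖w‖ₑ ^ s + ‖a r‖ₑ ^ s * N r := by
      intro r w
      rcases eq_or_ne (a r) 0 with h0 | h0
      · simp [h0]
      calc ∫⁻ y, ‖w + a r * g r y‖ₑ ^ s ∂(Q r)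
          = ∫⁻ y, ‖a r‖ₑ ^ s * ‖w / a r + g r y‖ₑ ^ s ∂(Q r) := by
            refine lintegral_congr fun y => ?_
            rw [← ENNReal.mul_rpow_of_nonneg _ _ hs.le, ← enorm_mul]
            congr 2
            field_simp
        _ ≤ ‖a r‖ₑ ^ s * (‖w / a r‖ₑ ^ s + N r) := by
            have := hg r
            rw [lintegral_const_mul _ (by fun_prop)]
            gcongr
            exact hN r _
        _ = _ := by
            rw [mul_add, ← ENNReal.mul_rpow_of_nonneg _ _ hs.le, ← enorm_mul,
              mul_div_cancel₀ _ h0]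
    have hmp := (measurePreserving_piFinSuccAbove Q 0).symm
    have hmeas : Measurable fun y : Fin (m + 1) → S => ‖w + ∑ r, a r * g r (y r)‖ₑ ^ s := by
      have : ∀ r, Measurable fun y : Fin (m + 1) → S => g r (y r) := fun r =>
        (hg r).comp (measurable_pi_apply r)
      fun_prop
    rw [← hmp.lintegral_comp hmeas]
    -- Coordinate 0 is integrated first, with all other summands absorbed into the translate. This
    -- is why the hypothesis on each factor is required for every `w`.
    refine (lintegral_prod_symm' _ (hmeas.comp hmp.measurable)).trans_le ?_
    calc _ ≤ ∫⁻ y, (‖w + ∑ r, a (Fin.succ r) * g (Fin.succ r) (y r)‖ₑ ^ s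
          + ‖a 0‖ₑ ^ s * N 0) ∂(Measure.pi fun r : Fin m => Q (Fin.succ r)) := by
          refine lintegral_mono fun y => ?_
          refine le_trans (le_of_eq (lintegral_congr fun x => ?_)) (hscale 0 _)
          simp only [Function.comp_apply, Fin.sum_univ_succ]
          congr 2
          simp [MeasurableEquiv.piFinSuccAbove]
          ring
      _ ≤ _ := by
          rw [lintegral_add_right _ measurable_const, Fin.sum_univ_succ]
          have := lintegral_pi_enorm_add_sum_rpow_le hs (fun r : Fin m => Q (Fin.succ r))
            (fun r => g (Fin.succ r)) (fun r => hg _) (fun r => a (Fin.succ r))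
            (fun r => N (Fin.succ r)) (fun r => hN _) w
          simp only [lintegral_const, measure_univ, mul_one]
          calc _ ≤ _ := add_le_add_left this _
            _ = _ := by ring

/-! ### Evaluation maps and the Polish topology of the space of analytic functions -/

namespace HolSpace

variable {D D' : Opens ℂ}

instance : LocallyCompactSpace D := D.2.locallyCompactSpace

instance : SecondCountableTopology (HolSpace D) :=
  inferInstanceAs (SecondCountableTopology (analyticSubalgebra D : Set C(D, ℂ)))

lemma continuous_eval : Continuous fun p : HolSpace D × D => p.1 p.2 := by
  have h : Continuous fun p : C(D, ℂ) × D => p.1 p.2 := ContinuousEval.continuous_eval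
  exact h.comp (continuous_subtype_val.prodMap continuous_id)

lemma continuous_apply (z : D) : Continuous fun f : HolSpace D => f z :=
  continuous_eval.comp (.prodMk_left z)

lemma continuous_coe (f : HolSpace D) : Continuous fun z : D => f z := f.1.continuous

@[fun_prop]
lemma measurable_apply (z : D) : Measurable fun f : HolSpace D => f z :=
  (continuous_apply z).measurable

lemma measurable_eval : Measurable fun p : HolSpace D × D => p.1 p.2 :=
  continuous_eval.measurable

@[simp] lemma add_apply (f g : HolSpace D) (z : D) : (f + g) z = f z + g z := rfl
@[simp] lemma mul_apply (f g : HolSpace D) (z : D) : (f * g) z = f z * g z := rfl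

lemma sum_apply {ι : Type*} (t : Finset ι) (f : ι → HolSpace D) (z : D) :
    (∑ i ∈ t, f i) z = ∑ i ∈ t, f i z := by
  classical
  induction t using Finset.induction_on with
  | empty => rfl
  | insert i t hi ih => rw [Finset.sum_insert hi, Finset.sum_insert hi, add_apply, ih]

lemma continuous_restrict (h : D' ≤ D) : Continuous (restrict h) := by
  refine Continuous.subtype_mk ?_ _
  have : Continuous fun z : D' => (⟨z, h z.2⟩ : D) := by fun_prop
  exact (ContinuousMap.continuous_precomp (⟨_, this⟩ : C(D', D))).comp continuous_subtype_val

lemma measurable_restrict (h : D' ≤ D) : Measurable (restrict h) :=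
  (continuous_restrict h).measurable

/-- Weierstrass: a locally uniform limit of analytic functions is analytic. First countability
reduces closedness to sequences. -/
lemma isClosed_analyticSubalgebra (D : Opens ℂ) :
    IsClosed (analyticSubalgebra D : Set C(D, ℂ)) := by
  have hfc : FirstCountableTopology C(D, ℂ) := inferInstance
  refine IsSeqClosed.isClosed fun f g hf hg => ?_
  choose F hF hfF using hf
  rw [ContinuousMap.tendsto_iff_tendstoLocallyUniformly] at hg
  classical
  let G : ℂ → ℂ := fun z => if h : z ∈ D then g ⟨z, h⟩ else 0
  have hG : ∀ z : D, G z = g z := fun z => by simp [G]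
  have hlu : TendstoLocallyUniformlyOn F G atTop D := by
    rw [tendstoLocallyUniformlyOn_iff_tendstoLocallyUniformly_comp_coe]
    have : TendstoLocallyUniformly (fun n (z : D) => F n z) (fun z : D => G z) atTop := by
      simp_rw [hG, ← hfF]
      exact hg
    exact this
  have hd : DifferentiableOn ℂ G D :=
    hlu.differentiableOn (Eventually.of_forall fun n => (hF n).differentiableOn) D.2
  exact ⟨G, hd.analyticOnNhd D.2, fun z => (hG z).symm⟩

instance : PolishSpace (HolSpace D) := by
  have : PolishSpace C(D, ℂ) := ⟨⟩
  exact (isClosed_analyticSubalgebra D).polishSpace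

end HolSpace

/-! ### The recurrence as an identity of laws on a product space -/

section RecursionLaw

variable {Ω : Type*} [MeasurableSpace Ω] {P : Measure Ω} {D : Opens ℂ}
  {m n₀ : ℕ} {X : ℕ → Ω → HolSpace D} {A : ℕ → Fin m → Ω → HolSpace D}
  {b : ℕ → Ω → HolSpace D} {I : ℕ → Fin m → Ω → ℕ} {Y : Fin m → ℕ → Ω → HolSpace D}

/-- The joint law of the `r`-th sequence of copies. -/
noncomputable def copyLaw (P : Measure Ω) (Y : Fin m → ℕ → Ω → HolSpace D) (r : Fin m) :
    Measure (ℕ → HolSpace D) := P.map fun ω j => Y r j ω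

lemma measurable_apply_index {S E : Type*} [MeasurableSpace S] [MeasurableSpace E] {i : S → ℕ}
    {y : S → ℕ → E} (hi : Measurable i) (hy : Measurable y) : Measurable fun p => y p (i p) := by
  have : Measurable fun q : (ℕ → E) × ℕ => q.1 q.2 :=
    measurable_from_prod_countable_left fun j => measurable_pi_apply j
  exact this.comp (hy.prodMk hi)

namespace AnalyticRecurrence

lemma isProbabilityMeasure_copyLaw [IsProbabilityMeasure P]
    (h : AnalyticRecurrence P n₀ X A b I Y) (r : Fin m) : IsProbabilityMeasure (copyLaw P Y r) :=
  Measure.isProbabilityMeasure_map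
    (measurable_pi_lambda _ fun j => h.measurable_Y r j).aemeasurable

lemma map_copyLaw (h : AnalyticRecurrence P n₀ X A b I Y)
    (r : Fin m) (j : ℕ) : (copyLaw P Y r).map (fun y => y j) = P.map (X j) := by
  rw [copyLaw, Measure.map_map (measurable_pi_apply j)
    (measurable_pi_lambda _ fun j => h.measurable_Y r j)]
  exact (h.identDistrib_copy r j).map_eq

lemma lintegral_copyLaw (h : AnalyticRecurrence P n₀ X A b I Y)
    (r : Fin m) (j : ℕ) {F : HolSpace D → ℝ≥0∞} (hF : Measurable F) :
    ∫⁻ y, F (y j) ∂(copyLaw P Y r) = ∫⁻ ω, F (X j ω) ∂P := by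
  rw [← lintegral_map hF (measurable_pi_apply j), h.map_copyLaw, lintegral_map hF (h.measurable_X j)]

lemma integral_copyLaw (h : AnalyticRecurrence P n₀ X A b I Y)
    (r : Fin m) (j : ℕ) {F : HolSpace D → ℂ} (hF : Measurable F) :
    ∫ y, F (y j) ∂(copyLaw P Y r) = ∫ ω, F (X j ω) ∂P := by
  rw [← integral_map (measurable_pi_apply j).aemeasurable hF.aestronglyMeasurable, h.map_copyLaw,
    integral_map (h.measurable_X j).aemeasurable hF.aestronglyMeasurable]

lemma measurable_rhs (h : AnalyticRecurrence P n₀ X A b I Y)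
    {n : ℕ} (hn : n₀ ≤ n) :
    Measurable fun p : Ω × (Fin m → ℕ → HolSpace D) =>
      ∑ r, A n r p.1 * p.2 r (I n r p.1) + b n p.1 := by
  have hA := h.measurable_A n hn
  have hb := h.measurable_b n hn
  have hI := h.measurable_I n hn
  refine (Finset.measurable_fun_sum _ fun r _ => ?_).add (hb.comp measurable_fst)
  exact ((hA r).comp measurable_fst).mul (measurable_apply_index ((hI r).comp measurable_fst)
    ((measurable_pi_apply r).comp measurable_snd))

/-- Independence turns the right-hand side into a function on a product space, so that Fubini can
freeze `ω`. The coefficients and the indices are then constants, and only the copies remain random.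
Whole sequences of copies are carried along because the index is random. -/
lemma map_eq [IsProbabilityMeasure P] (h : AnalyticRecurrence P n₀ X A b I Y)
    {n : ℕ} (hn : n₀ ≤ n) :
    P.map (X n) = (P.prod (Measure.pi (copyLaw P Y))).map
      fun p => ∑ r, A n r p.1 * p.2 r (I n r p.1) + b n p.1 := by
  have hA := h.measurable_A n hn
  have hb := h.measurable_b n hn
  have hI := h.measurable_I n hn
  have := h.isProbabilityMeasure_copyLaw
  rw [(h.recurrence n hn).map_eq]
  let C : Ω → (Fin m → HolSpace D) × HolSpace D × (Fin m → ℕ) :=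
    fun ω => ((fun r => A n r ω), b n ω, (fun r => I n r ω))
  have hC : Measurable C := (measurable_pi_lambda _ hA).prodMk
    (hb.prodMk (measurable_pi_lambda _ hI))
  let W : Ω → Fin m → ℕ → HolSpace D := fun ω r j => Y r j ω
  have hW : Measurable W := measurable_pi_lambda _ fun r => measurable_pi_lambda _ fun j =>
    h.measurable_Y r j
  let F : ((Fin m → HolSpace D) × HolSpace D × (Fin m → ℕ)) × (Fin m → ℕ → HolSpace D) →
    HolSpace D := fun q => ∑ r, q.1.1 r * q.2 r (q.1.2.2 r) + q.1.2.1
  have hF : Measurable F := by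
    refine (Finset.measurable_fun_sum _ fun r _ => ?_).add (by fun_prop)
    refine Measurable.mul (by fun_prop) (measurable_apply_index (by fun_prop) (by fun_prop))
  have hpi : P.map W = Measure.pi (copyLaw P Y) :=
    (iIndepFun_iff_map_fun_eq_pi_map fun r =>
      (measurable_pi_lambda _ fun j => h.measurable_Y r j).aemeasurable).1 h.iIndepFun_copies
  have hprod : P.map (fun ω => (C ω, W ω)) = (P.map C).prod (P.map W) :=
    (indepFun_iff_map_prod_eq_prod_map_map hC.aemeasurable hW.aemeasurable).1 (h.indepFun_coeff n hn)
  calc P.map (fun ω => ∑ r, A n r ω * Y r (I n r ω) ω + b n ω)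
      = (P.map fun ω => (C ω, W ω)).map F := by
        rw [Measure.map_map hF (hC.prodMk hW)]; rfl
    _ = ((P.map C).prod ((Measure.pi (copyLaw P Y)).map id)).map F := by
        rw [hprod, hpi, Measure.map_id]
    _ = _ := by
        rw [Measure.map_prod_map _ _ hC measurable_id,
          Measure.map_map hF (hC.prodMap measurable_id)]
        rfl

end AnalyticRecurrence

end RecursionLaw

/-! ### Moment bounds at a fixed point, uniform in `n` -/

namespace AnalyticRecurrence

variable {Ω : Type*} [MeasurableSpace Ω] {P : Measure Ω} {D : Opens ℂ}
  {m n₀ : ℕ} {X : ℕ → Ω → HolSpace D} {A : ℕ → Fin m → Ω → HolSpace D}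
  {b : ℕ → Ω → HolSpace D} {I : ℕ → Fin m → Ω → ℕ} {Y : Fin m → ℕ → Ω → HolSpace D}

lemma measurable_copy_apply (h : AnalyticRecurrence P n₀ X A b I Y) {n : ℕ} (hn : n₀ ≤ n)
    (r : Fin m) (z : D) :
    Measurable fun p : Ω × (Fin m → ℕ → HolSpace D) => p.2 r (I n r p.1) z := by
  have hI := h.measurable_I n hn r
  exact (HolSpace.measurable_apply z).comp (measurable_apply_index (hI.comp measurable_fst)
    ((measurable_pi_apply r).comp measurable_snd))

/-- Centring of the toll term is inherited from that of the `X j`: given the coefficients, each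
product has mean zero, so taking expectations in the recurrence leaves only the mean of `b n`. -/
lemma integral_b_eq_zero [IsProbabilityMeasure P] (h : AnalyticRecurrence P n₀ X A b I Y) {n : ℕ} (hn : n₀ ≤ n) (z : D)
    (hA : ∀ r, Integrable (fun ω => A n r ω z) P) (hb : Integrable (fun ω => b n ω z) P)
    (hX : ∀ j, Integrable (fun ω => X j ω z) P) (hc : ∀ j, ∫ ω, X j ω z ∂P = 0) :
    ∫ ω, b n ω z ∂P = 0 := by
  have := h.isProbabilityMeasure_copyLaw
  have hev := HolSpace.measurable_apply z
  have hYi : ∀ r j, Integrable (fun y : ℕ → HolSpace D => y j z) (copyLaw P Y r) := by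
    intro r j
    have h1 : Integrable (fun f : HolSpace D => f z) (P.map (X j)) :=
      (integrable_map_measure hev.aestronglyMeasurable (h.measurable_X j).aemeasurable).2 (hX j)
    rw [← h.map_copyLaw r j] at h1
    exact h1.comp_measurable (measurable_pi_apply j)
  have hterm : ∀ r, Integrable (fun p : Ω × (Fin m → ℕ → HolSpace D) =>
      A n r p.1 z * p.2 r (I n r p.1) z) (P.prod (Measure.pi (copyLaw P Y))) := by
    intro r
    -- Since the index is at most `n`, the randomly indexed copy is dominated by a finite sum that
    -- no longer depends on `ω`.
    have hg : Integrable (fun y : Fin m → ℕ → HolSpace D =>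
        ∑ j ∈ Finset.range (n + 1), ‖y r j z‖) (Measure.pi (copyLaw P Y)) := by
      refine integrable_finsetSum _ fun j _ => ?_
      exact (measurePreserving_eval (copyLaw P Y) r).integrable_comp_of_integrable (hYi r j).norm
    refine ((hA r).norm.mul_prod hg).mono' ?_ (Eventually.of_forall fun p => ?_)
    · exact (((hev.comp (h.measurable_A n hn r)).comp measurable_fst).mul
        (h.measurable_copy_apply hn r z)).aestronglyMeasurable
    · rw [norm_mul]
      gcongr
      exact Finset.single_le_sum (f := fun j => ‖p.2 r j z‖) (fun _ _ => norm_nonneg _)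
        (Finset.mem_range.2 (Nat.lt_succ_of_le (h.I_le n hn r p.1)))
  have hterm0 : ∀ r, ∫ p : Ω × (Fin m → ℕ → HolSpace D), A n r p.1 z * p.2 r (I n r p.1) z
      ∂(P.prod (Measure.pi (copyLaw P Y))) = 0 := by
    intro r
    rw [integral_prod _ (hterm r)]
    refine integral_eq_zero_of_ae (Eventually.of_forall fun ω => ?_)
    simp only [Pi.zero_apply]
    rw [integral_const_mul]
    have h1 := (measurePreserving_eval (copyLaw P Y) r).map_eq
    have h2 : ∫ y : Fin m → ℕ → HolSpace D, y r (I n r ω) z ∂(Measure.pi (copyLaw P Y)) =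
        ∫ y, y (I n r ω) z ∂(copyLaw P Y r) := by
      have hm : Measurable fun y : ℕ → HolSpace D => y (I n r ω) z := hev.comp (measurable_pi_apply _)
      rw [← h1, integral_map (measurable_pi_apply r).aemeasurable hm.aestronglyMeasurable]
    rw [h2, h.integral_copyLaw r _ hev, hc, mul_zero]
  have hbi : Integrable (fun p : Ω × (Fin m → ℕ → HolSpace D) => b n p.1 z)
      (P.prod (Measure.pi (copyLaw P Y))) := hb.comp_fst _
  have hX0 := hc n
  rw [← integral_map (φ := X n) (f := fun f : HolSpace D => f z) (h.measurable_X n).aemeasurable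
    hev.aestronglyMeasurable, h.map_eq hn, integral_map (h.measurable_rhs hn).aemeasurable
    hev.aestronglyMeasurable] at hX0
  simp only [HolSpace.add_apply, HolSpace.sum_apply, HolSpace.mul_apply] at hX0
  rw [integral_add (integrable_finsetSum _ fun r _ => hterm r) hbi,
    integral_finsetSum _ fun r _ => hterm r, Finset.sum_congr rfl fun r _ => hterm0 r,
    integral_prod _ hbi] at hX0
  simpa using hX0

/-- The translation excess of the `s`-th absolute moment, an ideal substitute for the moment. -/
noncomputable def momentExcess (P : Measure Ω) (s : ℝ) (g : Ω → ℂ) : ℝ≥0∞ :=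
  ⨆ w : ℂ, (∫⁻ ω, ‖w + g ω‖ₑ ^ s ∂P - ‖w‖ₑ ^ s)

lemma lintegral_le_add_momentExcess (s : ℝ) (g : Ω → ℂ) (w : ℂ) :
    ∫⁻ ω, ‖w + g ω‖ₑ ^ s ∂P ≤ ‖w‖ₑ ^ s + momentExcess P s g :=
  tsub_le_iff_left.1 (le_iSup (fun w : ℂ => ∫⁻ ω, ‖w + g ω‖ₑ ^ s ∂P - ‖w‖ₑ ^ s) w)

lemma lintegral_le_momentExcess {s : ℝ} (hs : 0 < s) (g : Ω → ℂ) :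
    ∫⁻ ω, ‖g ω‖ₑ ^ s ∂P ≤ momentExcess P s g := by
  simpa [hs] using lintegral_le_add_momentExcess (P := P) s g 0

/-- Together with `lintegral_le_momentExcess`, this makes excess and moment comparable up to the
factor 6 for variables that are centred when `s > 1`. -/
lemma momentExcess_le [IsProbabilityMeasure P] {s : ℝ} (hs : 0 < s) (hs2 : s ≤ 2) {g : Ω → ℂ} (hg : Measurable g)
    (hc : 1 < s → ∫ ω, g ω ∂P = 0) : momentExcess P s g ≤ 6 * ∫⁻ ω, ‖g ω‖ₑ ^ s ∂P :=
  iSup_le fun w => tsub_le_iff_left.2 (lintegral_enorm_add_rpow_le hs hs2 hg hc w)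

/-- Translates pass through the sum one summand at a time, so the factor in front of `M` is exactly
the sum of the coefficient moments. With plain moments a factor 6 would appear at every step and
could destroy the contraction. The bound is assumed for `j ≤ n`, including `n`, because the index
may equal `n`. -/
lemma momentExcess_recurrence [IsProbabilityMeasure P] (h : AnalyticRecurrence P n₀ X A b I Y) {n : ℕ} (hn : n₀ ≤ n)
    (z : D) {s : ℝ} (hs : 0 < s) (hs2 : s ≤ 2) (hb : 1 < s → ∫ ω, b n ω z ∂P = 0) {M : ℝ≥0∞}
    (hM : ∀ j ≤ n, momentExcess P s (fun ω => X j ω z) ≤ M) :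
    momentExcess P s (fun ω => X n ω z) ≤
      (∑ r, ∫⁻ ω, ‖A n r ω z‖ₑ ^ s ∂P) * M + 6 * ∫⁻ ω, ‖b n ω z‖ₑ ^ s ∂P := by
  have := h.isProbabilityMeasure_copyLaw
  have hev := HolSpace.measurable_apply z
  have hAm : ∀ r, Measurable fun ω => A n r ω z := fun r => hev.comp (h.measurable_A n hn r)
  have hbm : Measurable fun ω => b n ω z := hev.comp (h.measurable_b n hn)
  refine iSup_le fun w => tsub_le_iff_left.2 ?_
  have hF : Measurable fun f : HolSpace D => ‖w + f z‖ₑ ^ s := by fun_prop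
  rw [← lintegral_map (f := fun f : HolSpace D => ‖w + f z‖ₑ ^ s) hF (h.measurable_X n),
    h.map_eq hn, lintegral_map hF (h.measurable_rhs hn)]
  refine (lintegral_prod _ (hF.comp (h.measurable_rhs hn)).aemeasurable).trans_le ?_
  calc _ ≤ ∫⁻ ω, (‖w + b n ω z‖ₑ ^ s + ∑ r, ‖A n r ω z‖ₑ ^ s * M) ∂P := by
        refine lintegral_mono fun ω => ?_
        refine le_trans (le_of_eq (lintegral_congr fun y => ?_))
          (lintegral_pi_enorm_add_sum_rpow_le hs (copyLaw P Y) (fun r y => y (I n r ω) z)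
            (fun r => hev.comp (measurable_pi_apply _)) (fun r => A n r ω z) (fun _ => M) ?_
            (w + b n ω z))
        · simp only [Function.comp_apply, HolSpace.add_apply, HolSpace.sum_apply, HolSpace.mul_apply]
          congr 2
          ring
        · intro r w
          have hF : Measurable fun f : HolSpace D => ‖w + f z‖ₑ ^ s := by fun_prop
          rw [h.lintegral_copyLaw r (I n r ω) hF]
          refine (lintegral_le_add_momentExcess s _ w).trans ?_
          gcongr
          exact hM _ (h.I_le n hn r ω)
    _ = ∫⁻ ω, ‖w + b n ω z‖ₑ ^ s ∂P + (∑ r, ∫⁻ ω, ‖A n r ω z‖ₑ ^ s ∂P) * M := by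
        rw [lintegral_add_left (by fun_prop), lintegral_finsetSum _ (fun r _ => by
          have := hAm r; fun_prop), Finset.sum_mul]
        congr 2
        ext r
        have := hAm r
        rw [lintegral_mul_const _ (by fun_prop)]
    _ ≤ ‖w‖ₑ ^ s + 6 * ∫⁻ ω, ‖b n ω z‖ₑ ^ s ∂P + (∑ r, ∫⁻ ω, ‖A n r ω z‖ₑ ^ s ∂P) * M := by
        gcongr
        exact lintegral_enorm_add_rpow_le hs hs2 hbm hb w
    _ = _ := by ring

/-- Absorption of the unknown occurring on both sides: if `M > Q`, then `M ≤ ξ M + (1 - ξ) Q`, and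
finiteness of `M` allows `ξ M` to be subtracted. -/
lemma _root_.ENNReal.le_of_le_mul_max_add {ξ M Q B : ℝ≥0∞} (hξ : ξ < 1) (hM : M ≠ ⊤)
    (hQ : Q ≠ ⊤) (hBQ : B ≤ (1 - ξ) * Q) (h : M ≤ ξ * max Q M + B) : M ≤ Q := by
  by_contra hlt
  rw [max_eq_right (not_le.1 hlt).le] at h
  have h1 : M ≤ ξ * M + (1 - ξ) * Q := h.trans (by gcongr)
  lift ξ to NNReal using hξ.ne_top
  lift M to NNReal using hM
  lift Q to NNReal using hQ
  have hξ' : ξ < 1 := by exact_mod_cast hξ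
  have h2 : M ≤ ξ * M + (1 - ξ) * Q := by exact_mod_cast h1
  have h3 : Q < M := by exact_mod_cast not_le.1 hlt
  have h4 : (M : ℝ) ≤ ξ * M + (1 - ξ) * Q := by
    have := NNReal.coe_le_coe.2 h2
    rwa [NNReal.coe_add, NNReal.coe_mul, NNReal.coe_mul, NNReal.coe_sub hξ'.le] at this
  have h5 : (Q : ℝ) < M := h3
  have h6 : (ξ : ℝ) < 1 := hξ'
  nlinarith

/-- Contraction of the coefficients yields a bound on the moments of `X n z`, uniform in `n`. -/
lemma lintegral_le_of_contraction [IsProbabilityMeasure P] (h : AnalyticRecurrence P n₀ X A b I Y) (z : D) {s : ℝ}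
    (hs : 0 < s) (hs2 : s ≤ 2) {n₁ : ℕ} (hn₁ : n₀ ≤ n₁) {ξ B K : ℝ≥0∞} (hξ : ξ < 1) (hB : B ≠ ⊤)
    (hK : K ≠ ⊤) (hA : ∀ n, n₁ ≤ n → ∑ r, ∫⁻ ω, ‖A n r ω z‖ₑ ^ s ∂P ≤ ξ)
    (hb : ∀ n, n₁ ≤ n → ∫⁻ ω, ‖b n ω z‖ₑ ^ s ∂P ≤ B)
    (hXK : ∀ n, n < n₁ → ∫⁻ ω, ‖X n ω z‖ₑ ^ s ∂P ≤ K)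
    (hX : ∀ n, ∫⁻ ω, ‖X n ω z‖ₑ ^ s ∂P ≠ ⊤) (hc : 1 < s → ∀ n, ∫ ω, X n ω z ∂P = 0) (n : ℕ) :
    ∫⁻ ω, ‖X n ω z‖ₑ ^ s ∂P ≤ max (6 * K) (6 * B / (1 - ξ)) := by
  have hev := HolSpace.measurable_apply z
  have hξ0 : 1 - ξ ≠ 0 := (tsub_pos_of_lt hξ).ne'
  -- The first entry covers the initial indices, the factor 6 being the price of passing to the
  -- excess. The second is the fixed point of `q = ξ q + 6 B`.
  set Q := max (6 * K) (6 * B / (1 - ξ))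
  have hQ : Q ≠ ⊤ := max_ne_top (ENNReal.mul_ne_top (by norm_num) hK)
    (ENNReal.div_ne_top (ENNReal.mul_ne_top (by norm_num) hB) hξ0)
  have hXM : ∀ n, momentExcess P s (fun ω => X n ω z) ≤ 6 * ∫⁻ ω, ‖X n ω z‖ₑ ^ s ∂P := fun n =>
    momentExcess_le hs hs2 (hev.comp (h.measurable_X n)) fun hs1 => hc hs1 n
  -- The induction runs on the excess, so the factor 6 is paid once and not at each step.
  refine (lintegral_le_momentExcess hs _).trans ?_
  induction n using Nat.strong_induction_on with
  | _ n ih =>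
    rcases lt_or_ge n n₁ with hn | hn
    · exact (hXM n).trans ((mul_le_mul_right (hXK n hn) 6).trans (le_max_left _ _))
    · have hfin : momentExcess P s (fun ω => X n ω z) ≠ ⊤ :=
        ((hXM n).trans_lt (ENNReal.mul_lt_top (by norm_num) (hX n).lt_top)).ne
      refine ENNReal.le_of_le_mul_max_add (B := 6 * B) hξ hfin hQ ?_ ?_
      · rw [← ENNReal.mul_div_cancel (a := 1 - ξ) (b := 6 * B) hξ0
          (ENNReal.sub_ne_top ENNReal.one_ne_top)]
        gcongr
        exact le_max_right _ _
      · refine (h.momentExcess_recurrence (hn₁.trans hn) z hs hs2 ?_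
          (M := max Q (momentExcess P s fun ω => X n ω z)) fun j hj => ?_).trans ?_
        · intro hs1
          have hAr : ∀ r, ∫⁻ ω, ‖A n r ω z‖ₑ ^ s ∂P ≠ ⊤ := fun r =>
            (((Finset.single_le_sum (f := fun r => ∫⁻ ω, ‖A n r ω z‖ₑ ^ s ∂P)
              (fun _ _ => zero_le) (Finset.mem_univ r)).trans (hA n hn)).trans_lt hξ).ne_top
          refine h.integral_b_eq_zero (hn₁.trans hn) z (fun r => ?_) ?_ (fun j => ?_) (hc hs1)
          · exact integrable_of_lintegral_rpow (hev.comp (h.measurable_A n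
              (hn₁.trans hn) r)).aestronglyMeasurable hs1.le (hAr r)
          · exact integrable_of_lintegral_rpow (hev.comp (h.measurable_b n
              (hn₁.trans hn))).aestronglyMeasurable hs1.le ((hb n hn).trans_lt hB.lt_top).ne
          · exact integrable_of_lintegral_rpow (hev.comp
              (h.measurable_X j)).aestronglyMeasurable hs1.le (hX j)
        · rcases hj.lt_or_eq with hj | rfl
          · exact (ih j hj).trans (le_max_left _ _)
          · exact le_max_right _ _
        · gcongr
          · exact hA n hn
          · exact hb n hn

end AnalyticRecurrence

/-! ### Sub-mean value property of powers of the modulus -/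

section SubmeanValue

open Metric Real

/-- Jensen's formula shows that `log |f|` lies below its circle average; Jensen's inequality for the
convex function `exp` then transfers this to `|f|^p = exp (p log |f|)`. The argument includes
exponents `p < 1`. -/
lemma AnalyticOnNhd.norm_rpow_le_circleAverage {f : ℂ → ℂ} {c : ℂ} {R p : ℝ} (hR : 0 < R)
    (hp : 0 < p) (hf : AnalyticOnNhd ℂ f (closedBall c R)) :
    ‖f c‖ ^ p ≤ circleAverage (fun z => ‖f z‖ ^ p) c R := by
  rcases eq_or_ne (f c) 0 with h0 | h0
  · rw [h0, norm_zero, Real.zero_rpow hp.ne']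
    exact circleAverage_nonneg_of_nonneg fun z _ => by positivity
  have habs : |R| = R := abs_of_pos hR
  have hsph : sphere c |R| ⊆ closedBall c R := by rw [habs]; exact sphere_subset_closedBall
  have hlog : Real.log ‖f c‖ ≤ circleAverage (Real.log ‖f ·‖) c R := by
    rw [AnalyticOnNhd.circleAverage_log_norm hR.ne' (by rwa [habs]) h0]
    -- Each zero `u` contributes its multiplicity times `log (R / |c - u|)`, which is nonnegative
    -- inside the disc.
    refine le_add_of_nonneg_left (finsum_nonneg fun u => ?_)
    by_cases hu : u ∈ closedBall c |R|
    · refine mul_nonneg ?_ ?_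
      · have := (MeromorphicOn.AnalyticOnNhd.divisor_nonneg (hf.mono (by rw [habs]) :
          AnalyticOnNhd ℂ f (closedBall c |R|))) u
        exact_mod_cast this
      -- At `u = c` the logarithm is evaluated at the default value `0⁻¹ = 0`, giving 0.
      · rcases eq_or_ne u c with rfl | huc
        · simp
        · refine Real.log_nonneg ?_
          have hpos : 0 < ‖c - u‖ := norm_pos_iff.2 (sub_ne_zero.2 huc.symm)
          rw [← div_eq_mul_inv, one_le_div hpos, ← dist_eq_norm, dist_comm, ← habs]
          exact hu
    · simp [Function.locallyFinsuppWithin.apply_eq_zero_of_notMem _ hu]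
  -- At a zero of `f` the convention `Real.log 0 = 0` would give `exp 0 = 1` instead of 0. The zeros
  -- on the circle are discrete, so the averages are unaffected.
  have hne : ∀ᶠ z in codiscreteWithin (sphere c |R|), f z ≠ 0 := by
    rcases hf.eqOn_zero_or_eventually_ne_zero_of_preconnected
      (convex_closedBall c R).isPreconnected with h | h
    · exact absurd (h (mem_closedBall_self hR.le)) h0
    · exact codiscreteWithin_mono hsph h
  have hexp : (fun z => Real.exp (p * Real.log ‖f z‖)) =ᶠ[codiscreteWithin (sphere c |R|)]
      fun z => ‖f z‖ ^ p := by
    filter_upwards [hne] with z hz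
    rw [Real.rpow_def_of_pos (norm_pos_iff.2 hz), mul_comm]
  have hint1 : CircleIntegrable (Real.log ‖f ·‖) c R :=
    MeromorphicOn.circleIntegrable_log_norm fun z hz => (hf z (hsph hz)).meromorphicAt
  have hint2 : CircleIntegrable (fun z => ‖f z‖ ^ p) c R := by
    refine ContinuousOn.circleIntegrable hR.le ?_
    exact ((hf.continuousOn.mono (by rwa [habs] at hsph)).norm).rpow_const fun _ _ => Or.inr hp.le
  have hint3 : CircleIntegrable (fun z => Real.exp (p * Real.log ‖f z‖)) c R :=
    hint2.congr_codiscreteWithin hexp.symm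
  rw [← circleAverage_congr_codiscreteWithin hexp hR.ne']
  have hpi : (0 : ℝ) ≤ 2 * π := by positivity
  have : NeZero (volume.restrict (Set.uIoc 0 (2 * π))) := ⟨by
    rw [Ne, Measure.restrict_eq_zero, Set.uIoc_of_le hpi]; simp [pi_pos]⟩
  have : IsFiniteMeasure (volume.restrict (Set.uIoc 0 (2 * π))) := by
    rw [Set.uIoc_of_le hpi]; infer_instance
  have hJ := ConvexOn.map_average_le (μ := volume.restrict (Set.uIoc 0 (2 * π)))
    (f := fun θ => p * Real.log ‖f (circleMap c R θ)‖) convexOn_exp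
    Real.continuous_exp.continuousOn isClosed_univ (by simp)
    ((intervalIntegrable_iff.1 hint1).const_mul p) (intervalIntegrable_iff.1 hint3)
  calc ‖f c‖ ^ p = Real.exp (p * Real.log ‖f c‖) := by
        rw [Real.rpow_def_of_pos (norm_pos_iff.2 h0), mul_comm]
    _ ≤ Real.exp (p * circleAverage (Real.log ‖f ·‖) c R) := by gcongr
    _ = Real.exp (⨍ θ in 0..2 * π, p * Real.log ‖f (circleMap c R θ)‖) := by
        rw [circleAverage_eq_intervalAverage, interval_average_eq, interval_average_eq,
          intervalIntegral.integral_const_mul, smul_eq_mul, smul_eq_mul]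
        congr 1; ring
    _ ≤ _ := by
        rw [circleAverage_eq_intervalAverage]
        exact hJ

/-- The circle inequality is integrated over the radius in polar coordinates. The indicators in `H₁`
and `H₂` discard `f` outside the disc, where nothing is known about it. -/
lemma AnalyticOnNhd.enorm_rpow_mul_volume_ball_le {f : ℂ → ℂ} {c : ℂ} {R p : ℝ}
    (hp : 0 < p) (hf : AnalyticOnNhd ℂ f (ball c R)) :
    ‖f c‖ₑ ^ p * volume (ball c R) ≤ ∫⁻ w in ball c R, ‖f w‖ₑ ^ p := by
  let H₁ : ℂ → ℝ≥0∞ := (ball 0 R).indicator fun _ => ‖f c‖ₑ ^ p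
  let H₂ : ℂ → ℝ≥0∞ := (ball 0 R).indicator fun w => ‖f (c + w)‖ₑ ^ p
  have hcont : ContinuousOn (fun w => f (c + w)) (ball 0 R) :=
    hf.continuousOn.comp (by fun_prop) fun w hw => by simpa using hw
  have hH₁ : Measurable H₁ := measurable_const.indicator measurableSet_ball
  have hH₂ : Measurable H₂ := by
    have h1 : Measurable ((ball 0 R).indicator fun w => f (c + w)) := by
      classical
      rw [← Set.piecewise_eq_indicator]
      exact hcont.measurable_piecewise continuousOn_const measurableSet_ball
    have h2 : H₂ = fun w => ‖(ball 0 R).indicator (fun w => f (c + w)) w‖ₑ ^ p := by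
      ext w
      by_cases hw : w ∈ ball (0 : ℂ) R <;> simp [H₂, hw, hp]
    rw [h2]; fun_prop
  have hcircle : ∀ ρ ∈ Set.Ioi (0 : ℝ),
      ∫⁻ θ in Set.Ioo (-π) π, H₁ (Complex.polarCoord.symm (ρ, θ)) ≤
        ∫⁻ θ in Set.Ioo (-π) π, H₂ (Complex.polarCoord.symm (ρ, θ)) := by
    intro ρ hρ
    have hρ0 : 0 < ρ := hρ
    have hmem : ∀ θ, Complex.polarCoord.symm (ρ, θ) ∈ ball (0 : ℂ) R ↔ ρ < R := fun θ => by
      rw [mem_ball_zero_iff, Complex.norm_polarCoord_symm, abs_of_pos hρ0]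
    by_cases hρR : ρ < R
    swap
    · simp only [H₁, H₂, Set.indicator, hmem, hρR, if_false]; rfl
    have hcm : ∀ θ, c + Complex.polarCoord.symm (ρ, θ) = circleMap c ρ θ := fun θ => by
      simp [circleMap, Complex.exp_mul_I]
    simp only [H₁, H₂, Set.indicator, hmem, hρR, if_true, hcm]
    have hpi : -π ≤ π := by linarith [pi_pos]
    have hci : ContinuousOn (fun θ => ‖f (circleMap c ρ θ)‖ ^ p) Set.univ := by
      refine ContinuousOn.rpow_const (ContinuousOn.norm (hf.continuousOn.comp
        (by fun_prop) fun θ _ => ?_)) fun _ _ => Or.inr hp.le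
      simp [dist_eq_norm, abs_of_pos hρ0, hρR]
    have hint : IntegrableOn (fun θ => ‖f (circleMap c ρ θ)‖ ^ p) (Set.Ioo (-π) π) :=
      ((continuousOn_univ.1 hci).integrableOn_Icc).mono_set Set.Ioo_subset_Icc_self
    have hsub := AnalyticOnNhd.norm_rpow_le_circleAverage hρ0 hp
      (hf.mono (closedBall_subset_ball hρR))
    rw [circleAverage_eq_integral_add (-π), intervalIntegral.integral_comp_add_right
      (fun θ => ‖f (circleMap c ρ θ)‖ ^ p)] at hsub
    rw [show (0 : ℝ) + -π = -π by ring, show 2 * π + -π = π by ring,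
      intervalIntegral.integral_of_le hpi, integral_Ioc_eq_integral_Ioo, smul_eq_mul,
      inv_mul_eq_div, le_div_iff₀ (by positivity)] at hsub
    simp_rw [enorm_rpow_eq_ofReal _ hp.le]
    rw [← ofReal_integral_eq_lintegral_ofReal hint (Eventually.of_forall fun θ => by positivity),
      lintegral_const, Measure.restrict_apply_univ, Real.volume_Ioo,
      ← ENNReal.ofReal_mul (by positivity)]
    refine ENNReal.ofReal_le_ofReal ?_
    rw [show π - -π = 2 * π by ring]
    exact hsub
  have hmain : ∫⁻ w, H₁ w ≤ ∫⁻ w, H₂ w := by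
    have hpolar : ∀ H : ℂ → ℝ≥0∞, Measurable H → ∫⁻ w, H w = ∫⁻ ρ in Set.Ioi (0 : ℝ),
        ENNReal.ofReal ρ * ∫⁻ θ in Set.Ioo (-π) π, H (Complex.polarCoord.symm (ρ, θ)) := by
      intro H hH
      have hsymm : Measurable fun q : ℝ × ℝ => Complex.polarCoord.symm q := by
        simp only [Complex.polarCoord_symm_apply]
        fun_prop
      have hmeas : Measurable fun q : ℝ × ℝ =>
          ENNReal.ofReal q.1 • H (Complex.polarCoord.symm q) :=
        (ENNReal.measurable_ofReal.comp measurable_fst).mul (hH.comp hsymm)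
      rw [← Complex.lintegral_comp_polarCoord_symm, polarCoord_target, Measure.volume_eq_prod,
        ← Measure.prod_restrict, lintegral_prod _ hmeas.aemeasurable]
      refine lintegral_congr fun ρ => ?_
      simp only [smul_eq_mul]
      have hm : Measurable fun θ : ℝ => H (Complex.polarCoord.symm (ρ, θ)) :=
        hH.comp (hsymm.comp measurable_prodMk_left)
      rw [lintegral_const_mul _ hm]
    rw [hpolar _ hH₁, hpolar _ hH₂]
    refine setLIntegral_mono' measurableSet_Ioi fun ρ hρ => ?_
    exact mul_le_mul_right (hcircle ρ hρ) _
  have h1 : ∫⁻ w, H₁ w = ‖f c‖ₑ ^ p * volume (ball c R) := by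
    rw [lintegral_indicator measurableSet_ball, lintegral_const, Measure.restrict_apply_univ,
      Complex.volume_ball, Complex.volume_ball]
  have h2 : ∫⁻ w, H₂ w = ∫⁻ w in ball c R, ‖f w‖ₑ ^ p := by
    rw [← lintegral_indicator measurableSet_ball,
      ← lintegral_add_left_eq_self ((ball c R).indicator fun w => ‖f w‖ₑ ^ p) c]
    refine lintegral_congr fun w => ?_
    simp [H₂, Set.indicator]
  rwa [h1, h2] at hmain

end SubmeanValue

/-! ### Supremum and expectation; Montel's theorem -/

namespace HolSpace

open Metric

variable {D : Opens ℂ} {Ω : Type*} [MeasurableSpace Ω] {P : Measure Ω}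

lemma continuous_enorm_rpow (f : HolSpace D) (p : ℝ) : Continuous fun z : D => ‖f z‖ₑ ^ p :=
  (ENNReal.continuous_rpow_const).comp f.continuous_coe.enorm

lemma measurable_iSup_enorm_rpow (V : Set D) (p : ℝ) :
    Measurable fun f : HolSpace D => ⨆ z ∈ V, ‖f z‖ₑ ^ p :=
  (lowerSemicontinuous_biSup fun z _ => ((ENNReal.continuous_rpow_const).comp
    (continuous_apply z).enorm).lowerSemicontinuous).measurable

/-- Lebesgue measure on an open subset of `ℂ`. -/
noncomputable def lebesgue (D : Opens ℂ) : Measure D := (volume : Measure ℂ).comap Subtype.val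

lemma map_lebesgue : (lebesgue D).map Subtype.val = (volume : Measure ℂ).restrict D :=
  map_comap_subtype_coe D.2.measurableSet _

instance : SigmaFinite (lebesgue D) :=
  SigmaFinite.of_map _ measurable_subtype_coe.aemeasurable (by rw [map_lebesgue]; infer_instance)

lemma setLIntegral_lebesgue {B : Set ℂ} (hBD : B ⊆ D) (hB : MeasurableSet B) (F : ℂ → ℝ≥0∞) :
    ∫⁻ w in Subtype.val ⁻¹' B, F (w : ℂ) ∂(lebesgue D) = ∫⁻ w in B, F w := by
  have hemb : MeasurableEmbedding (Subtype.val : D → ℂ) :=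
    MeasurableEmbedding.subtype_coe D.2.measurableSet
  rw [← hemb.lintegral_map, ← hemb.restrict_map, map_lebesgue, Measure.restrict_restrict hB,
    Set.inter_eq_left.2 hBD]

lemma lebesgue_preimage {B : Set ℂ} (hBD : B ⊆ D) (hB : MeasurableSet B) :
    lebesgue D (Subtype.val ⁻¹' B) = volume B := by
  simpa using setLIntegral_lebesgue hBD hB fun _ => 1

/-- Subharmonicity exchanges the supremum and the expectation on concentric discs. -/
lemma lintegral_iSup_ball_le {x : D} {R p : ℝ} (hR : 0 < R) (hp : 0 < p)
    (hD : ball (x : ℂ) (2 * R) ⊆ D) [SFinite P] {Ξ : Ω → HolSpace D} (hΞ : Measurable Ξ) :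
    ∫⁻ ω, ⨆ z ∈ ball x R, ‖Ξ ω z‖ₑ ^ p ∂P ≤
      4 * ⨆ z ∈ ball x (2 * R), ∫⁻ ω, ‖Ξ ω z‖ₑ ^ p ∂P := by
  have hv : volume (ball (x : ℂ) R) ≠ 0 := (measure_ball_pos _ _ hR).ne'
  have hv' : volume (ball (x : ℂ) R) ≠ ⊤ := measure_ball_lt_top.ne
  have hpre : ball x (2 * R) = Subtype.val ⁻¹' ball (x : ℂ) (2 * R) := rfl
  -- The disc of radius `R` about any `z` with `|z - x| < R` lies in the disc of radius `2R` about
  -- `x`, so a single area integral controls all such `z`.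
  have hpt : ∀ ω, (⨆ z ∈ ball x R, ‖Ξ ω z‖ₑ ^ p) ≤
      (volume (ball (x : ℂ) R))⁻¹ * ∫⁻ w in ball x (2 * R), ‖Ξ ω w‖ₑ ^ p ∂(lebesgue D) := by
    intro ω
    obtain ⟨F, hF, hf⟩ := (Ξ ω).2
    have hF2 : ∫⁻ w in ball x (2 * R), ‖Ξ ω w‖ₑ ^ p ∂(lebesgue D) =
        ∫⁻ w in ball (x : ℂ) (2 * R), ‖F w‖ₑ ^ p := by
      rw [hpre, ← setLIntegral_lebesgue hD measurableSet_ball]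
      simp_rw [hf]
    refine iSup₂_le fun z hz => ?_
    have hsub : ball (z : ℂ) R ⊆ ball (x : ℂ) (2 * R) := by
      refine ball_subset_ball' ?_
      have : dist (z : ℂ) x < R := hz
      linarith
    have h1 := AnalyticOnNhd.enorm_rpow_mul_volume_ball_le hp (hF.mono (hsub.trans hD))
    rw [hF2, mul_comm, ← div_eq_mul_inv, ENNReal.le_div_iff_mul_le (Or.inl hv) (Or.inl hv'), hf z]
    have h3 : volume (ball (x : ℂ) R) = volume (ball (z : ℂ) R) := by simp
    rw [h3]
    exact h1.trans (lintegral_mono_set hsub)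
  have hjoint : Measurable fun q : Ω × D => ‖Ξ q.1 q.2‖ₑ ^ p := by
    have : Measurable fun q : Ω × D => Ξ q.1 q.2 :=
      measurable_eval.comp ((hΞ.comp measurable_fst).prodMk measurable_snd)
    fun_prop
  calc ∫⁻ ω, ⨆ z ∈ ball x R, ‖Ξ ω z‖ₑ ^ p ∂P
      ≤ ∫⁻ ω, (volume (ball (x : ℂ) R))⁻¹ *
          ∫⁻ w in ball x (2 * R), ‖Ξ ω w‖ₑ ^ p ∂(lebesgue D) ∂P := lintegral_mono hpt
    _ = (volume (ball (x : ℂ) R))⁻¹ *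
          ∫⁻ w in ball x (2 * R), ∫⁻ ω, ‖Ξ ω w‖ₑ ^ p ∂P ∂(lebesgue D) := by
        rw [lintegral_const_mul _ hjoint.lintegral_prod_right',
          lintegral_lintegral_swap hjoint.aemeasurable]
    _ ≤ (volume (ball (x : ℂ) R))⁻¹ * ∫⁻ w in ball x (2 * R),
          (⨆ z ∈ ball x (2 * R), ∫⁻ ω, ‖Ξ ω z‖ₑ ^ p ∂P) ∂(lebesgue D) := by
        refine mul_le_mul_right (setLIntegral_mono' measurableSet_ball fun w hw => ?_) _
        exact le_iSup₂ (f := fun (z : D) (_ : z ∈ ball x (2 * R)) => ∫⁻ ω, ‖Ξ ω z‖ₑ ^ p ∂P) w hw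
    _ = (volume (ball (x : ℂ) R))⁻¹ * volume (ball (x : ℂ) (2 * R)) *
          ⨆ z ∈ ball x (2 * R), ∫⁻ ω, ‖Ξ ω z‖ₑ ^ p ∂P := by
        rw [lintegral_const, Measure.restrict_apply_univ, hpre,
          lebesgue_preimage hD measurableSet_ball]
        ring
    _ = _ := by
        congr 1
        -- The constant 4 is the ratio of the areas of the two discs.
        have : volume (ball (x : ℂ) (2 * R)) = 4 * volume (ball (x : ℂ) R) := by
          rw [Complex.volume_ball, Complex.volume_ball, ENNReal.ofReal_mul (by norm_num)]
          norm_num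
          ring
        rw [this, mul_comm, mul_assoc, ENNReal.mul_inv_cancel hv hv', mul_one]

lemma exists_ball_subset {x : D} {U : Set D} (hU : U ∈ 𝓝 x) :
    ∃ R, 0 < R ∧ ball (x : ℂ) (2 * R) ⊆ D ∧ ball x (2 * R) ⊆ U := by
  obtain ⟨r₁, hr₁, h₁⟩ := Metric.mem_nhds_iff.1 hU
  obtain ⟨r₂, hr₂, h₂⟩ := Metric.isOpen_iff.1 D.2 x x.2
  refine ⟨min r₁ r₂ / 2, by positivity, (ball_subset_ball ?_).trans h₂,
    (ball_subset_ball ?_).trans h₁⟩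
  · linarith [min_le_right r₁ r₂]
  · linarith [min_le_left r₁ r₂]

lemma tendsto_iSup_ball (x : D) {R : ℝ} (hR : 0 < R) {h : D → ℝ≥0∞} (hh : Continuous h) :
    Tendsto (fun k : ℕ => ⨆ z ∈ ball x (R / (k + 1)), h z) atTop (𝓝 (h x)) := by
  refine tendsto_order.2 ⟨fun a ha => Eventually.of_forall fun k => ha.trans_le ?_, fun a ha => ?_⟩
  · exact le_iSup₂ (f := fun (z : D) (_ : z ∈ ball x (R / (k + 1))) => h z) x
      (mem_ball_self (by positivity))
  · obtain ⟨c, hc1, hc2⟩ := exists_between ha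
    obtain ⟨δ, hδ, hball⟩ := Metric.mem_nhds_iff.1 (hh.continuousAt (Iio_mem_nhds hc1))
    have hlim : Tendsto (fun k : ℕ => R / ((k : ℝ) + 1)) atTop (𝓝 0) :=
      tendsto_const_div_atTop_nhds_zero_nat R |>.comp (tendsto_add_atTop_nat 1) |>.congr
        fun k => by simp
    filter_upwards [hlim.eventually (gt_mem_nhds hδ)] with k hk
    refine lt_of_le_of_lt (iSup₂_le fun z hz => ?_) hc2
    exact le_of_lt (hball (ball_subset_ball hk.le hz))

/-- On shrinking discs the supremum tends to the value at `x` by continuity. Dominated convergence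
applies because the supremum over the first disc is integrable, by the exchange of supremum and
expectation. -/
lemma exists_ball_lintegral_sum_iSup_lt_one [SFinite P] {m : ℕ} {Ξ : Fin m → Ω → HolSpace D}
    (hΞ : ∀ r, Measurable (Ξ r)) {x : D} {U : Set D} (hU : U ∈ 𝓝 x) {p : ℝ} (hp : 0 < p)
    (hfin : ∀ r, (⨆ z ∈ U, ∫⁻ ω, ‖Ξ r ω z‖ₑ ^ p ∂P) < ⊤)
    (hlt : ∫⁻ ω, ∑ r, ‖Ξ r ω x‖ₑ ^ p ∂P < 1) :
    ∃ R, 0 < R ∧ ball x R ⊆ U ∧ ∫⁻ ω, ∑ r, ⨆ z ∈ ball x R, ‖Ξ r ω z‖ₑ ^ p ∂P < 1 := by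
  obtain ⟨R, hR, hD, hRU⟩ := exists_ball_subset hU
  have hm : ∀ r (R : ℝ), Measurable fun ω => ⨆ z ∈ ball x R, ‖Ξ r ω z‖ₑ ^ p := fun r R =>
    (measurable_iSup_enorm_rpow _ p).comp (hΞ r)
  have hle : ∀ k : ℕ, R / ((k : ℝ) + 1) ≤ R := fun k => div_le_self hR.le (by linarith [k.cast_nonneg (α := ℝ)])
  have hlim := tendsto_lintegral_of_dominated_convergence (μ := P)
    (F := fun (k : ℕ) ω => ∑ r, ⨆ z ∈ ball x (R / (k + 1)), ‖Ξ r ω z‖ₑ ^ p)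
    (f := fun ω => ∑ r, ‖Ξ r ω x‖ₑ ^ p) (fun ω => ∑ r, ⨆ z ∈ ball x R, ‖Ξ r ω z‖ₑ ^ p)
    (fun k => Finset.measurable_fun_sum _ fun r _ => hm r _)
    (fun k => Eventually.of_forall fun ω => Finset.sum_le_sum fun r _ =>
      biSup_mono fun z hz => ball_subset_ball (hle k) hz) ?_
    (Eventually.of_forall fun ω => tendsto_finsetSum _ fun r _ =>
      tendsto_iSup_ball x hR (continuous_enorm_rpow _ p))
  · obtain ⟨k, hk⟩ := (hlim.eventually (gt_mem_nhds hlt)).exists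
    refine ⟨R / (k + 1), by positivity, (ball_subset_ball ?_).trans hRU, hk⟩
    linarith [hle k]
  · rw [lintegral_finsetSum _ fun r _ => hm r R]
    refine ENNReal.sum_ne_top.2 fun r _ => ne_of_lt ?_
    refine (lintegral_iSup_ball_le hR hp hD (hΞ r)).trans_lt (ENNReal.mul_lt_top (by norm_num) ?_)
    exact (biSup_mono fun z hz => hRU hz).trans_lt (hfin r)

/-- **Montel's theorem**: a locally bounded family of analytic functions is relatively compact. -/
lemma isCompact_closure_of_locally_bounded {S : Set (HolSpace D)}
    (hS : ∀ x : D, ∃ V ∈ 𝓝 x, ∃ B : ℝ, ∀ f ∈ S, ∀ z ∈ V, ‖f z‖ ≤ B) : IsCompact (closure S) := by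
  have hT2 : T2Space (UniformOnFun D ℂ {K : Set D | IsCompact K}) :=
    UniformOnFun.t2Space_of_covering (Set.eq_univ_iff_forall.2 fun x =>
      Set.mem_sUnion_of_mem (Set.mem_singleton x) isCompact_singleton)
  have hemb : IsClosedEmbedding ((UniformOnFun.ofFun {K : Set D | IsCompact K}) ∘
      fun (f : HolSpace D) (z : D) => f z) :=
    (ContinuousMap.isUniformEmbedding_toUniformOnFunIsCompact.isClosedEmbedding).comp
      (isClosed_analyticSubalgebra D).isClosedEmbedding_subtypeVal
  refine ArzelaAscoli.isCompact_closure_of_isClosedEmbedding (fun K hK => hK) hemb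
    (fun K _ => Equicontinuous.equicontinuousOn ?_ K) fun K _ x _ => ?_
  · intro x
    obtain ⟨V, hV, B, hB⟩ := hS x
    obtain ⟨R, hR, hRD, hRV⟩ := exists_ball_subset hV
    have hb : Tendsto (fun z : D => 2 * B / (2 * R) * dist z x) (𝓝 x) (𝓝 0) := by
      have : Continuous fun z : D => 2 * B / (2 * R) * dist z x := by fun_prop
      simpa using this.tendsto x
    refine Metric.equicontinuousAt_of_continuity_modulus _ hb _ ?_
    filter_upwards [ball_mem_nhds x (show 0 < 2 * R by positivity)] with z hz f
    obtain ⟨F, hF, hf⟩ := f.1.2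
    -- A function bounded by `B` maps the disc into a disc of radius `2B` about `F x`; the Schwarz
    -- lemma then gives a modulus of continuity common to the whole family.
    have hmaps : Set.MapsTo F (ball (x : ℂ) (2 * R)) (closedBall (F x) (2 * B)) := by
      intro w hw
      have h1 := hB f.1 f.2 ⟨w, hRD hw⟩ (hRV hw)
      have h2 := hB f.1 f.2 x (mem_of_mem_nhds hV)
      rw [hf] at h1 h2
      rw [mem_closedBall, dist_eq_norm]
      exact (norm_sub_le _ _).trans (by linarith)
    have := Complex.dist_le_div_mul_dist_of_mapsTo_ball ((hF.mono hRD).differentiableOn) hmaps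
      (show (z : ℂ) ∈ ball (x : ℂ) (2 * R) from hz)
    simp only [Function.comp_apply]
    rw [dist_comm, hf, hf]
    exact this
  · obtain ⟨V, hV, B, hB⟩ := hS x
    exact ⟨closedBall 0 B, isCompact_closedBall _ _, fun f hf => by
      simpa using hB f hf x (mem_of_mem_nhds hV)⟩

end HolSpace

/-! ### Tightness from local moments -/

namespace HolSpace

variable {D : Opens ℂ}

/-- Markov's inequality on each set of a countable subcover, with error budgets summing to less than
`ε`, leaves a locally bounded family, which is relatively compact by Montel. The exponent may vary
from point to point. -/
lemma isTightMeasureSet_of_moments {μ : ℕ → Measure (HolSpace D)}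
    (h : ∀ x : D, ∃ V ∈ 𝓝 x, ∃ p : ℝ, 0 < p ∧ ∃ C : ℝ≥0∞, C < ⊤ ∧
      ∀ n, ∫⁻ f, ⨆ z ∈ V, ‖f z‖ₑ ^ p ∂(μ n) ≤ C) :
    IsTightMeasureSet (Set.range μ) := by
  choose V hV p hp C hC hμ using h
  obtain ⟨s, hs, hcov⟩ := TopologicalSpace.countable_cover_nhds fun x => interior_mem_nhds.2 (hV x)
  have := hs.to_subtype
  rw [isTightMeasureSet_iff_exists_isCompact_measure_compl_le]
  intro ε hε
  obtain ⟨δ, hδ, hδε⟩ := ENNReal.exists_pos_sum_of_countable' hε.ne' s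
  have hδtop : ∀ x, δ x ≠ ⊤ := fun x => ((ENNReal.le_tsum x).trans_lt (hδε.trans_le le_top)).ne
  -- Markov's inequality at level `C / δ` yields probability at most `δ`; the added 1 keeps the
  -- level positive.
  let B : s → ℝ≥0∞ := fun x => C x / δ x + 1
  have hB : ∀ x, B x ≠ ⊤ := fun x =>
    ENNReal.add_ne_top.2 ⟨ENNReal.div_ne_top (hC x).ne (hδ x).ne', ENNReal.one_ne_top⟩
  let S : Set (HolSpace D) := {f | ∀ x : s, ⨆ z ∈ V x, ‖f z‖ₑ ^ p x < B x}
  refine ⟨closure S, isCompact_closure_of_locally_bounded fun y => ?_, ?_⟩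
  · obtain ⟨x, hxs, hyx⟩ := Set.mem_iUnion₂.1 (hcov.symm ▸ Set.mem_univ y)
    refine ⟨V x, mem_interior_iff_mem_nhds.1 hyx, (B ⟨x, hxs⟩ ^ (p x)⁻¹).toReal,
      fun f hf z hz => ?_⟩
    have h1 : ‖f z‖ₑ ^ p x ≤ B ⟨x, hxs⟩ :=
      (le_iSup₂ (f := fun (z : D) (_ : z ∈ V x) => ‖f z‖ₑ ^ p x) z hz).trans (hf ⟨x, hxs⟩).le
    have h2 : ‖f z‖ₑ ≤ B ⟨x, hxs⟩ ^ (p x)⁻¹ := (ENNReal.le_rpow_inv_iff (hp x)).2 h1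
    rw [← toReal_enorm]
    exact ENNReal.toReal_mono (ENNReal.rpow_ne_top_of_nonneg (inv_nonneg.2 (hp x).le) (hB _)) h2
  · rintro _ ⟨n, rfl⟩
    have hsub : (closure S)ᶜ ⊆ ⋃ x : s, {f | B x ≤ ⨆ z ∈ V x, ‖f z‖ₑ ^ p x} := by
      intro f hf
      have hfS : f ∉ S := fun h => hf (subset_closure h)
      simpa [S] using hfS
    calc μ n (closure S)ᶜ ≤ ∑' x : s, μ n {f | B x ≤ ⨆ z ∈ V x, ‖f z‖ₑ ^ p x} :=
          (measure_mono hsub).trans (measure_iUnion_le _)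
      _ ≤ ∑' x, δ x := by
          refine ENNReal.tsum_le_tsum fun x => ?_
          have hB0 : B x ≠ 0 := by simp [B]
          refine (meas_ge_le_lintegral_div (measurable_iSup_enorm_rpow _ _).aemeasurable hB0
            (hB x)).trans ?_
          refine ENNReal.div_le_of_le_mul ((hμ x n).trans ?_)
          simp only [B]
          rw [mul_add, ENNReal.mul_div_cancel (hδ x).ne' (hδtop x)]
          exact le_self_add
      _ ≤ ε := hδε.le

end HolSpace

/-! ### Plane waves, separation of laws and convergence criteria -/

/-- The plane wave `x ↦ exp (i Re ∑ t_k x_k)` on `ℂ^ι`. -/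
noncomputable def planeWave {ι : Type*} [Fintype ι] (t x : ι → ℂ) : ℂ :=
  Complex.exp (Complex.I * ((∑ k, t k * x k).re : ℝ))

namespace HolSpace

variable {D : Opens ℂ}

/-- The real bilinear pairing of analytic functions with finite combinations of points of `V`. -/
noncomputable def pairing (V : Set D) : HolSpace D →ₗ[ℝ] (V →₀ ℂ) →ₗ[ℝ] ℝ :=
  LinearMap.mk₂ ℝ (fun f w => (w.sum fun z c => c * f z).re)
    (fun f g w => by simp [mul_add, Finsupp.sum, Finset.sum_add_distrib])
    (fun a f w => by
      have : ∀ z : D, (a • f) z = a * f z := fun z => rfl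
      simp only [Finsupp.sum, this, Complex.re_sum, mul_left_comm _ (a : ℂ), Complex.re_ofReal_mul,
        smul_eq_mul, Finset.mul_sum])
    (fun f v w => by
      rw [Finsupp.sum_add_index' (by simp) (fun _ _ _ => by ring), Complex.add_re])
    (fun a f w => by
      rw [Finsupp.sum_smul_index' (by simp)]
      simp only [Finsupp.sum, Complex.re_sum, Complex.real_smul, mul_assoc, Complex.re_ofReal_mul,
        smul_eq_mul, Finset.mul_sum])

lemma pairing_apply (V : Set D) (f : HolSpace D) (w : V →₀ ℂ) :
    pairing V f w = (∑ k : w.support, w k * f k).re := by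
  simp only [pairing, LinearMap.mk₂_apply, Finsupp.sum]
  rw [Finset.sum_coe_sort w.support fun k => w k * f k]

lemma eq_zero_of_forall_mem (hD : IsConnected (D : Set ℂ)) {V : Set D} (hV : IsOpen V)
    (hne : V.Nonempty) {f : HolSpace D} (hf : ∀ z ∈ V, f z = 0) : f = 0 := by
  obtain ⟨x, hx⟩ := hne
  obtain ⟨F, hF, hfF⟩ := f.2
  have hev : F =ᶠ[𝓝 (x : ℂ)] 0 := by
    have h1 : ∀ᶠ z : D in 𝓝 x, F z = 0 := by
      filter_upwards [hV.mem_nhds hx] with z hz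
      rw [← hfF, hf z hz]
    exact (D.2.isOpenEmbedding_subtypeVal.map_nhds_eq x) ▸ h1
  have hall := hF.eqOn_zero_of_preconnected_of_eventuallyEq_zero hD.isPreconnected x.2 hev
  refine Subtype.ext (ContinuousMap.ext fun z => ?_)
  rw [hfF]
  exact hall z.2

lemma pairing_ne_zero (hD : IsConnected (D : Set ℂ)) {V : Set D} (hV : IsOpen V)
    (hne : V.Nonempty) (f : HolSpace D) (hf : f ≠ 0) : pairing V f ≠ 0 := by
  intro h
  refine hf (eq_zero_of_forall_mem hD hV hne fun z hz => ?_)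
  -- Testing at `z` with the weight `conj (f z)` turns the pairing into `|f z|²`.
  have h1 := DFunLike.congr_fun h (Finsupp.single ⟨z, hz⟩ ((starRingEnd ℂ) (f z)))
  simp only [pairing, LinearMap.mk₂_apply, LinearMap.zero_apply] at h1
  rw [Finsupp.sum_single_index (by simp), mul_comm, Complex.mul_conj] at h1
  simpa using h1

/-- With the discrete topology on the test combinations, joint continuity of the pairing reduces to
continuity in `f` for a fixed combination. -/
instance (V : Set D) : TopologicalSpace (V →₀ ℂ) := ⊥

instance (V : Set D) : DiscreteTopology (V →₀ ℂ) := ⟨rfl⟩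

lemma continuous_pairing (V : Set D) :
    Continuous fun p : HolSpace D × (V →₀ ℂ) => pairing V p.1 p.2 := by
  refine continuous_prod_of_discrete_right.2 fun w => ?_
  simp only [pairing_apply]
  exact Complex.continuous_re.comp (continuous_finsetSum _ fun k _ =>
    continuous_const.mul (continuous_apply _))

lemma char_pairing (V : Set D) (w : V →₀ ℂ) (f : HolSpace D) :
    BoundedContinuousFunction.char Real.continuous_probChar (continuous_pairing V) w f =
      planeWave (fun k : w.support => w k) (fun k => f k) := by
  rw [BoundedContinuousFunction.char_apply, pairing_apply, Real.probChar_apply, planeWave, mul_comm]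

/-- By the identity theorem the values on `V` already separate analytic functions on all of `D`, so
the characters built from finitely many points of `V` separate finite measures. -/
lemma ext_of_planeWave (hD : IsConnected (D : Set ℂ)) {V : Set D} (hV : IsOpen V)
    (hne : V.Nonempty) {μ ν : Measure (HolSpace D)} [IsFiniteMeasure μ] [IsFiniteMeasure ν]
    (h : ∀ (s : Finset V) (t : s → ℂ),
      ∫ f, planeWave t (fun k => f k) ∂μ = ∫ f, planeWave t (fun k => f k) ∂ν) : μ = ν := by
  let := upgradeIsCompletelyMetrizable (HolSpace D)
  refine ext_of_integral_char_eq Real.continuous_probChar Real.probChar_ne_one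
    (pairing_ne_zero hD hV hne) (continuous_pairing V) fun w => ?_
  simp_rw [char_pairing]
  exact h _ _

/-- Prokhorov supplies cluster points. Any two of them have the same plane-wave integrals, namely
the limits of the Cauchy sequences, so they coincide. -/
lemma exists_tendsto_of_planeWave (hD : IsConnected (D : Set ℂ)) {V : Set D} (hV : IsOpen V)
    (hne : V.Nonempty) {μ : ℕ → ProbabilityMeasure (HolSpace D)}
    (hμ : IsTightMeasureSet (Set.range fun n => (μ n : Measure (HolSpace D))))
    (h : ∀ (s : Finset V) (t : s → ℂ),
      CauchySeq fun n => ∫ f, planeWave t (fun k => f k) ∂(μ n : Measure (HolSpace D))) :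
    ∃ ν : ProbabilityMeasure (HolSpace D), Tendsto μ atTop (𝓝 ν) := by
  have hcomp : IsCompact (closure (Set.range μ)) := by
    refine isCompact_closure_of_isTightMeasureSet (hμ.subset ?_)
    rintro _ ⟨_, ⟨n, rfl⟩, rfl⟩
    exact ⟨n, rfl⟩
  have hclust : ∀ ν, MapClusterPt ν atTop μ → ∀ (s : Finset V) (t : s → ℂ),
      Tendsto (fun n => ∫ f, planeWave t (fun k => f k) ∂(μ n : Measure (HolSpace D))) atTop
        (𝓝 (∫ f, planeWave t (fun k => f k) ∂(ν : Measure (HolSpace D)))) := by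
    intro ν hν s t
    obtain ⟨c, hc⟩ := cauchySeq_tendsto_of_complete (h s t)
    have hcont : Continuous fun f : HolSpace D => planeWave t (fun k => f k) := by
      refine Complex.continuous_exp.comp (continuous_const.mul (Complex.continuous_ofReal.comp
        (Complex.continuous_re.comp (continuous_finsetSum _ fun k _ =>
          continuous_const.mul (continuous_apply _)))))
    let g : BoundedContinuousFunction (HolSpace D) ℂ :=
      BoundedContinuousFunction.ofNormedAddCommGroup _ hcont 1 fun f =>
        (Complex.norm_exp_I_mul_ofReal _).le
    have hg : Continuous fun ν : ProbabilityMeasure (HolSpace D) =>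
        ∫ f, g f ∂(ν : Measure (HolSpace D)) := continuous_iff_continuousAt.2 fun ν =>
      (ProbabilityMeasure.tendsto_iff_forall_integral_rclike_tendsto ℂ).1 tendsto_id g
    -- Along an ultrafilter converging to the cluster point, the integrals tend both to the integral
    -- under `ν` and to the full limit `c`.
    obtain ⟨U, hU, hUν⟩ := mapClusterPt_iff_ultrafilter.1 hν
    have h2 : ∫ f, g f ∂(ν : Measure (HolSpace D)) = c :=
      tendsto_nhds_unique ((hg.tendsto ν).comp hUν) (hc.mono_left hU)
    exact h2.symm ▸ hc
  obtain ⟨ν, -, hν⟩ := hcomp.exists_mapClusterPt_of_frequently (l := atTop) (f := μ)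
    (Frequently.of_forall fun n => subset_closure ⟨n, rfl⟩)
  refine ⟨ν, hcomp.tendsto_nhds_of_unique_mapClusterPt
    (Eventually.of_forall fun n => subset_closure ⟨n, rfl⟩) fun ν' _ hν' => Subtype.ext ?_⟩
  have hfin := ν'.2
  have hfin' := ν.2
  exact ext_of_planeWave hD hV hne fun s t =>
    tendsto_nhds_unique (hclust ν' hν' s t) (hclust ν hν s t)

end HolSpace

/-! ### Regularity of plane waves and comparison of products -/

section PlaneWave

variable {ι : Type*} [Fintype ι]

lemma norm_planeWave (t x : ι → ℂ) : ‖planeWave t x‖ = 1 := Complex.norm_exp_I_mul_ofReal _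

lemma planeWave_comm (t x : ι → ℂ) : planeWave t x = planeWave x t := by
  simp [planeWave, mul_comm]

lemma planeWave_add_right (t x y : ι → ℂ) : planeWave t (x + y) = planeWave t x * planeWave t y := by
  simp [planeWave, mul_add, Finset.sum_add_distrib, Complex.exp_add]

lemma planeWave_zero_right (t : ι → ℂ) : planeWave t 0 = 1 := by simp [planeWave]

lemma planeWave_sum_right {κ : Type*} (s : Finset κ) (t : ι → ℂ) (x : κ → ι → ℂ) :
    planeWave t (∑ r ∈ s, x r) = ∏ r ∈ s, planeWave t (x r) := by
  classical
  induction s using Finset.induction_on with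
  | empty => simp [planeWave_zero_right]
  | insert r s hr ih => rw [Finset.sum_insert hr, Finset.prod_insert hr, planeWave_add_right, ih]

lemma planeWave_mul_right (t a x : ι → ℂ) : planeWave t (a * x) = planeWave (t * a) x := by
  simp [planeWave, mul_assoc]

lemma continuous_planeWave : Continuous fun p : (ι → ℂ) × (ι → ℂ) => planeWave p.1 p.2 := by
  unfold planeWave
  fun_prop

lemma enorm_apply_le (t : ι → ℂ) (k : ι) : ‖t k‖ₑ ≤ ‖t‖ₑ := by
  rw [← ofReal_norm, ← ofReal_norm]
  exact ENNReal.ofReal_le_ofReal (norm_le_pi_norm t k)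

lemma enorm_re_sum_le (t x : ι → ℂ) :
    ‖(∑ k, t k * x k).re‖ₑ ≤ Fintype.card ι * (‖t‖ₑ * ‖x‖ₑ) := by
  calc ‖(∑ k, t k * x k).re‖ₑ ≤ ‖∑ k, t k * x k‖ₑ := by
        rw [← ofReal_norm, ← ofReal_norm]
        exact ENNReal.ofReal_le_ofReal (Complex.abs_re_le_norm _)
    _ ≤ ∑ k, ‖t k * x k‖ₑ := enorm_sum_le _ _
    _ ≤ ∑ _k : ι, ‖t‖ₑ * ‖x‖ₑ := by
        gcongr with k
        rw [enorm_mul]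
        gcongr
        · exact enorm_apply_le t k
        · exact enorm_apply_le x k
    _ = _ := by simp

lemma enorm_planeWave_sub_le {p : ℝ} (hp : 0 < p) (hp1 : p ≤ 1) (t t' x : ι → ℂ) :
    ‖planeWave t x - planeWave t' x‖ₑ ≤ 3 * (Fintype.card ι * (‖t - t'‖ₑ * ‖x‖ₑ)) ^ p := by
  have h1 : planeWave t x - planeWave t' x = planeWave t' x * (planeWave (t - t') x - 1) := by
    have : planeWave t x = planeWave t' x * planeWave (t - t') x := by
      rw [planeWave_comm t', planeWave_comm (t - t'), ← planeWave_add_right, planeWave_comm]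
      congr 1; ring
    rw [this]; ring
  have h2 : ‖planeWave t' x‖ₑ = 1 := by rw [← ofReal_norm, norm_planeWave]; simp
  rw [h1, enorm_mul, h2, one_mul]
  refine le_trans ?_ (mul_le_mul_right (ENNReal.rpow_le_rpow (enorm_re_sum_le (t - t') x) hp.le) 3)
  rw [enorm_rpow_eq_ofReal _ hp.le, ← ofReal_norm,
    show (3 : ℝ≥0∞) = ENNReal.ofReal 3 by norm_num, ← ENNReal.ofReal_mul (by norm_num)]
  exact ENNReal.ofReal_le_ofReal (norm_exp_I_mul_sub_one_le_rpow hp hp1 _)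

end PlaneWave

/-- Telescoping: the factors are exchanged one at a time, the others having modulus at most 1. -/
lemma norm_mul_prod_sub_mul_prod_le {κ : Type*} (s : Finset κ) {z z' : ℂ} {w w' : κ → ℂ}
    (hz : ‖z‖ ≤ 1) (hw : ∀ r, ‖w r‖ ≤ 1) (hw' : ∀ r, ‖w' r‖ ≤ 1) :
    ‖z * ∏ r ∈ s, w r - z' * ∏ r ∈ s, w' r‖ ≤ ‖z - z'‖ + ∑ r ∈ s, ‖w r - w' r‖ := by
  classical
  induction s using Finset.induction_on with
  | empty => simp
  | insert r s hr ih =>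
    have hprod : ∀ {z : ℂ} {w : κ → ℂ}, ‖z‖ ≤ 1 → (∀ r, ‖w r‖ ≤ 1) → ‖z * ∏ r ∈ s, w r‖ ≤ 1 := by
      intro z w hz hw
      rw [norm_mul, norm_prod]
      exact mul_le_one₀ hz (Finset.prod_nonneg fun _ _ => norm_nonneg _)
        (Finset.prod_le_one (fun _ _ => norm_nonneg _) fun r _ => hw r)
    rw [Finset.prod_insert hr, Finset.prod_insert hr, Finset.sum_insert hr]
    calc _ = ‖(w r - w' r) * (z * ∏ r ∈ s, w r) +
          w' r * (z * ∏ r ∈ s, w r - z' * ∏ r ∈ s, w' r)‖ := by congr 1; ring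
      _ ≤ ‖w r - w' r‖ * 1 + 1 * ‖z * ∏ r ∈ s, w r - z' * ∏ r ∈ s, w' r‖ := by
          refine (norm_add_le _ _).trans ?_
          rw [norm_mul, norm_mul (w' r)]
          exact add_le_add (mul_le_mul_of_nonneg_left (hprod hz hw) (norm_nonneg _))
            (mul_le_mul_of_nonneg_right (hw' r) (norm_nonneg _))
      _ ≤ _ := by linarith

section Compare

variable {Ω : Type*} [MeasurableSpace Ω] {P : Measure Ω} {m : ℕ}

lemma enorm_integral_mul_prod_sub_le [IsProbabilityMeasure P] {z z' : Ω → ℂ} {w w' : Fin m → Ω → ℂ}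
    (hzm : Measurable z) (hzm' : Measurable z') (hwm : ∀ r, Measurable (w r))
    (hwm' : ∀ r, Measurable (w' r)) (hz : ∀ ω, ‖z ω‖ ≤ 1) (hz' : ∀ ω, ‖z' ω‖ ≤ 1)
    (hw : ∀ r ω, ‖w r ω‖ ≤ 1) (hw' : ∀ r ω, ‖w' r ω‖ ≤ 1) :
    ‖∫ ω, z ω * ∏ r, w r ω ∂P - ∫ ω, z' ω * ∏ r, w' r ω ∂P‖ₑ ≤
      ∫⁻ ω, ‖z ω - z' ω‖ₑ ∂P + ∑ r, ∫⁻ ω, ‖w r ω - w' r ω‖ₑ ∂P := by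
  have hint : ∀ {z : Ω → ℂ} {w : Fin m → Ω → ℂ}, Measurable z → (∀ r, Measurable (w r)) →
      (∀ ω, ‖z ω‖ ≤ 1) → (∀ r ω, ‖w r ω‖ ≤ 1) → Integrable (fun ω => z ω * ∏ r, w r ω) P := by
    intro z w hzm hwm hz hw
    refine Integrable.of_bound (hzm.mul (Finset.measurable_fun_prod _ fun r _ =>
      hwm r)).aestronglyMeasurable 1 (Eventually.of_forall fun ω => ?_)
    rw [norm_mul, norm_prod]
    exact mul_le_one₀ (hz ω) (Finset.prod_nonneg fun _ _ => norm_nonneg _)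
      (Finset.prod_le_one (fun _ _ => norm_nonneg _) fun r _ => hw r ω)
  rw [← integral_sub (hint hzm hwm hz hw) (hint hzm' hwm' hz' hw')]
  refine (enorm_integral_le_lintegral_enorm _).trans ?_
  have h1 : Measurable fun ω => ‖z ω - z' ω‖ₑ := (hzm.sub hzm').enorm
  have h2 : ∀ r, Measurable fun ω => ‖w r ω - w' r ω‖ₑ := fun r => ((hwm r).sub (hwm' r)).enorm
  rw [← lintegral_finsetSum _ fun r _ => h2 r, ← lintegral_add_left h1]
  refine lintegral_mono fun ω => ?_
  have := norm_mul_prod_sub_mul_prod_le Finset.univ (z' := z' ω) (hz ω) (fun r => hw r ω)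
    (fun r => hw' r ω)
  simp only [← ofReal_norm]
  rw [← ENNReal.ofReal_sum_of_nonneg (fun _ _ => norm_nonneg _), ← ENNReal.ofReal_add
    (norm_nonneg _) (Finset.sum_nonneg fun _ _ => norm_nonneg _)]
  exact ENNReal.ofReal_le_ofReal this

/-- A nonnegative function of order `‖t‖ ^ s` that is dominated by its average over contracting
random weights vanishes. -/
lemma eq_zero_of_le_sum_lintegral {ι : Type*} [Fintype ι] {a : Fin m → Ω → ι → ℂ} {s : ℝ}
    (hs : 0 < s) (ham : ∀ r, Measurable (a r)) (ha : ∑ r, ∫⁻ ω, ‖a r ω‖ₑ ^ s ∂P < 1)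
    {g : (ι → ℂ) → ℝ≥0∞} {K : ℝ≥0∞} (hK : K ≠ ⊤) (hgK : ∀ t, g t ≤ K * ‖t‖ₑ ^ s)
    (hg : ∀ t, g t ≤ ∑ r, ∫⁻ ω, g (t * a r ω) ∂P) (t : ι → ℂ) : g t = 0 := by
  set ξ := ∑ r, ∫⁻ ω, ‖a r ω‖ₑ ^ s ∂P
  -- Every iteration of the inequality inserts one more independent weight and gains a factor `ξ`
  -- from the homogeneity of `‖·‖ ^ s`.
  have hit : ∀ k : ℕ, ∀ t, g t ≤ ξ ^ k * (K * ‖t‖ₑ ^ s) := by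
    intro k
    induction k with
    | zero => simpa using hgK
    | succ k ih =>
      intro t
      calc g t ≤ ∑ r, ∫⁻ ω, g (t * a r ω) ∂P := hg t
        _ ≤ ∑ r, ∫⁻ ω, ξ ^ k * (K * ‖t‖ₑ ^ s) * ‖a r ω‖ₑ ^ s ∂P := by
            gcongr with r _ ω
            refine (ih _).trans ?_
            rw [mul_assoc, mul_assoc, ← ENNReal.mul_rpow_of_nonneg _ _ hs.le]
            gcongr
            rw [← ofReal_norm, ← ofReal_norm, ← ofReal_norm, ← ENNReal.ofReal_mul (norm_nonneg _)]
            exact ENNReal.ofReal_le_ofReal (norm_mul_le _ _)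
        _ = ξ ^ (k + 1) * (K * ‖t‖ₑ ^ s) := by
            have : ∀ r, ∫⁻ ω, ξ ^ k * (K * ‖t‖ₑ ^ s) * ‖a r ω‖ₑ ^ s ∂P =
                ξ ^ k * (K * ‖t‖ₑ ^ s) * ∫⁻ ω, ‖a r ω‖ₑ ^ s ∂P := fun r =>
              lintegral_const_mul _ ((ham r).enorm.pow_const s)
            rw [Finset.sum_congr rfl fun r _ => this r, ← Finset.mul_sum, pow_succ]
            ring
  have hlim : Tendsto (fun k : ℕ => ξ ^ k * (K * ‖t‖ₑ ^ s)) atTop (𝓝 (0 * (K * ‖t‖ₑ ^ s))) :=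
    ENNReal.Tendsto.mul_const (ENNReal.tendsto_pow_atTop_nhds_zero_of_lt_one ha)
      (Or.inr (ENNReal.mul_ne_top hK (ENNReal.rpow_ne_top_of_nonneg hs.le enorm_ne_top)))
  rw [zero_mul] at hlim
  exact le_antisymm (ge_of_tendsto' hlim fun k => hit k t) zero_le

end Compare

/-! ### Contraction for sequences of characteristic functions -/

/-- A sequence of characteristic functions `φ n` on `ℂ^ι` solving the recursion obtained from
`X_n =ᵈ ∑_r A_r X_{I_r} + b`, with coefficients that converge to contracting ones. -/
structure IsCharRecursion {Ω : Type*} [MeasurableSpace Ω] (P : Measure Ω) {ι : Type*} [Fintype ι]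
    {m : ℕ} (n₀ : ℕ) (φ : ℕ → (ι → ℂ) → ℂ) (a : ℕ → Fin m → Ω → ι → ℂ) (b : ℕ → Ω → ι → ℂ)
    (I : ℕ → Fin m → Ω → ℕ) (a' : Fin m → Ω → ι → ℂ) (b' : Ω → ι → ℂ) (s p : ℝ) (K : ℝ≥0∞) :
    Prop where
  pos : 0 < s
  p_pos : 0 < p
  p_le_one : p ≤ 1
  K_ne_top : K ≠ ⊤
  norm_le : ∀ n t, ‖φ n t‖ ≤ 1
  enorm_sub_le : ∀ n t t', ‖φ n t - φ n t'‖ₑ ≤ K * ‖t - t'‖ₑ ^ p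
  enorm_sub_one_le : ∀ n t, ‖φ n t - 1‖ₑ ≤ K * ‖t‖ₑ ^ s
  measurable_a : ∀ n, n₀ ≤ n → ∀ r, Measurable (a n r)
  measurable_b : ∀ n, n₀ ≤ n → Measurable (b n)
  measurable_I : ∀ n, n₀ ≤ n → ∀ r, Measurable (I n r)
  measurable_a' : ∀ r, Measurable (a' r)
  measurable_b' : Measurable b'
  recursion : ∀ n, n₀ ≤ n → ∀ t,
    φ n t = ∫ ω, planeWave t (b n ω) * ∏ r, φ (I n r ω) (t * a n r ω) ∂P
  tendsto_a : ∀ r, Tendsto (fun n => ∫⁻ ω, ‖a n r ω - a' r ω‖ₑ ^ p ∂P) atTop (𝓝 0)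
  tendsto_b : Tendsto (fun n => ∫⁻ ω, ‖b n ω - b' ω‖ₑ ^ p ∂P) atTop (𝓝 0)
  contraction : ∑ r, ∫⁻ ω, ‖a' r ω‖ₑ ^ s ∂P < 1
  tendsto_small : ∀ ℓ r, Tendsto (fun n => ∫⁻ ω in {ω | I n r ω ≤ ℓ}, ‖a' r ω‖ₑ ^ s ∂P) atTop (𝓝 0)

namespace IsCharRecursion

section Oscillation

variable {ι : Type*} {φ : ℕ → (ι → ℂ) → ℂ}

/-- The tail oscillation of the sequence `φ`. -/
noncomputable def osc (φ : ℕ → (ι → ℂ) → ℂ) (ℓ : ℕ) (t : ι → ℂ) : ℝ≥0∞ :=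
  ⨆ (j ≥ ℓ) (k ≥ ℓ), ‖φ j t - φ k t‖ₑ

lemma le_osc {ℓ j k : ℕ} (hj : ℓ ≤ j) (hk : ℓ ≤ k) (t : ι → ℂ) :
    ‖φ j t - φ k t‖ₑ ≤ osc φ ℓ t :=
  le_trans (le_iSup₂ (f := fun k (_ : k ≥ ℓ) => ‖φ j t - φ k t‖ₑ) k hk)
    (le_iSup₂ (f := fun j (_ : j ≥ ℓ) => ⨆ k ≥ ℓ, ‖φ j t - φ k t‖ₑ) j hj)

lemma antitone_osc : Antitone (osc φ) := fun _ _ hℓ t =>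
  iSup₂_le fun _ hj => iSup₂_le fun _ hk => le_osc (hℓ.trans hj) (hℓ.trans hk) t

end Oscillation

variable {Ω : Type*} [MeasurableSpace Ω] {P : Measure Ω} {ι : Type*} [Fintype ι]
  {m n₀ : ℕ} {φ : ℕ → (ι → ℂ) → ℂ} {a : ℕ → Fin m → Ω → ι → ℂ} {b : ℕ → Ω → ι → ℂ}
  {I : ℕ → Fin m → Ω → ℕ} {a' : Fin m → Ω → ι → ℂ} {b' : Ω → ι → ℂ} {s p : ℝ} {K : ℝ≥0∞}

lemma measurable_phi (h : IsCharRecursion P n₀ φ a b I a' b' s p K) (n : ℕ) :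
    Measurable (φ n) := by
  refine Continuous.measurable (continuous_iff_continuousAt.2 fun t => ?_)
  refine tendsto_iff_edist_tendsto_0.2 ?_
  have hlim : Tendsto (fun t' : ι → ℂ => K * ‖t' - t‖ₑ ^ p) (𝓝 t) (𝓝 (K * ‖t - t‖ₑ ^ p)) := by
    refine ENNReal.Tendsto.const_mul ?_ (Or.inr h.K_ne_top)
    exact ((ENNReal.continuous_rpow_const.comp (by fun_prop : Continuous fun t' : ι → ℂ =>
      ‖t' - t‖ₑ)).tendsto t)
  simp only [sub_self, enorm_zero, ENNReal.zero_rpow_of_pos h.p_pos, mul_zero] at hlim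
  exact tendsto_of_tendsto_of_tendsto_of_le_of_le tendsto_const_nhds hlim (fun _ => zero_le)
    fun t' => by simpa only [edist_eq_enorm_sub] using h.enorm_sub_le n t' t

lemma measurable_comp (h : IsCharRecursion P n₀ φ a b I a' b' s p K) {i : Ω → ℕ}
    (hi : Measurable i) {c : Ω → ι → ℂ} (hc : Measurable c) (t : ι → ℂ) :
    Measurable fun ω => φ (i ω) (t * c ω) := by
  refine measurable_apply_index (y := fun ω j => φ j (t * c ω)) hi ?_
  exact measurable_pi_lambda _ fun j => (h.measurable_phi j).comp (measurable_const.mul hc)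

lemma measurable_wave {b : Ω → ι → ℂ} (hb : Measurable b) (t : ι → ℂ) :
    Measurable fun ω => planeWave t (b ω) :=
  (continuous_planeWave.comp (.prodMk_right t)).measurable.comp hb

/-- The recursion with the limiting coefficients. -/
noncomputable def frozen (P : Measure Ω) (φ : ℕ → (ι → ℂ) → ℂ) (I : ℕ → Fin m → Ω → ℕ)
    (a' : Fin m → Ω → ι → ℂ) (b' : Ω → ι → ℂ) (n : ℕ) (t : ι → ℂ) : ℂ :=
  ∫ ω, planeWave t (b' ω) * ∏ r, φ (I n r ω) (t * a' r ω) ∂P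

lemma enorm_mul_le (t x : ι → ℂ) : ‖t * x‖ₑ ≤ ‖t‖ₑ * ‖x‖ₑ := by
  rw [← ofReal_norm, ← ofReal_norm, ← ofReal_norm, ← ENNReal.ofReal_mul (norm_nonneg _)]
  exact ENNReal.ofReal_le_ofReal (norm_mul_le _ _)

/-- The Hölder modulus of `φ j` is uniform in `j`, so replacing the coefficients by their limits is
harmless whatever the random indices are. -/
lemma tendsto_sub_frozen [IsProbabilityMeasure P] (h : IsCharRecursion P n₀ φ a b I a' b' s p K)
    (t : ι → ℂ) : Tendsto (fun n => ‖φ n t - frozen P φ I a' b' n t‖ₑ) atTop (𝓝 0) := by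
  have hp := h.p_pos
  have hbound : Tendsto (fun n => 3 * (Fintype.card ι * ‖t‖ₑ) ^ p *
      ∫⁻ ω, ‖b n ω - b' ω‖ₑ ^ p ∂P +
      ∑ r, K * ‖t‖ₑ ^ p * ∫⁻ ω, ‖a n r ω - a' r ω‖ₑ ^ p ∂P) atTop (𝓝 0) := by
    have h1 := ENNReal.Tendsto.const_mul (a := 3 * (Fintype.card ι * ‖t‖ₑ) ^ p) h.tendsto_b
      (Or.inr (ENNReal.mul_ne_top (by norm_num) (ENNReal.rpow_ne_top_of_nonneg hp.le
        (ENNReal.mul_ne_top (by simp) enorm_ne_top))))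
    have h2 : ∀ r, Tendsto (fun n => K * ‖t‖ₑ ^ p * ∫⁻ ω, ‖a n r ω - a' r ω‖ₑ ^ p ∂P) atTop
        (𝓝 (K * ‖t‖ₑ ^ p * 0)) := fun r => ENNReal.Tendsto.const_mul (h.tendsto_a r)
      (Or.inr (ENNReal.mul_ne_top h.K_ne_top (ENNReal.rpow_ne_top_of_nonneg hp.le enorm_ne_top)))
    simpa using h1.add (tendsto_finsetSum Finset.univ fun r _ => h2 r)
  refine tendsto_of_tendsto_of_tendsto_of_le_of_le' tendsto_const_nhds hbound
    (Eventually.of_forall fun _ => zero_le) ?_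
  filter_upwards [eventually_ge_atTop n₀] with n hn
  have hdb : Measurable fun ω => ‖b n ω - b' ω‖ₑ ^ p :=
    ((h.measurable_b n hn).sub h.measurable_b').enorm.pow_const p
  have hda : ∀ r, Measurable fun ω => ‖a n r ω - a' r ω‖ₑ ^ p := fun r =>
    ((h.measurable_a n hn r).sub (h.measurable_a' r)).enorm.pow_const p
  rw [h.recursion n hn, frozen]
  refine (enorm_integral_mul_prod_sub_le (measurable_wave (h.measurable_b n hn) t)
    (measurable_wave h.measurable_b' t)
    (fun r => h.measurable_comp (h.measurable_I n hn r) (h.measurable_a n hn r) t)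
    (fun r => h.measurable_comp (h.measurable_I n hn r) (h.measurable_a' r) t)
    (fun ω => (norm_planeWave _ _).le) (fun ω => (norm_planeWave _ _).le)
    (fun r ω => h.norm_le _ _) (fun r ω => h.norm_le _ _)).trans ?_
  refine add_le_add ?_ (Finset.sum_le_sum fun r _ => ?_)
  · rw [← lintegral_const_mul _ hdb]
    refine lintegral_mono fun ω => ?_
    rw [planeWave_comm t, planeWave_comm t]
    refine (enorm_planeWave_sub_le hp h.p_le_one _ _ _).trans (le_of_eq ?_)
    rw [mul_assoc, ← ENNReal.mul_rpow_of_nonneg _ _ hp.le]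
    ring_nf
  · rw [← lintegral_const_mul _ (hda r)]
    refine lintegral_mono fun ω => ?_
    refine (h.enorm_sub_le _ _ _).trans ?_
    rw [← mul_sub, mul_assoc, ← ENNReal.mul_rpow_of_nonneg _ _ hp.le]
    gcongr
    exact enorm_mul_le _ _

lemma measurable_osc (h : IsCharRecursion P n₀ φ a b I a' b' s p K) (ℓ : ℕ) :
    Measurable (osc φ ℓ) :=
  Measurable.iSup fun j => Measurable.iSup fun _ => Measurable.iSup fun k =>
    Measurable.iSup fun _ => ((h.measurable_phi j).sub (h.measurable_phi k)).enorm

lemma enorm_sub_le_two_mul (h : IsCharRecursion P n₀ φ a b I a' b' s p K) (j k : ℕ)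
    (t : ι → ℂ) : ‖φ j t - φ k t‖ₑ ≤ 2 * K * ‖t‖ₑ ^ s := by
  calc ‖φ j t - φ k t‖ₑ = ‖(φ j t - 1) - (φ k t - 1)‖ₑ := by congr 1; ring
    _ ≤ ‖φ j t - 1‖ₑ + ‖φ k t - 1‖ₑ := _root_.enorm_sub_le
    _ ≤ K * ‖t‖ₑ ^ s + K * ‖t‖ₑ ^ s := add_le_add (h.enorm_sub_one_le _ _) (h.enorm_sub_one_le _ _)
    _ = _ := by ring

lemma osc_le_two_mul (h : IsCharRecursion P n₀ φ a b I a' b' s p K) (ℓ : ℕ) (t : ι → ℂ) :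
    osc φ ℓ t ≤ 2 * K * ‖t‖ₑ ^ s :=
  iSup₂_le fun _ _ => iSup₂_le fun _ _ => h.enorm_sub_le_two_mul _ _ _

lemma osc_le_two (h : IsCharRecursion P n₀ φ a b I a' b' s p K) (ℓ : ℕ) (t : ι → ℂ) :
    osc φ ℓ t ≤ 2 := by
  refine iSup₂_le fun j _ => iSup₂_le fun k _ => _root_.enorm_sub_le.trans ?_
  have : ∀ j, ‖φ j t‖ₑ ≤ 1 := fun j => by
    rw [← ofReal_norm, ← ENNReal.ofReal_one]; exact ENNReal.ofReal_le_ofReal (h.norm_le j t)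
  calc _ ≤ (1 : ℝ≥0∞) + 1 := add_le_add (this j) (this k)
    _ = 2 := by norm_num

/-- Up to an error that vanishes as `n → ∞`, `φ (I n r ω)` differs from any tail limit by at most
the tail oscillation. -/
lemma lintegral_enorm_sub_le (h : IsCharRecursion P n₀ φ a b I a' b' s p K) {n : ℕ} (hn : n₀ ≤ n)
    (r : Fin m) (ℓ : ℕ) (t : ι → ℂ) (ψ : Ω → (ι → ℂ) → ℂ)
    (hψ : ∀ ω u j, ‖φ j u - ψ ω u‖ₑ ≤ 2 * K * ‖u‖ₑ ^ s) (E : Set Ω) (hE : MeasurableSet E)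
    (hψ' : ∀ ω ∉ E, ∀ u j, ℓ ≤ j → ‖φ j u - ψ ω u‖ₑ ≤ osc φ ℓ u) :
    ∫⁻ ω, ‖φ (I n r ω) (t * a' r ω) - ψ ω (t * a' r ω)‖ₑ ∂P ≤
      ∫⁻ ω, osc φ ℓ (t * a' r ω) ∂P + 2 * K * ‖t‖ₑ ^ s *
        (∫⁻ ω in {ω | I n r ω ≤ ℓ}, ‖a' r ω‖ₑ ^ s ∂P + ∫⁻ ω in E, ‖a' r ω‖ₑ ^ s ∂P) := by
  have hIm : MeasurableSet {ω | I n r ω ≤ ℓ} := h.measurable_I n hn r measurableSet_Iic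
  have hm : Measurable fun ω => ‖a' r ω‖ₑ ^ s := (h.measurable_a' r).enorm.pow_const s
  have hsum : Measurable fun ω => {ω | I n r ω ≤ ℓ}.indicator (fun ω => ‖a' r ω‖ₑ ^ s) ω +
      E.indicator (fun ω => ‖a' r ω‖ₑ ^ s) ω := (hm.indicator hIm).add (hm.indicator hE)
  have hosc : Measurable fun ω => osc φ ℓ (t * a' r ω) :=
    (h.measurable_osc ℓ).comp (measurable_const.mul (h.measurable_a' r))
  rw [← lintegral_indicator hIm, ← lintegral_indicator hE,
    ← lintegral_add_left (hm.indicator hIm), ← lintegral_const_mul _ hsum, ← lintegral_add_left hosc]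
  refine lintegral_mono fun ω => ?_
  -- Where an index is small, the oscillation gives no control. Flatness at the origin still bounds
  -- the difference by `‖a'‖ ^ s`, whose integral over that event is negligible.
  have hcrude : ‖φ (I n r ω) (t * a' r ω) - ψ ω (t * a' r ω)‖ₑ ≤
      2 * K * ‖t‖ₑ ^ s * ‖a' r ω‖ₑ ^ s := by
    refine (hψ _ _ _).trans ?_
    rw [mul_assoc (2 * K), ← ENNReal.mul_rpow_of_nonneg _ _ h.pos.le]
    have := h.pos.le
    gcongr
    exact enorm_mul_le _ _
  by_cases hω : I n r ω ≤ ℓ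
  · refine hcrude.trans (le_add_left ?_)
    gcongr
    simp [hω]
  · by_cases hωE : ω ∈ E
    · refine hcrude.trans (le_add_left ?_)
      gcongr
      simp [hωE]
    · exact (hψ' ω hωE _ _ (not_le.1 hω).le).trans le_self_add

lemma enorm_frozen_sub_frozen_le [IsProbabilityMeasure P]
    (h : IsCharRecursion P n₀ φ a b I a' b' s p K) {n k : ℕ} (hn : n₀ ≤ n) (hk : n₀ ≤ k) (ℓ : ℕ)
    (t : ι → ℂ) :
    ‖frozen P φ I a' b' n t - frozen P φ I a' b' k t‖ₑ ≤ ∑ r, (∫⁻ ω, osc φ ℓ (t * a' r ω) ∂P +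
      2 * K * ‖t‖ₑ ^ s * (∫⁻ ω in {ω | I n r ω ≤ ℓ}, ‖a' r ω‖ₑ ^ s ∂P +
        ∫⁻ ω in {ω | I k r ω ≤ ℓ}, ‖a' r ω‖ₑ ^ s ∂P)) := by
  refine (enorm_integral_mul_prod_sub_le (measurable_wave h.measurable_b' t)
    (measurable_wave h.measurable_b' t)
    (fun r => h.measurable_comp (h.measurable_I n hn r) (h.measurable_a' r) t)
    (fun r => h.measurable_comp (h.measurable_I k hk r) (h.measurable_a' r) t)
    (fun ω => (norm_planeWave _ _).le) (fun ω => (norm_planeWave _ _).le)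
    (fun r ω => h.norm_le _ _) (fun r ω => h.norm_le _ _)).trans ?_
  simp only [sub_self, enorm_zero, lintegral_zero, zero_add]
  refine Finset.sum_le_sum fun r _ => ?_
  refine h.lintegral_enorm_sub_le hn r ℓ t (fun ω => φ (I k r ω))
    (fun ω u j => h.enorm_sub_le_two_mul _ _ _) _ (h.measurable_I k hk r measurableSet_Iic) ?_
  intro ω hω u j hj
  exact le_osc hj (not_le.1 hω).le u

lemma tendsto_lintegral_osc [IsProbabilityMeasure P]
    (h : IsCharRecursion P n₀ φ a b I a' b' s p K) (r : Fin m) (t : ι → ℂ) :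
    Tendsto (fun ℓ => ∫⁻ ω, osc φ ℓ (t * a' r ω) ∂P) atTop
      (𝓝 (∫⁻ ω, ⨅ ℓ, osc φ ℓ (t * a' r ω) ∂P)) := by
  have hm : ∀ ℓ, Measurable fun ω => osc φ ℓ (t * a' r ω) := fun ℓ =>
    (h.measurable_osc ℓ).comp (measurable_const.mul (h.measurable_a' r))
  refine tendsto_lintegral_of_dominated_convergence (fun _ => 2) hm
    (fun ℓ => Eventually.of_forall fun ω => h.osc_le_two ℓ _) (by simp)
    (Eventually.of_forall fun ω => tendsto_atTop_iInf fun ℓ ℓ' hℓ => antitone_osc hℓ _)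

/-- The core of the contraction method. Comparing the frozen recursions at two large times bounds
the oscillation at `t` by its average at the contracted arguments. The limiting oscillation is then
a subsolution of order `‖t‖ ^ s` and vanishes by iteration. -/
lemma iInf_osc_eq_zero [IsProbabilityMeasure P] (h : IsCharRecursion P n₀ φ a b I a' b' s p K)
    (t : ι → ℂ) : ⨅ ℓ, osc φ ℓ t = 0 := by
  have hK2 : (2 : ℝ≥0∞) * K ≠ ⊤ := ENNReal.mul_ne_top (by norm_num) h.K_ne_top
  refine eq_zero_of_le_sum_lintegral h.pos h.measurable_a' h.contraction (K := 2 * K) hK2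
    (g := fun t => ⨅ ℓ, osc φ ℓ t) (fun t => (iInf_le _ 0).trans (h.osc_le_two_mul 0 t)) ?_ t
  intro t
  -- The limits are taken in this order: with `ℓ` fixed, both times go to infinity and remove the
  -- errors; only then does `ℓ` grow.
  refine ge_of_tendsto' (tendsto_finsetSum Finset.univ fun r _ => h.tendsto_lintegral_osc r t)
    fun ℓ => ?_
  let err : ℕ → ℝ≥0∞ := fun n => ‖φ n t - frozen P φ I a' b' n t‖ₑ +
    ∑ r, 2 * K * ‖t‖ₑ ^ s * ∫⁻ ω in {ω | I n r ω ≤ ℓ}, ‖a' r ω‖ₑ ^ s ∂P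
  have herr : Tendsto err atTop (𝓝 0) := by
    have h2 : ∀ r, Tendsto (fun n => 2 * K * ‖t‖ₑ ^ s *
        ∫⁻ ω in {ω | I n r ω ≤ ℓ}, ‖a' r ω‖ₑ ^ s ∂P) atTop (𝓝 (2 * K * ‖t‖ₑ ^ s * 0)) := fun r =>
      ENNReal.Tendsto.const_mul (h.tendsto_small ℓ r) (Or.inr (ENNReal.mul_ne_top hK2
        (ENNReal.rpow_ne_top_of_nonneg h.pos.le enorm_ne_top)))
    simpa using (h.tendsto_sub_frozen t).add (tendsto_finsetSum Finset.univ fun r _ => h2 r)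
  have hpair : ∀ n k, n₀ ≤ n → n₀ ≤ k → ‖φ n t - φ k t‖ₑ ≤
      ∑ r, ∫⁻ ω, osc φ ℓ (t * a' r ω) ∂P + (err n + err k) := by
    intro n k hn hk
    set Gn := frozen P φ I a' b' n t
    set Gk := frozen P φ I a' b' k t
    calc ‖φ n t - φ k t‖ₑ = ‖(φ n t - Gn) + (Gn - Gk) - (φ k t - Gk)‖ₑ := by congr 1; ring
      _ ≤ ‖φ n t - Gn‖ₑ + ‖Gn - Gk‖ₑ + ‖φ k t - Gk‖ₑ :=
          _root_.enorm_sub_le.trans (add_le_add_left (enorm_add_le _ _) _)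
      _ ≤ _ := by
          have := h.enorm_frozen_sub_frozen_le hn hk ℓ t
          simp only [mul_add, Finset.sum_add_distrib] at this
          calc _ ≤ _ := add_le_add_left (add_le_add_right this _) _
            _ = _ := by simp only [err]; ring
  refine ENNReal.le_of_forall_pos_le_add fun ε hε _ => ?_
  have hε2 : (0 : ℝ≥0∞) < ε / 2 := ENNReal.half_pos (by simpa using hε.ne')
  obtain ⟨N, hN⟩ := eventually_atTop.1 (herr.eventually (ge_mem_nhds hε2))
  refine (iInf_le _ (max N n₀)).trans (iSup₂_le fun j hj => iSup₂_le fun k hk => ?_)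
  refine (hpair j k (le_of_max_le_right hj) (le_of_max_le_right hk)).trans ?_
  gcongr
  calc err j + err k ≤ ε / 2 + ε / 2 :=
        add_le_add (hN j (le_of_max_le_left hj)) (hN k (le_of_max_le_left hk))
    _ = ε := ENNReal.add_halves _

lemma cauchySeq [IsProbabilityMeasure P] (h : IsCharRecursion P n₀ φ a b I a' b' s p K)
    (t : ι → ℂ) : CauchySeq fun n => φ n t := by
  refine EMetric.cauchySeq_iff.2 fun ε hε => ?_
  have h0 := h.iInf_osc_eq_zero t
  obtain ⟨ℓ, hℓ⟩ := iInf_lt_iff.1 (h0.trans_lt hε)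
  exact ⟨ℓ, fun j hj k hk => by
    rw [edist_eq_enorm_sub]; exact (le_osc hj hk t).trans_lt hℓ⟩

/-- The pointwise limit of the characteristic functions solves the limiting fixed-point equation. -/
lemma limit_eq [IsProbabilityMeasure P] (h : IsCharRecursion P n₀ φ a b I a' b' s p K)
    {ψ : (ι → ℂ) → ℂ} (hψ : ∀ t, Tendsto (fun n => φ n t) atTop (𝓝 (ψ t))) (t : ι → ℂ) :
    ψ t = ∫ ω, planeWave t (b' ω) * ∏ r, ψ (t * a' r ω) ∂P := by
  have hK2 : (2 : ℝ≥0∞) * K ≠ ⊤ := ENNReal.mul_ne_top (by norm_num) h.K_ne_top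
  set G := ∫ ω, planeWave t (b' ω) * ∏ r, ψ (t * a' r ω) ∂P with hG
  have hψm : Measurable ψ := measurable_of_tendsto_metrizable (fun n => h.measurable_phi n)
    (tendsto_pi_nhds.2 hψ)
  have hψ1 : ∀ t, ‖ψ t‖ ≤ 1 := fun t => le_of_tendsto' (hψ t).norm fun n => h.norm_le n t
  have hle : ∀ (j : ℕ) (u : ι → ℂ) (c : ℝ≥0∞) (ℓ : ℕ), (∀ k ≥ ℓ, ‖φ j u - φ k u‖ₑ ≤ c) →
      ‖φ j u - ψ u‖ₑ ≤ c := fun j u c ℓ hc =>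
    le_of_tendsto (tendsto_const_nhds.sub (hψ u)).enorm ((eventually_ge_atTop ℓ).mono hc)
  -- The comparison used for the oscillation is repeated with the limit `ψ` in place of the second
  -- time; the exceptional event `E` is then empty.
  have hbound : ∀ ℓ, ‖ψ t - G‖ₑ ≤ ∑ r, ∫⁻ ω, osc φ ℓ (t * a' r ω) ∂P := by
    intro ℓ
    have hlim : Tendsto (fun n => ‖φ n t - frozen P φ I a' b' n t‖ₑ +
        ∑ r, (∫⁻ ω, osc φ ℓ (t * a' r ω) ∂P + 2 * K * ‖t‖ₑ ^ s *
          (∫⁻ ω in {ω | I n r ω ≤ ℓ}, ‖a' r ω‖ₑ ^ s ∂P))) atTop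
        (𝓝 (0 + ∑ r, (∫⁻ ω, osc φ ℓ (t * a' r ω) ∂P + 2 * K * ‖t‖ₑ ^ s * 0))) := by
      refine (h.tendsto_sub_frozen t).add (tendsto_finsetSum _ fun r _ =>
        tendsto_const_nhds.add (ENNReal.Tendsto.const_mul (h.tendsto_small ℓ r) (Or.inr ?_)))
      exact ENNReal.mul_ne_top hK2 (ENNReal.rpow_ne_top_of_nonneg h.pos.le enorm_ne_top)
    simp only [mul_zero, add_zero, zero_add] at hlim
    refine le_of_tendsto_of_tendsto ((hψ t).sub_const G).enorm hlim ?_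
    filter_upwards [eventually_ge_atTop n₀] with n hn
    calc ‖φ n t - G‖ₑ = ‖(φ n t - frozen P φ I a' b' n t) + (frozen P φ I a' b' n t - G)‖ₑ := by
          congr 1; ring
      _ ≤ _ := (enorm_add_le _ _).trans (add_le_add_right ?_ _)
    refine (enorm_integral_mul_prod_sub_le (measurable_wave h.measurable_b' t)
      (measurable_wave h.measurable_b' t)
      (fun r => h.measurable_comp (h.measurable_I n hn r) (h.measurable_a' r) t)
      (fun r => hψm.comp (measurable_const.mul (h.measurable_a' r)))
      (fun ω => (norm_planeWave _ _).le) (fun ω => (norm_planeWave _ _).le)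
      (fun r ω => h.norm_le _ _) (fun r ω => hψ1 _)).trans ?_
    simp only [sub_self, enorm_zero, lintegral_zero, zero_add]
    refine Finset.sum_le_sum fun r _ => ?_
    have := h.lintegral_enorm_sub_le hn r ℓ t (fun _ => ψ)
      (fun ω u j => hle j u _ 0 fun k _ => h.enorm_sub_le_two_mul j k u) ∅ MeasurableSet.empty
      (fun ω _ u j hj => hle j u _ ℓ fun k hk => le_osc hj hk u)
    simpa using this
  have hlim := tendsto_finsetSum Finset.univ fun r _ => h.tendsto_lintegral_osc r t
  simp only [h.iInf_osc_eq_zero, lintegral_zero, Finset.sum_const_zero] at hlim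
  have h0 : ‖ψ t - G‖ₑ = 0 := le_antisymm (ge_of_tendsto' hlim hbound) zero_le
  exact sub_eq_zero.1 (enorm_eq_zero.1 h0)

end IsCharRecursion

/-- Uniqueness of solutions of the fixed-point equation for characteristic functions. -/
lemma eq_of_charFixedPoint {Ω : Type*} [MeasurableSpace Ω] {P : Measure Ω} [IsProbabilityMeasure P]
    {ι : Type*} [Fintype ι] {m : ℕ} {a : Fin m → Ω → ι → ℂ} {b : Ω → ι → ℂ} {s : ℝ} (hs : 0 < s)
    (ham : ∀ r, Measurable (a r)) (hbm : Measurable b)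
    (ha : ∑ r, ∫⁻ ω, ‖a r ω‖ₑ ^ s ∂P < 1) {ψ ψ' : (ι → ℂ) → ℂ} (hψm : Measurable ψ)
    (hψm' : Measurable ψ') (hψ : ∀ t, ‖ψ t‖ ≤ 1) (hψ' : ∀ t, ‖ψ' t‖ ≤ 1) {K : ℝ≥0∞} (hK : K ≠ ⊤)
    (hψK : ∀ t, ‖ψ t - 1‖ₑ ≤ K * ‖t‖ₑ ^ s) (hψK' : ∀ t, ‖ψ' t - 1‖ₑ ≤ K * ‖t‖ₑ ^ s)
    (heq : ∀ t, ψ t = ∫ ω, planeWave t (b ω) * ∏ r, ψ (t * a r ω) ∂P)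
    (heq' : ∀ t, ψ' t = ∫ ω, planeWave t (b ω) * ∏ r, ψ' (t * a r ω) ∂P) (t : ι → ℂ) :
    ψ t = ψ' t := by
  have hmain := eq_zero_of_le_sum_lintegral (P := P) hs ham ha (K := K + K)
    (ENNReal.add_ne_top.2 ⟨hK, hK⟩) (g := fun t => ‖ψ t - ψ' t‖ₑ) (fun t => ?_) (fun t => ?_) t
  · exact sub_eq_zero.1 (enorm_eq_zero.1 hmain)
  · calc ‖ψ t - ψ' t‖ₑ = ‖(ψ t - 1) - (ψ' t - 1)‖ₑ := by congr 1; ring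
      _ ≤ ‖ψ t - 1‖ₑ + ‖ψ' t - 1‖ₑ := enorm_sub_le
      _ ≤ (K + K) * ‖t‖ₑ ^ s := by rw [add_mul]; exact add_le_add (hψK t) (hψK' t)
  · rw [heq t, heq' t]
    have hwave := IsCharRecursion.measurable_wave hbm t
    simpa using enorm_integral_mul_prod_sub_le (P := P) hwave hwave
      (fun r => hψm.comp (measurable_const.mul (ham r)))
      (fun r => hψm'.comp (measurable_const.mul (ham r))) (fun ω => (norm_planeWave _ _).le)
      (fun ω => (norm_planeWave _ _).le) (fun r ω => hψ _) (fun r ω => hψ' _)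

/-! ### Power inequalities and randomly weighted sums -/

lemma ENNReal.add_rpow_le_two_rpow_mul {s : ℝ} (hs : 0 < s) (a b : ℝ≥0∞) :
    (a + b) ^ s ≤ 2 ^ s * (a ^ s + b ^ s) := by
  rcases le_total a b with h | h
  · calc (a + b) ^ s ≤ (2 * b) ^ s := by gcongr; rw [two_mul]; gcongr
      _ = 2 ^ s * b ^ s := ENNReal.mul_rpow_of_nonneg _ _ hs.le
      _ ≤ _ := by gcongr; exact le_add_self
  · calc (a + b) ^ s ≤ (2 * a) ^ s := by gcongr; rw [two_mul]; gcongr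
      _ = 2 ^ s * a ^ s := ENNReal.mul_rpow_of_nonneg _ _ hs.le
      _ ≤ _ := by gcongr; exact le_self_add

lemma ENNReal.rpow_le_one_add_rpow {p q : ℝ} (hp : 0 ≤ p) (hpq : p ≤ q) (a : ℝ≥0∞) :
    a ^ p ≤ 1 + a ^ q := by
  rcases le_total a 1 with h | h
  · exact (ENNReal.rpow_le_one h hp).trans le_self_add
  · exact (ENNReal.rpow_le_rpow_of_exponent_le h hpq).trans le_add_self

lemma pi_enorm_rpow_le_of_forall {ι : Type*} [Fintype ι] {s : ℝ} (hs : 0 < s) (x : ι → ℂ)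
    {c : ℝ≥0∞} (hc : ∀ k, ‖x k‖ₑ ^ s ≤ c) : ‖x‖ₑ ^ s ≤ c := by
  rcases isEmpty_or_nonempty ι with h | h
  · have : x = 0 := Subsingleton.elim _ _
    simp [this, hs]
  · obtain ⟨k, hk⟩ := Finite.exists_max fun k => ‖x k‖
    have : ‖x‖ ≤ ‖x k‖ := (pi_norm_le_iff_of_nonneg (norm_nonneg _)).2 hk
    refine le_trans (ENNReal.rpow_le_rpow ?_ hs.le) (hc k)
    rw [← ofReal_norm, ← ofReal_norm]
    exact ENNReal.ofReal_le_ofReal this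

lemma pi_enorm_rpow_le_sum {ι : Type*} [Fintype ι] {s : ℝ} (hs : 0 < s) (x : ι → ℂ) :
    ‖x‖ₑ ^ s ≤ ∑ k, ‖x k‖ₑ ^ s :=
  pi_enorm_rpow_le_of_forall hs x fun k =>
    Finset.single_le_sum (f := fun k => ‖x k‖ₑ ^ s) (fun _ _ => zero_le) (Finset.mem_univ k)

lemma tendsto_lintegral_rpow_of_le {Ω E : Type*} [MeasurableSpace Ω] {P : Measure Ω}
    [IsProbabilityMeasure P] [NormedAddCommGroup E] {g : ℕ → Ω → E} {n₀ : ℕ}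
    (hg : ∀ n, n₀ ≤ n → AEStronglyMeasurable (g n) P) {p q : ℝ} (hp : 0 < p) (hpq : p ≤ q)
    (h : Tendsto (fun n => ∫⁻ ω, ‖g n ω‖ₑ ^ q ∂P) atTop (𝓝 0)) :
    Tendsto (fun n => ∫⁻ ω, ‖g n ω‖ₑ ^ p ∂P) atTop (𝓝 0) := by
  have hq : 0 < q := hp.trans_le hpq
  have hlim : Tendsto (fun n => ((∫⁻ ω, ‖g n ω‖ₑ ^ q ∂P) ^ (1 / q)) ^ p) atTop (𝓝 0) := by
    have h1 := ((ENNReal.continuous_rpow_const (y := p)).comp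
      (ENNReal.continuous_rpow_const (y := 1 / q))).tendsto (0 : ℝ≥0∞)
    simp only [Function.comp_apply, ENNReal.zero_rpow_of_pos (show 0 < 1 / q by positivity),
      ENNReal.zero_rpow_of_pos hp] at h1
    exact h1.comp h
  refine tendsto_of_tendsto_of_tendsto_of_le_of_le' tendsto_const_nhds hlim
    (Eventually.of_forall fun _ => zero_le) ?_
  filter_upwards [eventually_ge_atTop n₀] with n hn
  have := eLpNorm'_le_eLpNorm'_of_exponent_le hp hpq P (hg n hn)
  simp only [eLpNorm'_eq_lintegral_enorm] at this
  calc ∫⁻ ω, ‖g n ω‖ₑ ^ p ∂P = ((∫⁻ ω, ‖g n ω‖ₑ ^ p ∂P) ^ (1 / p)) ^ p := by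
        rw [← ENNReal.rpow_mul, one_div_mul_cancel hp.ne', ENNReal.rpow_one]
    _ ≤ _ := ENNReal.rpow_le_rpow this hp.le

/-- Characteristic functions of randomly weighted sums of independent random vectors. -/
lemma integral_planeWave_sum {Ω S ι : Type*} [MeasurableSpace Ω] {P : Measure Ω}
    [IsProbabilityMeasure P] [MeasurableSpace S] [Fintype ι] {m : ℕ} (Q : Fin m → Measure S)
    [∀ r, IsProbabilityMeasure (Q r)] {a : Fin m → Ω → ι → ℂ} {b : Ω → ι → ℂ}
    {G : Fin m → Ω → S → ι → ℂ} (t : ι → ℂ)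
    (hm : Measurable fun p : Ω × (Fin m → S) => ∑ r, a r p.1 * G r p.1 (p.2 r) + b p.1) :
    ∫ p, planeWave t (∑ r, a r p.1 * G r p.1 (p.2 r) + b p.1) ∂(P.prod (Measure.pi Q)) =
      ∫ ω, planeWave t (b ω) * ∏ r, ∫ y, planeWave (t * a r ω) (G r ω y) ∂(Q r) ∂P := by
  have hint : Integrable (fun p : Ω × (Fin m → S) =>
      planeWave t (∑ r, a r p.1 * G r p.1 (p.2 r) + b p.1)) (P.prod (Measure.pi Q)) :=
    Integrable.of_bound (IsCharRecursion.measurable_wave hm t).aestronglyMeasurable 1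
      (Eventually.of_forall fun p => (norm_planeWave _ _).le)
  rw [integral_prod _ hint]
  congr 1
  ext ω
  simp only [planeWave_add_right, planeWave_sum_right, planeWave_mul_right]
  rw [integral_mul_const, mul_comm, integral_fintype_prod_eq_prod
    (f := fun r y => planeWave (t * a r ω) (G r ω y))]

lemma Measurable.planeWave {S ι : Type*} [MeasurableSpace S] [Fintype ι] {a x : S → ι → ℂ}
    (ha : Measurable a) (hx : Measurable x) : Measurable fun q => planeWave (a q) (x q) := by
  unfold _root_.planeWave
  fun_prop

/-! ### Characteristic functions of finite-dimensional distributions -/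

namespace HolSpace

variable {D : Opens ℂ} {ι : Type*}

/-- The vector of values at finitely many points. -/
noncomputable def evalAt (z : ι → D) (f : HolSpace D) : ι → ℂ := fun k => f (z k)

@[simp] lemma evalAt_apply (z : ι → D) (f : HolSpace D) (k : ι) : evalAt z f k = f (z k) := rfl

lemma evalAt_add (z : ι → D) (f g : HolSpace D) : evalAt z (f + g) = evalAt z f + evalAt z g := rfl

lemma evalAt_mul (z : ι → D) (f g : HolSpace D) : evalAt z (f * g) = evalAt z f * evalAt z g := rfl

lemma evalAt_sum {κ : Type*} (s : Finset κ) (z : ι → D) (f : κ → HolSpace D) :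
    evalAt z (∑ r ∈ s, f r) = ∑ r ∈ s, evalAt z (f r) := by
  ext k
  simp

lemma measurable_evalAt (z : ι → D) : Measurable (evalAt z) :=
  measurable_pi_lambda _ fun k => measurable_apply (z k)

variable [Fintype ι]

/-- The characteristic function of the finite-dimensional distribution at the points `z`. -/
noncomputable def charFunAt (μ : Measure (HolSpace D)) (z : ι → D) (t : ι → ℂ) : ℂ :=
  ∫ f, planeWave t (evalAt z f) ∂μ

lemma charFunAt_map {Ω : Type*} [MeasurableSpace Ω] {P : Measure Ω} {X : Ω → HolSpace D}
    (hX : Measurable X) (z : ι → D) (t : ι → ℂ) :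
    charFunAt (P.map X) z t = ∫ ω, planeWave t (evalAt z (X ω)) ∂P :=
  integral_map hX.aemeasurable
    (IsCharRecursion.measurable_wave (measurable_evalAt z) t).aestronglyMeasurable

variable {μ : Measure (HolSpace D)} [IsProbabilityMeasure μ]

lemma integrable_planeWave (z : ι → D) (t : ι → ℂ) :
    Integrable (fun f => planeWave t (evalAt z f)) μ :=
  Integrable.of_bound (IsCharRecursion.measurable_wave (measurable_evalAt z) t).aestronglyMeasurable
    1 (Eventually.of_forall fun _ => (norm_planeWave _ _).le)

lemma norm_charFunAt_le (z : ι → D) (t : ι → ℂ) : ‖charFunAt μ z t‖ ≤ 1 := by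
  refine (norm_integral_le_of_norm_le_const (C := 1)
    (Eventually.of_forall fun f => (norm_planeWave _ _).le)).trans ?_
  simp

lemma enorm_charFunAt_sub_le {p : ℝ} (hp : 0 < p) (hp1 : p ≤ 1) (z : ι → D) (t t' : ι → ℂ) :
    ‖charFunAt μ z t - charFunAt μ z t'‖ₑ ≤
      3 * (Fintype.card ι : ℝ≥0∞) ^ p * (∫⁻ f, ‖evalAt z f‖ₑ ^ p ∂μ) * ‖t - t'‖ₑ ^ p := by
  have hm : Measurable fun f : HolSpace D => ‖evalAt z f‖ₑ ^ p :=
    (measurable_evalAt z).enorm.pow_const p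
  rw [charFunAt, charFunAt, ← integral_sub (integrable_planeWave z t) (integrable_planeWave z t')]
  refine (enorm_integral_le_lintegral_enorm _).trans ?_
  rw [mul_right_comm, ← lintegral_const_mul _ hm]
  refine lintegral_mono fun f => (enorm_planeWave_sub_le hp hp1 _ _ _).trans (le_of_eq ?_)
  rw [ENNReal.mul_rpow_of_nonneg _ _ hp.le, ENNReal.mul_rpow_of_nonneg _ _ hp.le]
  ring

lemma enorm_charFunAt_sub_one_le {s : ℝ} (hs : 0 < s) (hs2 : s ≤ 2) (z : ι → D)
    (hfin : ∀ k, ∫⁻ f, ‖f (z k)‖ₑ ^ s ∂μ ≠ ⊤) (hc : 1 < s → ∀ k, ∫ f, f (z k) ∂μ = 0)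
    (t : ι → ℂ) :
    ‖charFunAt μ z t - 1‖ₑ ≤
      3 * (Fintype.card ι : ℝ≥0∞) ^ s * (∑ k, ∫⁻ f, ‖f (z k)‖ₑ ^ s ∂μ) * ‖t‖ₑ ^ s := by
  have hm : Measurable fun f : HolSpace D => (∑ k, t k * evalAt z f k).re :=
    Complex.measurable_re.comp (Finset.measurable_fun_sum _ fun k _ =>
      (measurable_apply (z k)).const_mul _)
  refine (enorm_integral_exp_sub_one_le hs hs2 hm fun hs1 => ?_).trans ?_
  · have hint : ∀ k, Integrable (fun f : HolSpace D => t k * evalAt z f k) μ := fun k =>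
      (integrable_of_lintegral_rpow (measurable_apply (z k)).aestronglyMeasurable hs1.le
        (hfin k)).const_mul _
    rw [show (fun f : HolSpace D => (∑ k, t k * evalAt z f k).re) =
      fun f => RCLike.re (∑ k, t k * evalAt z f k) from rfl,
      integral_re (integrable_finsetSum _ fun k _ => hint k),
      integral_finsetSum _ fun k _ => hint k]
    simp [integral_const_mul, hc hs1]
  · have hmk : ∀ k, Measurable fun f : HolSpace D => ‖f (z k)‖ₑ ^ s := fun k =>
      (measurable_apply (z k)).enorm.pow_const s
    have hms : Measurable fun f : HolSpace D => ∑ k, ‖f (z k)‖ₑ ^ s :=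
      Finset.measurable_fun_sum _ fun k _ => hmk k
    have hle : ∀ f : HolSpace D, ‖(∑ k, t k * evalAt z f k).re‖ₑ ^ s ≤
        (Fintype.card ι : ℝ≥0∞) ^ s * ‖t‖ₑ ^ s * ∑ k, ‖f (z k)‖ₑ ^ s := fun f => by
      refine (ENNReal.rpow_le_rpow (enorm_re_sum_le t (evalAt z f)) hs.le).trans ?_
      rw [ENNReal.mul_rpow_of_nonneg _ _ hs.le, ENNReal.mul_rpow_of_nonneg _ _ hs.le, ← mul_assoc]
      exact mul_le_mul_right (pi_enorm_rpow_le_sum hs (evalAt z f)) _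
    have hint := lintegral_mono (μ := μ) hle
    rw [lintegral_const_mul _ hms, lintegral_finsetSum _ fun k _ => hmk k] at hint
    refine (mul_le_mul_right hint 3).trans (le_of_eq ?_)
    ring

lemma measurable_charFunAt (z : ι → D) : Measurable (charFunAt μ z) := by
  have he : Measurable fun q : (ι → ℂ) × HolSpace D => evalAt z q.2 :=
    (measurable_evalAt z).comp measurable_snd
  have h : Measurable fun q : (ι → ℂ) × HolSpace D => planeWave q.1 (evalAt z q.2) :=
    measurable_fst.planeWave he
  exact (h.stronglyMeasurable.integral_prod_right' (ν := μ)).measurable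

end HolSpace

/-- On characteristic functions `T` acts as the right-hand side of the limiting recursion, so fixed
points of `T` can be compared through `limit_eq` and `eq_of_charFixedPoint`. -/
lemma charFunAt_contractionMap {Ω : Type*} [MeasurableSpace Ω] {P : Measure Ω}
    [IsProbabilityMeasure P] {D : Opens ℂ} {m : ℕ} {A : Fin m → Ω → HolSpace D}
    {b : Ω → HolSpace D} (hA : ∀ r, Measurable (A r)) (hb : Measurable b)
    (ν : Measure (HolSpace D)) [IsProbabilityMeasure ν] {ι : Type*} [Fintype ι] (z : ι → D)
    (t : ι → ℂ) :
    HolSpace.charFunAt (contractionMap P A b ν) z t = ∫ ω, planeWave t (HolSpace.evalAt z (b ω)) *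
      ∏ r, HolSpace.charFunAt ν z (t * HolSpace.evalAt z (A r ω)) ∂P := by
  have hm : Measurable fun p : Ω × (Fin m → HolSpace D) => ∑ r, A r p.1 * p.2 r + b p.1 :=
    (Finset.measurable_fun_sum _ fun r _ => ((hA r).comp measurable_fst).mul
      ((measurable_pi_apply r).comp measurable_snd)).add (hb.comp measurable_fst)
  have hm' : Measurable fun p : Ω × (Fin m → HolSpace D) =>
      ∑ r, HolSpace.evalAt z (A r p.1) * HolSpace.evalAt z (p.2 r) + HolSpace.evalAt z (b p.1) := by
    have := (HolSpace.measurable_evalAt z).comp hm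
    simpa only [Function.comp_def, HolSpace.evalAt_add, HolSpace.evalAt_sum,
      HolSpace.evalAt_mul] using this
  have key := integral_planeWave_sum (P := P) (fun _ : Fin m => ν)
    (a := fun r ω => HolSpace.evalAt z (A r ω)) (b := fun ω => HolSpace.evalAt z (b ω))
    (G := fun _ _ f => HolSpace.evalAt z f) t hm'
  rw [contractionMap, HolSpace.charFunAt_map hm]
  simp only [HolSpace.evalAt_add, HolSpace.evalAt_sum, HolSpace.evalAt_mul]
  rw [key]
  rfl

/-! ### From the analytic recurrence to the recursion for characteristic functions -/

namespace AnalyticRecurrence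

variable {Ω : Type*} [MeasurableSpace Ω] {P : Measure Ω} [IsProbabilityMeasure P] {D : Opens ℂ}
  {m n₀ : ℕ} {X : ℕ → Ω → HolSpace D} {A : ℕ → Fin m → Ω → HolSpace D}
  {b : ℕ → Ω → HolSpace D} {I : ℕ → Fin m → Ω → ℕ} {Y : Fin m → ℕ → Ω → HolSpace D}

open HolSpace

lemma charFunAt_recursion (h : AnalyticRecurrence P n₀ X A b I Y) {ι : Type*} [Fintype ι]
    (z : ι → D) {n : ℕ} (hn : n₀ ≤ n) (t : ι → ℂ) :
    charFunAt (P.map (X n)) z t = ∫ ω, planeWave t (evalAt z (b n ω)) *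
      ∏ r, charFunAt (P.map (X (I n r ω))) z (t * evalAt z (A n r ω)) ∂P := by
  have := h.isProbabilityMeasure_copyLaw
  have hm' := (measurable_evalAt z).comp (h.measurable_rhs hn)
  simp only [Function.comp_def, evalAt_add, evalAt_sum, evalAt_mul] at hm'
  rw [h.map_eq hn, charFunAt_map (h.measurable_rhs hn)]
  simp only [evalAt_add, evalAt_sum, evalAt_mul]
  rw [integral_planeWave_sum (copyLaw P Y) (a := fun r ω => evalAt z (A n r ω))
    (b := fun ω => evalAt z (b n ω)) (G := fun r ω y => evalAt z (y (I n r ω))) t hm']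
  congr 1
  ext ω
  congr 1
  refine Finset.prod_congr rfl fun r _ => ?_
  rw [charFunAt_map (h.measurable_X _)]
  exact h.integral_copyLaw r (I n r ω)
    (F := fun f => planeWave (t * evalAt z (A n r ω)) (evalAt z f))
    (IsCharRecursion.measurable_wave (measurable_evalAt z) _)

lemma isCharRecursion (h : AnalyticRecurrence P n₀ X A b I Y) {Astar : Fin m → Ω → HolSpace D}
    {bstar : Ω → HolSpace D} (hAstar : ∀ r, Measurable (Astar r)) (hbstar : Measurable bstar)
    {s : ℝ} (hs : 0 < s) (hs2 : s ≤ 2) {V : Set D} {M : ℝ≥0∞} (hM : M ≠ ⊤)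
    (hX : ∀ n, ∀ z ∈ V, ∫⁻ ω, ‖X n ω z‖ₑ ^ s ∂P ≤ M)
    (hc : 1 < s → ∀ n, ∀ z ∈ V, ∫ ω, X n ω z ∂P = 0)
    (hA : ∀ r, ∀ z ∈ V, Tendsto (fun n => ∫⁻ ω, ‖A n r ω z - Astar r ω z‖ₑ ^ s ∂P) atTop (𝓝 0))
    (hb : ∀ z ∈ V, Tendsto (fun n => ∫⁻ ω, ‖b n ω z - bstar ω z‖ₑ ^ s ∂P) atTop (𝓝 0))
    (hlt : ∫⁻ ω, ∑ r, ⨆ z ∈ V, ‖Astar r ω z‖ₑ ^ s ∂P < 1)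
    (hI : ∀ ℓ r, ∀ z ∈ V, Tendsto (fun n => ∫⁻ ω in {ω | I n r ω ≤ ℓ}, ‖A n r ω z‖ₑ ^ s ∂P)
      atTop (𝓝 0))
    {ι : Type*} [Fintype ι] (z : ι → D) (hz : ∀ k, z k ∈ V) :
    ∃ K, IsCharRecursion P n₀ (fun n => charFunAt (P.map (X n)) z)
      (fun n r ω => evalAt z (A n r ω)) (fun n ω => evalAt z (b n ω)) I
      (fun r ω => evalAt z (Astar r ω)) (fun ω => evalAt z (bstar ω)) s (min s 1) K := by
  -- Two exponents are needed: `s` governs flatness at the origin and contraction, while Hölder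
  -- continuity in `t` only holds for exponents up to 1.
  set p := min s 1 with hpdef
  have hp : 0 < p := lt_min hs one_pos
  have hp1 : p ≤ 1 := min_le_right _ _
  have hps : p ≤ s := min_le_left _ _
  have hprob : ∀ n, IsProbabilityMeasure (P.map (X n)) := fun n =>
    Measure.isProbabilityMeasure_map (h.measurable_X n).aemeasurable
  have hmk : ∀ k, Measurable fun f : HolSpace D => ‖f (z k)‖ₑ ^ s := fun k =>
    (measurable_apply (z k)).enorm.pow_const s
  have hev := measurable_evalAt z
  have hmom : ∀ n k, ∫⁻ f, ‖f (z k)‖ₑ ^ s ∂(P.map (X n)) ≤ M := fun n k => by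
    rw [lintegral_map (hmk k) (h.measurable_X n)]
    exact hX n _ (hz k)
  have hmom' : ∀ n, ∑ k, ∫⁻ f, ‖f (z k)‖ₑ ^ s ∂(P.map (X n)) ≤ Fintype.card ι * M := fun n =>
    (Finset.sum_le_sum fun k _ => hmom n k).trans (by simp)
  set c : ℝ≥0∞ := (Fintype.card ι : ℝ≥0∞)
  have hctop : c ≠ ⊤ := by simp [c]
  have hcM : c * M ≠ ⊤ := ENNReal.mul_ne_top hctop hM
  refine ⟨3 * c ^ p * (1 + c * M) + 3 * c ^ s * (c * M),
    { pos := hs, p_pos := hp, p_le_one := hp1, K_ne_top := ?_,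
      norm_le := fun n t => norm_charFunAt_le z t, enorm_sub_le := fun n t t' => ?_,
      enorm_sub_one_le := fun n t => ?_,
      measurable_a := fun n hn r => hev.comp (h.measurable_A n hn r),
      measurable_b := fun n hn => hev.comp (h.measurable_b n hn),
      measurable_I := h.measurable_I, measurable_a' := fun r => hev.comp (hAstar r),
      measurable_b' := hev.comp hbstar, recursion := fun n hn t => h.charFunAt_recursion z hn t,
      tendsto_a := fun r => ?_, tendsto_b := ?_, contraction := ?_,
      tendsto_small := fun ℓ r => ?_ }⟩
  · refine ENNReal.add_ne_top.2 ⟨ENNReal.mul_ne_top (ENNReal.mul_ne_top (by norm_num)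
      (ENNReal.rpow_ne_top_of_nonneg hp.le hctop)) (ENNReal.add_ne_top.2 ⟨by simp, hcM⟩),
      ENNReal.mul_ne_top (ENNReal.mul_ne_top (by norm_num)
      (ENNReal.rpow_ne_top_of_nonneg hs.le hctop)) hcM⟩
  · refine (enorm_charFunAt_sub_le hp hp1 z t t').trans ?_
    gcongr
    refine le_trans ?_ le_self_add
    gcongr
    calc ∫⁻ f, ‖evalAt z f‖ₑ ^ p ∂(P.map (X n))
        ≤ ∫⁻ f, (1 + ∑ k, ‖f (z k)‖ₑ ^ s) ∂(P.map (X n)) := lintegral_mono fun f =>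
          (ENNReal.rpow_le_one_add_rpow hp.le hps _).trans
            (add_le_add_right (pi_enorm_rpow_le_sum hs _) _)
      _ ≤ 1 + c * M := by
          rw [lintegral_add_left measurable_const, lintegral_finsetSum _ fun k _ => hmk k]
          simpa using add_le_add_right (hmom' n) 1
  · refine (enorm_charFunAt_sub_one_le hs hs2 z (fun k => ((hmom n k).trans_lt hM.lt_top).ne)
      (fun hs1 k => ?_) t).trans ?_
    · rw [integral_map (h.measurable_X n).aemeasurable
        (measurable_apply (z k)).aestronglyMeasurable]
      exact hc hs1 n _ (hz k)
    · gcongr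
      refine le_trans ?_ le_add_self
      gcongr
      exact hmom' n
  · refine tendsto_lintegral_rpow_of_le (n₀ := n₀) (q := s) (fun n hn =>
      ((hev.comp (h.measurable_A n hn r)).sub (hev.comp (hAstar r))).aestronglyMeasurable) hp hps ?_
    have hsum := tendsto_finsetSum Finset.univ fun k _ => hA r (z k) (hz k)
    rw [Finset.sum_const_zero] at hsum
    refine tendsto_of_tendsto_of_tendsto_of_le_of_le' tendsto_const_nhds hsum
      (Eventually.of_forall fun _ => zero_le) ?_
    filter_upwards [eventually_ge_atTop n₀] with n hn
    have hm : ∀ k, Measurable fun ω => ‖A n r ω (z k) - Astar r ω (z k)‖ₑ ^ s := fun k =>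
      (((measurable_apply (z k)).comp (h.measurable_A n hn r)).sub
        ((measurable_apply (z k)).comp (hAstar r))).enorm.pow_const s
    rw [← lintegral_finsetSum _ fun k _ => hm k]
    exact lintegral_mono fun ω => pi_enorm_rpow_le_sum hs _
  · refine tendsto_lintegral_rpow_of_le (n₀ := n₀) (q := s) (fun n hn =>
      ((hev.comp (h.measurable_b n hn)).sub (hev.comp hbstar)).aestronglyMeasurable) hp hps ?_
    have hsum := tendsto_finsetSum Finset.univ fun k _ => hb (z k) (hz k)
    rw [Finset.sum_const_zero] at hsum
    refine tendsto_of_tendsto_of_tendsto_of_le_of_le' tendsto_const_nhds hsum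
      (Eventually.of_forall fun _ => zero_le) ?_
    filter_upwards [eventually_ge_atTop n₀] with n hn
    have hm : ∀ k, Measurable fun ω => ‖b n ω (z k) - bstar ω (z k)‖ₑ ^ s := fun k =>
      (((measurable_apply (z k)).comp (h.measurable_b n hn)).sub
        ((measurable_apply (z k)).comp hbstar)).enorm.pow_const s
    rw [← lintegral_finsetSum _ fun k _ => hm k]
    exact lintegral_mono fun ω => pi_enorm_rpow_le_sum hs _
  -- The norm on `ℂ^ι` is the maximum over the points, so joint contraction follows from the
  -- supremum over `V` taken inside the expectation.
  · refine lt_of_le_of_lt ?_ hlt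
    have hm : ∀ r, Measurable fun ω => ⨆ z ∈ V, ‖Astar r ω z‖ₑ ^ s := fun r =>
      (measurable_iSup_enorm_rpow V s).comp (hAstar r)
    rw [lintegral_finsetSum _ fun r _ => hm r]
    refine Finset.sum_le_sum fun r _ => lintegral_mono fun ω => ?_
    exact pi_enorm_rpow_le_of_forall hs _ fun k =>
      le_iSup₂ (f := fun (z : D) (_ : z ∈ V) => ‖Astar r ω z‖ₑ ^ s) (z k) (hz k)
  -- Smallness on `{I ≤ ℓ}` is assumed for `A n` and is transferred to `Astar` through their `L^s`
  -- distance.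
  · have hsum := tendsto_finsetSum Finset.univ fun k _ => ENNReal.Tendsto.const_mul (a := 2 ^ s)
      ((hI ℓ r (z k) (hz k)).add (hA r (z k) (hz k)))
      (Or.inr (ENNReal.rpow_ne_top_of_nonneg hs.le (by norm_num)))
    simp only [add_zero, mul_zero, Finset.sum_const_zero] at hsum
    refine tendsto_of_tendsto_of_tendsto_of_le_of_le' tendsto_const_nhds hsum
      (Eventually.of_forall fun _ => zero_le) ?_
    filter_upwards [eventually_ge_atTop n₀] with n hn
    have hmA : ∀ k, Measurable fun ω => A n r ω (z k) := fun k =>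
      (measurable_apply (z k)).comp (h.measurable_A n hn r)
    have hmS : ∀ k, Measurable fun ω => Astar r ω (z k) := fun k =>
      (measurable_apply (z k)).comp (hAstar r)
    calc ∫⁻ ω in {ω | I n r ω ≤ ℓ}, ‖evalAt z (Astar r ω)‖ₑ ^ s ∂P
        ≤ ∫⁻ ω in {ω | I n r ω ≤ ℓ}, ∑ k, ‖Astar r ω (z k)‖ₑ ^ s ∂P :=
          lintegral_mono fun ω => pi_enorm_rpow_le_sum hs _
      _ = ∑ k, ∫⁻ ω in {ω | I n r ω ≤ ℓ}, ‖Astar r ω (z k)‖ₑ ^ s ∂P :=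
          lintegral_finsetSum _ fun k _ => (hmS k).enorm.pow_const s
      _ ≤ _ := Finset.sum_le_sum fun k _ => ?_
    calc ∫⁻ ω in {ω | I n r ω ≤ ℓ}, ‖Astar r ω (z k)‖ₑ ^ s ∂P
        ≤ ∫⁻ ω in {ω | I n r ω ≤ ℓ}, 2 ^ s * (‖A n r ω (z k)‖ₑ ^ s +
            ‖A n r ω (z k) - Astar r ω (z k)‖ₑ ^ s) ∂P := by
          refine lintegral_mono fun ω => le_trans ?_ (ENNReal.add_rpow_le_two_rpow_mul hs _ _)
          gcongr
          calc ‖Astar r ω (z k)‖ₑ = ‖A n r ω (z k) - (A n r ω (z k) - Astar r ω (z k))‖ₑ := by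
                congr 1; ring
            _ ≤ _ := enorm_sub_le
      _ = 2 ^ s * (∫⁻ ω in {ω | I n r ω ≤ ℓ}, ‖A n r ω (z k)‖ₑ ^ s ∂P +
            ∫⁻ ω in {ω | I n r ω ≤ ℓ}, ‖A n r ω (z k) - Astar r ω (z k)‖ₑ ^ s ∂P) := by
          have hm : Measurable fun ω => ‖A n r ω (z k)‖ₑ ^ s := (hmA k).enorm.pow_const s
          have hm' : Measurable fun ω => ‖A n r ω (z k)‖ₑ ^ s +
              ‖A n r ω (z k) - Astar r ω (z k)‖ₑ ^ s :=
            hm.add (((hmA k).sub (hmS k)).enorm.pow_const s)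
          rw [lintegral_const_mul _ hm', lintegral_add_left hm]
      _ ≤ _ := mul_le_mul_right (add_le_add_right (setLIntegral_le_lintegral _ _) _) _

end AnalyticRecurrence

/-! ### Uniform moments near a contraction point -/

/-- The constant in front of the main term can be taken arbitrarily close to 1, so a strict
contraction survives a small perturbation; the crude factor `2 ^ s` would not allow this. -/
lemma ENNReal.add_rpow_le_weighted {s : ℝ} (hs : 0 < s) {δ : ℝ≥0∞} (hδ : δ ≠ 0) (hδ' : δ ≠ ⊤)
    (a b : ℝ≥0∞) : (a + b) ^ s ≤ (1 + δ) ^ s * a ^ s + (1 + δ⁻¹) ^ s * b ^ s := by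
  rw [← ENNReal.mul_rpow_of_nonneg _ _ hs.le, ← ENNReal.mul_rpow_of_nonneg _ _ hs.le]
  rcases le_total b (δ * a) with h | h
  · refine le_trans (ENNReal.rpow_le_rpow ?_ hs.le) le_self_add
    rw [add_mul, one_mul]
    exact add_le_add_right h a
  · refine le_trans (ENNReal.rpow_le_rpow ?_ hs.le) le_add_self
    have : a ≤ δ⁻¹ * b := by
      calc a = δ⁻¹ * (δ * a) := by rw [← mul_assoc, ENNReal.inv_mul_cancel hδ hδ', one_mul]
        _ ≤ _ := mul_le_mul_right h _
    rw [add_mul, one_mul, add_comm]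
    exact add_le_add_right this b

lemma ENNReal.exists_one_add_rpow_mul_lt_one {s : ℝ} {θ : ℝ≥0∞} (hθ : θ < 1) :
    ∃ δ : ℝ≥0∞, δ ≠ 0 ∧ δ ≠ ⊤ ∧ (1 + δ) ^ s * θ < 1 := by
  have hc : Tendsto (fun n : ℕ => (1 + (n : ℝ≥0∞)⁻¹) ^ s * θ) atTop (𝓝 ((1 + 0) ^ s * θ)) := by
    refine ENNReal.Tendsto.mul_const ?_ (Or.inr hθ.ne_top)
    exact ((ENNReal.continuous_rpow_const (y := s)).tendsto _).comp
      (tendsto_const_nhds.add ENNReal.tendsto_inv_nat_nhds_zero)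
  rw [add_zero, ENNReal.one_rpow, one_mul] at hc
  obtain ⟨n, hn, hn0⟩ := ((hc.eventually (gt_mem_nhds hθ)).and (eventually_gt_atTop 0)).exists
  exact ⟨_, by simp, by simpa using hn0.ne', hn⟩

section

variable {Ω : Type*} [MeasurableSpace Ω] {P : Measure Ω}

lemma lintegral_enorm_rpow_le_weighted {s : ℝ} (hs : 0 < s) {δ : ℝ≥0∞} (hδ : δ ≠ 0) (hδ' : δ ≠ ⊤)
    {f g : Ω → ℂ} (hf : Measurable f) (hg : Measurable g) :
    ∫⁻ ω, ‖f ω‖ₑ ^ s ∂P ≤ (1 + δ) ^ s * ∫⁻ ω, ‖g ω‖ₑ ^ s ∂P +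
      (1 + δ⁻¹) ^ s * ∫⁻ ω, ‖f ω - g ω‖ₑ ^ s ∂P := by
  have h1 : Measurable fun ω => ‖g ω‖ₑ ^ s := hg.enorm.pow_const s
  have h2 : Measurable fun ω => ‖f ω - g ω‖ₑ ^ s := (hf.sub hg).enorm.pow_const s
  rw [← lintegral_const_mul _ h1, ← lintegral_const_mul _ h2, ← lintegral_add_left (h1.const_mul _)]
  refine lintegral_mono fun ω => le_trans (ENNReal.rpow_le_rpow ?_ hs.le)
    (ENNReal.add_rpow_le_weighted hs hδ hδ' _ _)
  calc ‖f ω‖ₑ = ‖g ω + (f ω - g ω)‖ₑ := by congr 1; ring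
    _ ≤ _ := enorm_add_le _ _

lemma LocallyBoundedInLp.lintegral_lt_top {D : Opens ℂ} {Ξ : Ω → HolSpace D} {s : ℝ}
    (h : LocallyBoundedInLp P Ξ s) (z : D) : ∫⁻ ω, ‖Ξ ω z‖ₑ ^ s ∂P < ⊤ := by
  obtain ⟨V, hV, hfin⟩ := h z
  exact (le_iSup₂ (f := fun (z : D) (_ : z ∈ V) => ∫⁻ ω, ‖Ξ ω z‖ₑ ^ s ∂P) z
    (mem_of_mem_nhds hV)).trans_lt hfin

lemma LocallyBoundedInLp.mono [IsProbabilityMeasure P] {D : Opens ℂ} {Ξ : Ω → HolSpace D}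
    {p s : ℝ} (hp : 0 ≤ p) (hps : p ≤ s) (h : LocallyBoundedInLp P Ξ s) :
    LocallyBoundedInLp P Ξ p := fun x => by
  obtain ⟨V, hV, hfin⟩ := h x
  refine ⟨V, hV, lt_of_le_of_lt (b := 1 + ⨆ z ∈ V, ∫⁻ ω, ‖Ξ ω z‖ₑ ^ s ∂P) ?_
    (ENNReal.add_lt_top.2 ⟨ENNReal.one_lt_top, hfin⟩)⟩
  refine iSup₂_le fun z hz => ?_
  calc ∫⁻ ω, ‖Ξ ω z‖ₑ ^ p ∂P ≤ ∫⁻ ω, (1 + ‖Ξ ω z‖ₑ ^ s) ∂P :=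
        lintegral_mono fun ω => ENNReal.rpow_le_one_add_rpow hp hps _
    _ = 1 + ∫⁻ ω, ‖Ξ ω z‖ₑ ^ s ∂P := by rw [lintegral_add_left measurable_const]; simp
    _ ≤ _ := add_le_add_right
        (le_iSup₂ (f := fun (z : D) (_ : z ∈ V) => ∫⁻ ω, ‖Ξ ω z‖ₑ ^ s ∂P) z hz) _

lemma tendsto_of_tendsto_biSup {D : Type*} {F : ℕ → D → ℝ≥0∞} {U : Set D}
    (h : Tendsto (fun n => ⨆ z ∈ U, F n z) atTop (𝓝 0)) {z : D} (hz : z ∈ U) :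
    Tendsto (fun n => F n z) atTop (𝓝 0) :=
  tendsto_of_tendsto_of_tendsto_of_le_of_le tendsto_const_nhds h (fun _ => zero_le)
    fun n => le_iSup₂ (f := fun (z : D) (_ : z ∈ U) => F n z) z hz

end

namespace AnalyticRecurrence

variable {Ω : Type*} [MeasurableSpace Ω] {P : Measure Ω} [IsProbabilityMeasure P] {D : Opens ℂ}
  {m n₀ : ℕ} {X : ℕ → Ω → HolSpace D} {A : ℕ → Fin m → Ω → HolSpace D}
  {b : ℕ → Ω → HolSpace D} {I : ℕ → Fin m → Ω → ℕ} {Y : Fin m → ℕ → Ω → HolSpace D}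

open HolSpace Metric

/-- Uniform moment bounds near a point at which the limiting recursion is contractive. -/
lemma exists_ball_moments (h : AnalyticRecurrence P n₀ X A b I Y)
    {Astar : Fin m → Ω → HolSpace D} {bstar : Ω → HolSpace D}
    (hAstar : ∀ r, Measurable (Astar r)) (hbstar : Measurable bstar)
    {s : ℝ} (hs : 0 < s) (hs2 : s ≤ 2) (hX : ∀ n, LocallyBoundedInLp P (X n) s)
    (hbb : ∀ n, n₀ ≤ n → LocallyBoundedInLp P (b n) s)
    (hc : 1 < s → ∀ n, ∀ z : D, ∫ ω, X n ω z ∂P = 0) {x : D} {U : Set D} (hU : U ∈ 𝓝 x)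
    (hA : ∀ r, Tendsto (fun n => ⨆ z ∈ U, ∫⁻ ω, ‖A n r ω z - Astar r ω z‖ₑ ^ s ∂P) atTop (𝓝 0))
    (hb : Tendsto (fun n => ⨆ z ∈ U, ∫⁻ ω, ‖b n ω z - bstar ω z‖ₑ ^ s ∂P) atTop (𝓝 0))
    (hfin : ∀ r, (⨆ z ∈ U, ∫⁻ ω, ‖Astar r ω z‖ₑ ^ s ∂P) < ⊤)
    (hlt : ∫⁻ ω, ∑ r, ‖Astar r ω x‖ₑ ^ s ∂P < 1) :
    ∃ R, 0 < R ∧ ball (x : ℂ) (2 * R) ⊆ D ∧ ball x (2 * R) ⊆ U ∧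
      (∃ M, M ≠ ⊤ ∧ ∀ n, ∀ z ∈ ball x (2 * R), ∫⁻ ω, ‖X n ω z‖ₑ ^ s ∂P ≤ M) ∧
      ∫⁻ ω, ∑ r, ⨆ z ∈ ball x (2 * R), ‖Astar r ω z‖ₑ ^ s ∂P < 1 := by
  obtain ⟨R₁, hR₁, hR₁U, hθ⟩ := exists_ball_lintegral_sum_iSup_lt_one hAstar hU hs hfin hlt
  set θ := ∫⁻ ω, ∑ r, ⨆ z ∈ ball x R₁, ‖Astar r ω z‖ₑ ^ s ∂P with hθdef
  obtain ⟨δ, hδ, hδ', hδθ⟩ := ENNReal.exists_one_add_rpow_mul_lt_one (s := s) hθ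
  obtain ⟨ξ, hξ, hξ1⟩ := exists_between hδθ
  have hev := fun z : D => measurable_apply z
  have hθz : ∀ z ∈ ball x R₁, ∑ r, ∫⁻ ω, ‖Astar r ω z‖ₑ ^ s ∂P ≤ θ := fun z hz => by
    have hm : ∀ r, Measurable fun ω => ‖Astar r ω z‖ₑ ^ s := fun r =>
      ((hev z).comp (hAstar r)).enorm.pow_const s
    rw [← lintegral_finsetSum _ fun r _ => hm r]
    exact lintegral_mono fun ω => Finset.sum_le_sum fun r _ =>
      le_iSup₂ (f := fun (z : D) (_ : z ∈ ball x R₁) => ‖Astar r ω z‖ₑ ^ s) z hz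
  set C := (1 + δ⁻¹) ^ s
  have hC : C ≠ ⊤ := ENNReal.rpow_ne_top_of_nonneg hs.le
    (ENNReal.add_ne_top.2 ⟨by simp, ENNReal.inv_ne_top.2 hδ⟩)
  have hlim : Tendsto (fun n => (1 + δ) ^ s * θ +
      C * ∑ r, ⨆ z ∈ U, ∫⁻ ω, ‖A n r ω z - Astar r ω z‖ₑ ^ s ∂P) atTop (𝓝 ((1 + δ) ^ s * θ)) := by
    have := tendsto_const_nhds (x := (1 + δ) ^ s * θ).add (ENNReal.Tendsto.const_mul (a := C)
      (tendsto_finsetSum Finset.univ fun r _ => hA r) (Or.inr hC))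
    simpa using this
  obtain ⟨n₁, hn₁⟩ := eventually_atTop.1 ((hlim.eventually (gt_mem_nhds hξ)).and
    ((hb.eventually (gt_mem_nhds one_pos)).and (eventually_ge_atTop n₀)))
  have hn₁0 : n₀ ≤ n₁ := (hn₁ n₁ le_rfl).2.2
  -- Local boundedness has to be uniform only for `b n₁` and the finitely many `X n` with `n < n₁`,
  -- so a common neighbourhood exists. Later `b n` are compared with `bstar`, and `bstar` with `b
  -- n₁`; this explains the nested constant `B`.
  obtain ⟨W, hW, hWfin⟩ := hbb n₁ hn₁0 x
  choose WX hWX hWXfin using fun n => hX n x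
  have hWXn : (⋂ n ∈ Finset.range n₁, WX n) ∈ 𝓝 x :=
    (Filter.biInter_finset_mem _).2 fun n _ => hWX n
  obtain ⟨R, hR, hRD, hRU⟩ := exists_ball_subset
    (inter_mem (inter_mem (ball_mem_nhds x hR₁) hU) (inter_mem hW hWXn))
  set Mb := ⨆ z ∈ W, ∫⁻ ω, ‖b n₁ ω z‖ₑ ^ s ∂P
  set K := ∑ n ∈ Finset.range n₁, ⨆ z ∈ WX n, ∫⁻ ω, ‖X n ω z‖ₑ ^ s ∂P
  have hK : K ≠ ⊤ := ENNReal.sum_ne_top.2 fun n _ => (hWXfin n).ne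
  set c : ℝ≥0∞ := (1 + 1) ^ s
  have hcc : c ≠ ⊤ := ENNReal.rpow_ne_top_of_nonneg hs.le (by norm_num)
  set B := c * (c * Mb + c * 1) + c * 1
  have hB : B ≠ ⊤ := by
    have := hWfin.ne
    finiteness
  refine ⟨R, hR, hRD, fun z hz => (hRU hz).1.2, ⟨max (6 * K) (6 * B / (1 - ξ)), ?_, ?_⟩, ?_⟩
  · exact max_ne_top (ENNReal.mul_ne_top (by norm_num) hK)
      (ENNReal.div_ne_top (ENNReal.mul_ne_top (by norm_num) hB) (tsub_pos_of_lt hξ1).ne')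
  · intro n z hz
    obtain ⟨⟨hz1, hzU⟩, hzW, hzX⟩ := hRU hz
    refine h.lintegral_le_of_contraction z hs hs2 hn₁0 hξ1 hB hK (fun n hn => ?_) (fun n hn => ?_)
      (fun n hn => ?_) (fun n => ((hX n).lintegral_lt_top z).ne) (fun hs1 n => hc hs1 n z) n
    · obtain ⟨hnξ, -, hnn⟩ := hn₁ n hn
      refine le_trans ?_ hnξ.le
      calc ∑ r, ∫⁻ ω, ‖A n r ω z‖ₑ ^ s ∂P
          ≤ ∑ r, ((1 + δ) ^ s * ∫⁻ ω, ‖Astar r ω z‖ₑ ^ s ∂P +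
              C * ⨆ z ∈ U, ∫⁻ ω, ‖A n r ω z - Astar r ω z‖ₑ ^ s ∂P) :=
            Finset.sum_le_sum fun r _ => (lintegral_enorm_rpow_le_weighted hs hδ hδ'
              ((hev z).comp (h.measurable_A n hnn r)) ((hev z).comp (hAstar r))).trans
              (add_le_add_right (mul_le_mul_right (le_iSup₂ (f := fun (z : D) (_ : z ∈ U) =>
                ∫⁻ ω, ‖A n r ω z - Astar r ω z‖ₑ ^ s ∂P) z hzU) _) _)
        _ = (1 + δ) ^ s * ∑ r, ∫⁻ ω, ‖Astar r ω z‖ₑ ^ s ∂P +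
              C * ∑ r, ⨆ z ∈ U, ∫⁻ ω, ‖A n r ω z - Astar r ω z‖ₑ ^ s ∂P := by
            rw [Finset.sum_add_distrib, Finset.mul_sum, Finset.mul_sum]
        _ ≤ _ := add_le_add_left (mul_le_mul_right (hθz z hz1) _) _
    · have hdiff : ∀ n, n₁ ≤ n → ∫⁻ ω, ‖b n ω z - bstar ω z‖ₑ ^ s ∂P ≤ 1 := fun n hn =>
        (le_iSup₂ (f := fun (z : D) (_ : z ∈ U) => ∫⁻ ω, ‖b n ω z - bstar ω z‖ₑ ^ s ∂P)
          z hzU).trans (hn₁ n hn).2.1.le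
      have hmb : ∀ n, n₁ ≤ n → Measurable fun ω => b n ω z := fun n hn =>
        (hev z).comp (h.measurable_b n (hn₁0.trans hn))
      have hms : Measurable fun ω => bstar ω z := (hev z).comp hbstar
      have hstar : ∫⁻ ω, ‖bstar ω z‖ₑ ^ s ∂P ≤ c * Mb + c * 1 := by
        have := lintegral_enorm_rpow_le_weighted (P := P) hs one_ne_zero ENNReal.one_ne_top hms
          (hmb n₁ le_rfl)
        rw [inv_one] at this
        refine this.trans (add_le_add (mul_le_mul_right (le_iSup₂ (f := fun (z : D) (_ : z ∈ W) =>
          ∫⁻ ω, ‖b n₁ ω z‖ₑ ^ s ∂P) z hzW) _) (mul_le_mul_right ?_ _))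
        simpa only [enorm_sub_rev] using hdiff n₁ le_rfl
      have := lintegral_enorm_rpow_le_weighted (P := P) hs one_ne_zero ENNReal.one_ne_top
        (hmb n hn) hms
      rw [inv_one] at this
      exact this.trans (add_le_add (mul_le_mul_right hstar _) (mul_le_mul_right (hdiff n hn) _))
    · refine le_trans ?_ (Finset.single_le_sum (f := fun n => ⨆ z ∈ WX n,
        ∫⁻ ω, ‖X n ω z‖ₑ ^ s ∂P) (fun _ _ => zero_le) (Finset.mem_range.2 hn))
      exact le_iSup₂ (f := fun (z : D) (_ : z ∈ WX n) => ∫⁻ ω, ‖X n ω z‖ₑ ^ s ∂P) z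
        (Set.mem_iInter₂.1 hzX n (Finset.mem_range.2 hn))
  · refine lt_of_le_of_lt (lintegral_mono fun ω => Finset.sum_le_sum fun r _ => ?_) hθ
    exact biSup_mono fun z hz => (hRU hz).1.1

end AnalyticRecurrence

/-! ### Moments and centring of weak limits -/

/-- A characteristic function that is flat at the origin forces the mean to vanish. -/
lemma integral_eq_zero_of_enorm_sub_one_le {S : Type*} [MeasurableSpace S] {μ : Measure S}
    [IsProbabilityMeasure μ] {s : ℝ} (hs : 1 < s) (hs2 : s ≤ 2) {u : S → ℝ} (hu : Measurable u)
    (hfin : ∫⁻ y, ‖u y‖ₑ ^ s ∂μ ≠ ⊤) {K : ℝ≥0∞} (hK : K ≠ ⊤)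
    (h : ∀ ε : ℝ, 0 < ε →
      ‖∫ y, Complex.exp (Complex.I * ((ε * u y : ℝ) : ℂ)) ∂μ - 1‖ₑ ≤ K * ‖ε‖ₑ ^ s) :
    ∫ y, u y ∂μ = 0 := by
  have hs0 : 0 < s := by linarith
  set e := ∫ y, u y ∂μ
  set M := ∫⁻ y, ‖u y‖ₑ ^ s ∂μ
  have hui : Integrable u μ := integrable_of_lintegral_rpow hu.aestronglyMeasurable hs.le hfin
  -- The first-order term has modulus `ε |e|`, while both the characteristic function increment and
  -- the Taylor remainder are of order `ε^s`. Division by `ε` leaves `ε^(s-1)`, which tends to 0.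
  have hbound : ∀ ε : ℝ, 0 < ε → ‖e‖ₑ ≤ (K + 3 * M) * ‖ε‖ₑ ^ (s - 1) := by
    intro ε hε
    have hε0 : ‖ε‖ₑ ≠ 0 := by simpa using hε.ne'
    have hexp : Integrable (fun y => Complex.exp (Complex.I * ((ε * u y : ℝ) : ℂ))) μ :=
      Integrable.of_bound (by fun_prop) 1 (Eventually.of_forall fun y =>
        (Complex.norm_exp_I_mul_ofReal _).le)
    have hlin : Integrable (fun y => Complex.I * ((ε * u y : ℝ) : ℂ)) μ :=
      (hui.const_mul ε).ofReal.const_mul _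
    have hexp1 : Integrable (fun y => Complex.exp (Complex.I * ((ε * u y : ℝ) : ℂ)) - 1) μ :=
      hexp.sub (integrable_const _)
    have hint : ∫ y, (Complex.exp (Complex.I * ((ε * u y : ℝ) : ℂ)) - 1 -
        Complex.I * ((ε * u y : ℝ) : ℂ)) ∂μ =
        (∫ y, Complex.exp (Complex.I * ((ε * u y : ℝ) : ℂ)) ∂μ - 1) - Complex.I * (ε * e : ℝ) := by
      rw [integral_sub hexp1 hlin, integral_sub hexp (integrable_const _), integral_const_mul,
        integral_complex_ofReal, integral_const_mul]
      simp [e]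
    have hrem : ‖∫ y, (Complex.exp (Complex.I * ((ε * u y : ℝ) : ℂ)) - 1 -
        Complex.I * ((ε * u y : ℝ) : ℂ)) ∂μ‖ₑ ≤ 3 * (‖ε‖ₑ ^ s * M) := by
      refine (enorm_integral_le_lintegral_enorm _).trans ?_
      rw [← lintegral_const_mul _ (hu.enorm.pow_const s),
        ← lintegral_const_mul _ ((hu.enorm.pow_const s).const_mul _)]
      refine lintegral_mono fun y => ?_
      rw [← ENNReal.mul_rpow_of_nonneg _ _ hs0.le, ← enorm_mul, enorm_rpow_eq_ofReal _ hs0.le,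
        ← ofReal_norm, show (3 : ℝ≥0∞) = ENNReal.ofReal 3 by norm_num,
        ← ENNReal.ofReal_mul (by norm_num)]
      exact ENNReal.ofReal_le_ofReal (norm_exp_I_mul_sub_one_sub_le_rpow hs hs2 _)
    have hmul : ‖ε‖ₑ * ‖e‖ₑ ≤ ‖ε‖ₑ * ((K + 3 * M) * ‖ε‖ₑ ^ (s - 1)) := by
      calc ‖ε‖ₑ * ‖e‖ₑ = ‖Complex.I * ((ε * e : ℝ) : ℂ)‖ₑ := by
            rw [enorm_mul, ← enorm_mul, ← ofReal_norm (Complex.I), Complex.norm_I,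
              ← ofReal_norm ((ε * e : ℝ) : ℂ), Complex.norm_real, ofReal_norm]
            simp
        _ = ‖(∫ y, Complex.exp (Complex.I * ((ε * u y : ℝ) : ℂ)) ∂μ - 1) -
            ∫ y, (Complex.exp (Complex.I * ((ε * u y : ℝ) : ℂ)) - 1 -
              Complex.I * ((ε * u y : ℝ) : ℂ)) ∂μ‖ₑ := by
            rw [hint]; congr 1; ring
        _ ≤ K * ‖ε‖ₑ ^ s + 3 * (‖ε‖ₑ ^ s * M) := enorm_sub_le.trans (add_le_add (h ε hε) hrem)
        _ = (K + 3 * M) * ‖ε‖ₑ ^ (1 + (s - 1)) := by rw [add_sub_cancel]; ring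
        _ = _ := by
            rw [ENNReal.rpow_add _ _ hε0 enorm_ne_top, ENNReal.rpow_one]; ring
    exact (ENNReal.mul_le_mul_iff_right hε0 enorm_ne_top).1 hmul
  have hC : K + 3 * M ≠ ⊤ := ENNReal.add_ne_top.2 ⟨hK, ENNReal.mul_ne_top (by norm_num) hfin⟩
  have hlim : Tendsto (fun n : ℕ => (K + 3 * M) * ‖1 / ((n : ℝ) + 1)‖ₑ ^ (s - 1)) atTop (𝓝 0) := by
    have h1 : Tendsto (fun n : ℕ => ‖1 / ((n : ℝ) + 1)‖ₑ ^ (s - 1)) atTop (𝓝 (‖(0 : ℝ)‖ₑ ^ (s - 1))) :=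
      ((ENNReal.continuous_rpow_const (y := s - 1)).tendsto _).comp
        (tendsto_one_div_add_atTop_nhds_zero_nat (𝕜 := ℝ)).enorm
    rw [enorm_zero, ENNReal.zero_rpow_of_pos (by linarith)] at h1
    simpa using ENNReal.Tendsto.const_mul h1 (Or.inr hC)
  have hle : ‖e‖ₑ ≤ 0 := ge_of_tendsto' hlim fun n => hbound _ (by positivity)
  exact enorm_eq_zero.1 (le_zero_iff.1 hle)

namespace HolSpace

variable {D : Opens ℂ}

lemma tendsto_charFunAt {μ : ℕ → ProbabilityMeasure (HolSpace D)}
    {ν : ProbabilityMeasure (HolSpace D)} (h : Tendsto μ atTop (𝓝 ν)) {ι : Type*} [Fintype ι]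
    (z : ι → D) (t : ι → ℂ) :
    Tendsto (fun n => charFunAt (μ n : Measure (HolSpace D)) z t) atTop
      (𝓝 (charFunAt (ν : Measure (HolSpace D)) z t)) := by
  have hev : Continuous (evalAt z) := continuous_pi fun k => continuous_apply (z k)
  have hcont : Continuous fun f : HolSpace D => planeWave t (evalAt z f) :=
    continuous_planeWave.comp (continuous_const.prodMk hev)
  exact (ProbabilityMeasure.tendsto_iff_forall_integral_rclike_tendsto ℂ).1 h
    (BoundedContinuousFunction.ofNormedAddCommGroup _ hcont 1 fun f => (norm_planeWave _ _).le)

/-- Moments are lower semicontinuous under weak convergence, by the portmanteau inequality for open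
sets and a Fatou argument. -/
lemma lintegral_le_of_tendsto {μ : ℕ → ProbabilityMeasure (HolSpace D)}
    {ν : ProbabilityMeasure (HolSpace D)} (h : Tendsto μ atTop (𝓝 ν)) {s : ℝ} (hs : 0 < s) (z : D)
    {M : ℝ≥0∞} (hM : ∀ n, ∫⁻ f, ‖f z‖ₑ ^ s ∂(μ n : Measure (HolSpace D)) ≤ M) :
    ∫⁻ f, ‖f z‖ₑ ^ s ∂(ν : Measure (HolSpace D)) ≤ M := by
  let := upgradeIsCompletelyMetrizable (HolSpace D)
  have hcont : Continuous fun f : HolSpace D => ‖f z‖ ^ s :=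
    (continuous_apply z).norm.rpow_const fun _ => Or.inr hs.le
  have := lintegral_le_liminf_lintegral_of_forall_isOpen_measure_le_liminf_measure
    (μ := (ν : Measure (HolSpace D))) (μs := fun n => (μ n : Measure (HolSpace D))) hcont
    (fun f => by positivity)
    fun G hG => ProbabilityMeasure.le_liminf_measure_open_of_tendsto h hG
  simp only [← enorm_rpow_eq_ofReal _ hs.le] at this
  exact this.trans (liminf_le_of_le (by isBoundedDefault) fun c hc =>
    let ⟨n, hn⟩ := hc.exists; hn.trans (hM n))

/-- Flatness at the origin survives pointwise limits of characteristic functions, so it carries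
centring over to the limit law. The real and imaginary parts are tested with `c = 1` and `c = -i`.
-/
lemma integral_eq_zero_of_charFunAt {ν : Measure (HolSpace D)} [IsProbabilityMeasure ν] {s : ℝ}
    (hs : 1 < s) (hs2 : s ≤ 2) (z : D) (hfin : ∫⁻ f, ‖f z‖ₑ ^ s ∂ν ≠ ⊤) {K : ℝ≥0∞} (hK : K ≠ ⊤)
    (h : ∀ t : Unit → ℂ, ‖charFunAt ν (fun _ : Unit => z) t - 1‖ₑ ≤ K * ‖t‖ₑ ^ s) :
    ∫ f, f z ∂ν = 0 := by
  have hs0 : 0 < s := by linarith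
  have hev := measurable_apply z
  have hint : Integrable (fun f : HolSpace D => f z) ν :=
    integrable_of_lintegral_rpow hev.aestronglyMeasurable hs.le hfin
  have key : ∀ c : ℂ, ‖c‖ = 1 → ∫ f, (c * f z).re ∂ν = 0 := by
    intro c hc
    have hc' : ‖c‖ₑ = 1 := by rw [← ofReal_norm, hc, ENNReal.ofReal_one]
    have hm : Measurable fun f : HolSpace D => (c * f z).re :=
      Complex.measurable_re.comp (hev.const_mul c)
    refine integral_eq_zero_of_enorm_sub_one_le hs hs2 hm (ne_top_of_le_ne_top hfin
      (lintegral_mono fun f => ENNReal.rpow_le_rpow ?_ hs0.le)) hK fun ε hε => ?_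
    · calc ‖(c * f z).re‖ₑ ≤ ‖c * f z‖ₑ := by
            rw [← ofReal_norm, ← ofReal_norm]
            exact ENNReal.ofReal_le_ofReal (Complex.abs_re_le_norm _)
        _ = ‖f z‖ₑ := by rw [enorm_mul, hc', one_mul]
    · have ht := h fun _ => ε * c
      have h1 : ‖fun _ : Unit => (ε : ℂ) * c‖ₑ = ‖ε‖ₑ := by
        rw [← ofReal_norm, ← ofReal_norm, pi_norm_const, norm_mul, hc, mul_one, Complex.norm_real]
      rw [h1] at ht
      have h2 : charFunAt ν (fun _ : Unit => z) (fun _ => ε * c) =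
          ∫ f, Complex.exp (Complex.I * ((ε * (c * f z).re : ℝ) : ℂ)) ∂ν := by
        simp [charFunAt, planeWave, mul_assoc]
      rwa [h2] at ht
  have hre := key 1 (by simp)
  have him := key (-Complex.I) (by simp)
  refine Complex.ext ?_ ?_
  · have := integral_re (μ := ν) hint
    simp only [RCLike.re_to_complex] at this
    rw [← this]
    simpa using hre
  · have := integral_im (μ := ν) hint
    simp only [RCLike.im_to_complex] at this
    rw [← this]
    simpa using him

end HolSpace

open Metric in
lemma isConnected_iUnion_ball {E : Type*} [NormedAddCommGroup E] [NormedSpace ℝ E] {Δ : Set E}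
    (hΔ : IsConnected Δ) (R : Δ → ℝ) (hR : ∀ x, 0 < R x) :
    IsConnected (⋃ x : Δ, ball (x : E) (R x)) := by
  obtain ⟨x₀, hx₀⟩ := hΔ.nonempty
  have hsub : Δ ⊆ ⋃ x : Δ, ball (x : E) (R x) := fun x hx =>
    Set.mem_iUnion.2 ⟨⟨x, hx⟩, mem_ball_self (hR _)⟩
  refine ⟨⟨x₀, hsub hx₀⟩, ?_⟩
  -- Adding `Δ` to each ball does not change the union, but makes all pieces connected with a common
  -- point.
  have heq : (⋃ x : Δ, ball (x : E) (R x)) = ⋃ x : Δ, (Δ ∪ ball (x : E) (R x)) := by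
    refine Set.Subset.antisymm (Set.iUnion_mono fun x => Set.subset_union_right)
      (Set.iUnion_subset fun x => Set.union_subset hsub (Set.subset_iUnion_of_subset x subset_rfl))
  rw [heq]
  refine isPreconnected_iUnion ⟨x₀, Set.mem_iInter.2 fun x => Or.inl hx₀⟩ fun x => ?_
  exact IsPreconnected.union (x : E) x.2 (mem_ball_self (hR x)) hΔ.isPreconnected
    (convex_ball (x : E) (R x)).isPreconnected

/-! ### Convergence, fixed point and uniqueness -/

/-- The data of the recursion are contractive in `L^s` on `V`, with uniform moments of the
solution. -/
structure IsContractiveOn {Ω : Type*} [MeasurableSpace Ω] (P : Measure Ω) {D : Opens ℂ} {m : ℕ}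
    (X : ℕ → Ω → HolSpace D) (A : ℕ → Fin m → Ω → HolSpace D) (b : ℕ → Ω → HolSpace D)
    (I : ℕ → Fin m → Ω → ℕ) (Astar : Fin m → Ω → HolSpace D) (bstar : Ω → HolSpace D) (s : ℝ)
    (V : Set D) : Prop where
  pos : 0 < s
  le_two : s ≤ 2
  exists_moment : ∃ M, M ≠ ⊤ ∧ ∀ n, ∀ z ∈ V, ∫⁻ ω, ‖X n ω z‖ₑ ^ s ∂P ≤ M
  centered : 1 < s → ∀ n, ∀ z ∈ V, ∫ ω, X n ω z ∂P = 0
  tendsto_A : ∀ r, ∀ z ∈ V,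
    Tendsto (fun n => ∫⁻ ω, ‖A n r ω z - Astar r ω z‖ₑ ^ s ∂P) atTop (𝓝 0)
  tendsto_b : ∀ z ∈ V, Tendsto (fun n => ∫⁻ ω, ‖b n ω z - bstar ω z‖ₑ ^ s ∂P) atTop (𝓝 0)
  lt_one : ∫⁻ ω, ∑ r, ⨆ z ∈ V, ‖Astar r ω z‖ₑ ^ s ∂P < 1
  tendsto_small : ∀ ℓ r, ∀ z ∈ V,
    Tendsto (fun n => ∫⁻ ω in {ω | I n r ω ≤ ℓ}, ‖A n r ω z‖ₑ ^ s ∂P) atTop (𝓝 0)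

namespace HolSpace

/-- The inclusion of an open subset. -/
def incl {D D' : Opens ℂ} (h : D' ≤ D) (z : D') : D := ⟨z, h z.2⟩

lemma continuous_incl {D D' : Opens ℂ} (h : D' ≤ D) : Continuous (incl h) :=
  continuous_subtype_val.subtype_mk _

/-- Laws of random analytic functions, restricted to a smaller open set. -/
noncomputable def restrictLaw {Ω : Type*} [MeasurableSpace Ω] (P : Measure Ω)
    [IsProbabilityMeasure P] {D D' : Opens ℂ} (h : D' ≤ D) {X : ℕ → Ω → HolSpace D}
    (hX : ∀ n, Measurable (X n)) (n : ℕ) : ProbabilityMeasure (HolSpace D') :=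
  ⟨P.map fun ω => (X n ω).restrict h,
    Measure.isProbabilityMeasure_map ((measurable_restrict h).comp (hX n)).aemeasurable⟩

variable {Ω : Type*} [MeasurableSpace Ω] {P : Measure Ω} [IsProbabilityMeasure P]
  {D D' : Opens ℂ} {X : ℕ → Ω → HolSpace D}

lemma lintegral_restrictLaw (h : D' ≤ D) (hX : ∀ n, Measurable (X n)) (n : ℕ)
    {F : HolSpace D' → ℝ≥0∞} (hF : Measurable F) :
    ∫⁻ f, F f ∂(restrictLaw P h hX n : Measure (HolSpace D')) =
      ∫⁻ ω, F ((X n ω).restrict h) ∂P :=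
  lintegral_map hF ((measurable_restrict h).comp (hX n))

lemma charFunAt_restrictLaw (h : D' ≤ D) (hX : ∀ n, Measurable (X n)) (n : ℕ) {ι : Type*}
    [Fintype ι] (z : ι → D') (t : ι → ℂ) :
    charFunAt (restrictLaw P h hX n : Measure (HolSpace D')) z t =
      charFunAt (P.map (X n)) (fun k => incl h (z k)) t := by
  rw [charFunAt_map (hX n)]
  exact charFunAt_map ((measurable_restrict h).comp (hX n)) z t

end HolSpace

namespace AnalyticRecurrence

variable {Ω : Type*} [MeasurableSpace Ω] {P : Measure Ω} [IsProbabilityMeasure P]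
  {D D' : Opens ℂ} {m n₀ : ℕ} {X : ℕ → Ω → HolSpace D} {A : ℕ → Fin m → Ω → HolSpace D}
  {b : ℕ → Ω → HolSpace D} {I : ℕ → Fin m → Ω → ℕ} {Y : Fin m → ℕ → Ω → HolSpace D}
  {Astar : Fin m → Ω → HolSpace D} {bstar : Ω → HolSpace D} {s : ℝ} {V : Set D}

open HolSpace Metric

lemma exists_isCharRecursion (h : AnalyticRecurrence P n₀ X A b I Y)
    (hAstar : ∀ r, Measurable (Astar r)) (hbstar : Measurable bstar)
    (hV : IsContractiveOn P X A b I Astar bstar s V) {ι : Type*} [Fintype ι] {z : ι → D}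
    (hz : ∀ k, z k ∈ V) :
    ∃ K, IsCharRecursion P n₀ (fun n => charFunAt (P.map (X n)) z)
      (fun n r ω => evalAt z (A n r ω)) (fun n ω => evalAt z (b n ω)) I
      (fun r ω => evalAt z (Astar r ω)) (fun ω => evalAt z (bstar ω)) s (min s 1) K := by
  obtain ⟨M, hM, hXM⟩ := hV.exists_moment
  exact h.isCharRecursion hAstar hbstar hV.pos hV.le_two hM hXM hV.centered hV.tendsto_A
    hV.tendsto_b hV.lt_one hV.tendsto_small z hz

lemma isTightMeasureSet_restrictLaw (h : AnalyticRecurrence P n₀ X A b I Y) (hD : D' ≤ D)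
    (hcover : ∀ y : D', ∃ (x : D) (R s : ℝ), 0 < R ∧ (y : ℂ) ∈ ball (x : ℂ) R ∧
      ball (x : ℂ) (2 * R) ⊆ D ∧ IsContractiveOn P X A b I Astar bstar s (ball x (2 * R))) :
    IsTightMeasureSet (Set.range fun n =>
      (restrictLaw P hD h.measurable_X n : Measure (HolSpace D'))) := by
  refine isTightMeasureSet_of_moments fun y => ?_
  obtain ⟨x, R, s, hR, hy, hsub, hV⟩ := hcover y
  obtain ⟨M, hM, hXM⟩ := hV.exists_moment
  refine ⟨incl hD ⁻¹' ball x R, (continuous_incl hD).continuousAt (isOpen_ball.mem_nhds hy), s,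
    hV.pos, 4 * M, ENNReal.mul_lt_top (by norm_num) hM.lt_top, fun n => ?_⟩
  rw [lintegral_restrictLaw hD h.measurable_X n (measurable_iSup_enorm_rpow _ s)]
  calc ∫⁻ ω, ⨆ z ∈ incl hD ⁻¹' ball x R, ‖(X n ω).restrict hD z‖ₑ ^ s ∂P
      ≤ ∫⁻ ω, ⨆ z ∈ ball x R, ‖X n ω z‖ₑ ^ s ∂P := lintegral_mono fun ω => iSup₂_le fun z hz =>
        le_iSup₂ (f := fun (z : D) (_ : z ∈ ball x R) => ‖X n ω z‖ₑ ^ s) (incl hD z) hz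
    _ ≤ _ := lintegral_iSup_ball_le hR hV.pos hsub (h.measurable_X n)
    _ ≤ 4 * M := mul_le_mul_right (iSup₂_le fun z hz => hXM n z hz) _

variable {ν : ProbabilityMeasure (HolSpace D')}

lemma lintegral_limit_le (h : AnalyticRecurrence P n₀ X A b I Y) (hD : D' ≤ D)
    (hν : Tendsto (restrictLaw P hD h.measurable_X) atTop (𝓝 ν))
    (hV : IsContractiveOn P X A b I Astar bstar s V) :
    ∃ M, M ≠ ⊤ ∧ ∀ z : D', incl hD z ∈ V → ∫⁻ f, ‖f z‖ₑ ^ s ∂(ν : Measure (HolSpace D')) ≤ M := by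
  obtain ⟨M, hM, hXM⟩ := hV.exists_moment
  refine ⟨M, hM, fun z hz => lintegral_le_of_tendsto hν hV.pos z fun n => ?_⟩
  rw [lintegral_restrictLaw hD h.measurable_X n ((measurable_apply z).enorm.pow_const s)]
  exact hXM n _ hz

lemma integral_limit_eq_zero (h : AnalyticRecurrence P n₀ X A b I Y)
    (hAstar : ∀ r, Measurable (Astar r)) (hbstar : Measurable bstar) (hD : D' ≤ D)
    (hν : Tendsto (restrictLaw P hD h.measurable_X) atTop (𝓝 ν))
    (hV : IsContractiveOn P X A b I Astar bstar s V) (hs : 1 < s) {z : D'} (hz : incl hD z ∈ V) :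
    ∫ f, f z ∂(ν : Measure (HolSpace D')) = 0 := by
  obtain ⟨M, hM, hXM⟩ := h.lintegral_limit_le hD hν hV
  obtain ⟨K, hK⟩ := h.exists_isCharRecursion hAstar hbstar hV
    (z := fun _ : Unit => incl hD z) fun _ => hz
  refine integral_eq_zero_of_charFunAt hs hV.le_two z (ne_top_of_le_ne_top hM (hXM z hz))
    hK.K_ne_top fun t => ?_
  refine le_of_tendsto' ((tendsto_charFunAt hν (fun _ : Unit => z) t).sub_const 1).enorm fun n => ?_
  rw [charFunAt_restrictLaw]
  exact hK.enorm_sub_one_le n t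

lemma charFunAt_limit_eq (h : AnalyticRecurrence P n₀ X A b I Y)
    (hAstar : ∀ r, Measurable (Astar r)) (hbstar : Measurable bstar) (hD : D' ≤ D)
    (hν : Tendsto (restrictLaw P hD h.measurable_X) atTop (𝓝 ν))
    (hV : IsContractiveOn P X A b I Astar bstar s V) {ι : Type*} [Fintype ι] {z : ι → D'}
    (hz : ∀ k, incl hD (z k) ∈ V) (t : ι → ℂ) :
    charFunAt (contractionMap P (fun r ω => (Astar r ω).restrict hD)
      (fun ω => (bstar ω).restrict hD) ν) z t = charFunAt (ν : Measure (HolSpace D')) z t := by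
  obtain ⟨K, hK⟩ := h.exists_isCharRecursion hAstar hbstar hV hz
  have hA' : ∀ r, Measurable fun ω => (Astar r ω).restrict hD := fun r =>
    (measurable_restrict hD).comp (hAstar r)
  have hb' : Measurable fun ω => (bstar ω).restrict hD := (measurable_restrict hD).comp hbstar
  rw [charFunAt_contractionMap hA' hb']
  refine (hK.limit_eq (ψ := charFunAt (ν : Measure (HolSpace D')) z) (fun t => ?_) t).symm
  simpa only [charFunAt_restrictLaw] using tendsto_charFunAt hν z t

/-- The restricted laws converge, and the limit is a fixed point. -/
lemma exists_tendsto_restrictLaw (h : AnalyticRecurrence P n₀ X A b I Y)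
    (hAstar : ∀ r, Measurable (Astar r)) (hbstar : Measurable bstar) (hD : D' ≤ D)
    (hD' : IsConnected (D' : Set ℂ))
    (htight : IsTightMeasureSet (Set.range fun n =>
      (restrictLaw P hD h.measurable_X n : Measure (HolSpace D'))))
    (hV : IsContractiveOn P X A b I Astar bstar s V) (hVo : IsOpen V)
    (hne : (incl hD ⁻¹' V).Nonempty) :
    ∃ ν : ProbabilityMeasure (HolSpace D'),
      Tendsto (restrictLaw P hD h.measurable_X) atTop (𝓝 ν) ∧
      contractionMap P (fun r ω => (Astar r ω).restrict hD) (fun ω => (bstar ω).restrict hD) ν =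
        (ν : Measure (HolSpace D')) := by
  have hVo' : IsOpen (incl hD ⁻¹' V) := hVo.preimage (continuous_incl hD)
  -- The contraction is used only at points of `V`; tightness and the identity theorem extend
  -- convergence to all of `D'`.
  obtain ⟨ν, hν⟩ := exists_tendsto_of_planeWave hD' hVo' hne htight fun S t => by
    obtain ⟨K, hK⟩ := h.exists_isCharRecursion hAstar hbstar hV
      (z := fun k : S => incl hD (k : incl hD ⁻¹' V)) fun k => (k : incl hD ⁻¹' V).2
    have := hK.cauchySeq t
    simp only [← charFunAt_restrictLaw hD h.measurable_X] at this
    exact this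
  have hA' : ∀ r, Measurable fun ω => (Astar r ω).restrict hD := fun r =>
    (measurable_restrict hD).comp (hAstar r)
  have hb' : Measurable fun ω => (bstar ω).restrict hD := (measurable_restrict hD).comp hbstar
  have := isProbabilityMeasure_contractionMap P hA' hb' (ν : Measure (HolSpace D'))
  refine ⟨ν, hν, ext_of_planeWave hD' hVo' hne fun S t => ?_⟩
  exact h.charFunAt_limit_eq hAstar hbstar hD hν hV
    (z := fun k : S => ((k : incl hD ⁻¹' V) : D')) (fun k => (k : incl hD ⁻¹' V).2) t

end AnalyticRecurrence

open HolSpace in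
/-- Fixed points with bounded centered moments near a point of contraction agree. -/
lemma eq_of_contractionMap_eq {Ω : Type*} [MeasurableSpace Ω] {P : Measure Ω}
    [IsProbabilityMeasure P] {D : Opens ℂ} (hD : IsConnected (D : Set ℂ)) {m : ℕ}
    {A : Fin m → Ω → HolSpace D} {b : Ω → HolSpace D} (hA : ∀ r, Measurable (A r))
    (hb : Measurable b) {s : ℝ} (hs : 0 < s) (hs2 : s ≤ 2) {V : Set D} (hV : IsOpen V)
    (hne : V.Nonempty) (hlt : ∫⁻ ω, ∑ r, ⨆ z ∈ V, ‖A r ω z‖ₑ ^ s ∂P < 1)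
    {μ ν : Measure (HolSpace D)} [IsProbabilityMeasure μ] [IsProbabilityMeasure ν]
    (hμ : contractionMap P A b μ = μ) (hν : contractionMap P A b ν = ν)
    {M : ℝ≥0∞} (hM : M ≠ ⊤) (hμM : ∀ z ∈ V, ∫⁻ f, ‖f z‖ₑ ^ s ∂μ ≤ M)
    (hνM : ∀ z ∈ V, ∫⁻ f, ‖f z‖ₑ ^ s ∂ν ≤ M) (hμc : 1 < s → ∀ z ∈ V, ∫ f, f z ∂μ = 0)
    (hνc : 1 < s → ∀ z ∈ V, ∫ f, f z ∂ν = 0) : μ = ν := by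
  refine ext_of_planeWave hD hV hne fun S t => ?_
  set z : S → D := fun k => (k : V)
  have hz : ∀ k, z k ∈ V := fun k => (k : V).2
  set c : ℝ≥0∞ := (Fintype.card S : ℝ≥0∞)
  have hflat : ∀ (κ : Measure (HolSpace D)) [IsProbabilityMeasure κ],
      (∀ z ∈ V, ∫⁻ f, ‖f z‖ₑ ^ s ∂κ ≤ M) → (1 < s → ∀ z ∈ V, ∫ f, f z ∂κ = 0) →
      ∀ t, ‖charFunAt κ z t - 1‖ₑ ≤ 3 * c ^ s * (c * M) * ‖t‖ₑ ^ s := by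
    intro κ _ hκM hκc t
    refine (enorm_charFunAt_sub_one_le hs hs2 z
      (fun k => ne_top_of_le_ne_top hM (hκM _ (hz k))) (fun hs1 k => hκc hs1 _ (hz k)) t).trans ?_
    refine mul_le_mul_left (mul_le_mul_right ?_ _) _
    exact (Finset.sum_le_sum fun k _ => hκM _ (hz k)).trans (by simp [c])
  have hfix : ∀ (κ : Measure (HolSpace D)) [IsProbabilityMeasure κ], contractionMap P A b κ = κ →
      ∀ t, charFunAt κ z t = ∫ ω, planeWave t (evalAt z (b ω)) *
        ∏ r, charFunAt κ z (t * evalAt z (A r ω)) ∂P := by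
    intro κ _ hκ t
    conv_lhs => rw [← hκ]
    exact charFunAt_contractionMap hA hb κ z t
  have hev := measurable_evalAt z
  have hcontr : ∑ r, ∫⁻ ω, ‖evalAt z (A r ω)‖ₑ ^ s ∂P < 1 := by
    refine lt_of_le_of_lt ?_ hlt
    have hm : ∀ r, Measurable fun ω => ⨆ z ∈ V, ‖A r ω z‖ₑ ^ s := fun r =>
      (measurable_iSup_enorm_rpow V s).comp (hA r)
    rw [lintegral_finsetSum _ fun r _ => hm r]
    refine Finset.sum_le_sum fun r _ => lintegral_mono fun ω => ?_
    exact pi_enorm_rpow_le_of_forall hs _ fun k =>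
      le_iSup₂ (f := fun (z : D) (_ : z ∈ V) => ‖A r ω z‖ₑ ^ s) (z k) (hz k)
  have hc : c ≠ ⊤ := by simp [c]
  exact eq_of_charFixedPoint hs (fun r => hev.comp (hA r)) (hev.comp hb) hcontr
    (measurable_charFunAt z) (measurable_charFunAt z) (norm_charFunAt_le z) (norm_charFunAt_le z)
    (ENNReal.mul_ne_top (ENNReal.mul_ne_top (by norm_num) (ENNReal.rpow_ne_top_of_nonneg hs.le hc))
      (ENNReal.mul_ne_top hc hM)) (hflat μ hμM hμc) (hflat ν hνM hνc) (hfix μ hμ) (hfix ν hν) t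

theorem theorem7p1 {Ω : Type*} [MeasurableSpace Ω] (P : Measure Ω) [IsProbabilityMeasure P]
    (D : Opens ℂ) (hD : IsConnected (D : Set ℂ))
    (s : ℝ) (hs : 0 < s) (hs2 : s ≤ 2)
    (m : ℕ) (hm : 1 ≤ m) (n₀ : ℕ) (hn₀ : 1 ≤ n₀)
    (X : ℕ → Ω → HolSpace D) (A : ℕ → Fin m → Ω → HolSpace D) (b : ℕ → Ω → HolSpace D)
    (I : ℕ → Fin m → Ω → ℕ) (Y : Fin m → ℕ → Ω → HolSpace D)
    (hrec : AnalyticRecurrence P n₀ X A b I Y)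
    (hX : ∀ n, LocallyBoundedInLp P (X n) s)
    (hA : ∀ n, n₀ ≤ n → ∀ r, LocallyBoundedInLp P (A n r) s)
    (hb : ∀ n, n₀ ≤ n → LocallyBoundedInLp P (b n) s)
    (hcent : 1 < s → ∀ n, ∀ z : D, ∫ ω, X n ω z ∂P = 0)
    (Astar : Fin m → Ω → HolSpace D) (bstar : Ω → HolSpace D)
    (hAstar : ∀ r, Measurable (Astar r)) (hbstar : Measurable bstar)
    (Δ : Set ℂ) (hΔ : IsConnected Δ) (hΔD : Δ ⊆ D)
    (σ : ℂ → ℝ) (hσ : ∀ x ∈ Δ, 0 < σ x ∧ σ x ≤ s)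
    (hlocal : ∀ x : D, (x : ℂ) ∈ Δ → ∃ U ∈ 𝓝 x,
      (∀ r, Tendsto (fun n => ⨆ z ∈ U, ∫⁻ ω, ‖A n r ω z - Astar r ω z‖ₑ ^ σ x ∂P)
        atTop (𝓝 0)) ∧
      Tendsto (fun n => ⨆ z ∈ U, ∫⁻ ω, ‖b n ω z - bstar ω z‖ₑ ^ σ x ∂P) atTop (𝓝 0) ∧
      (∀ r, (⨆ z ∈ U, ∫⁻ ω, ‖Astar r ω z‖ₑ ^ σ x ∂P) < ⊤) ∧
      (∫⁻ ω, ∑ r, ‖Astar r ω x‖ₑ ^ σ x ∂P) < 1 ∧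
      (∀ (ℓ : ℕ) (r : Fin m),
        Tendsto (fun n => ⨆ z ∈ U, ∫⁻ ω in {ω | I n r ω ≤ ℓ}, ‖A n r ω z‖ₑ ^ σ x ∂P)
          atTop (𝓝 0))) :
    ∃ (D' : Opens ℂ) (hD'D : D' ≤ D), IsConnected (D' : Set ℂ) ∧ Δ ⊆ D' ∧
      ∃ (Ω' : Type) (_ : MeasurableSpace Ω') (P' : Measure Ω') (_ : IsProbabilityMeasure P')
        (Z : Ω' → HolSpace D'), Measurable Z ∧
        -- convergence in distribution in the space of analytic functions on `D'`
        TendstoInDistribution (fun n ω => (X n ω).restrict hD'D) atTop Z (fun _ => P) P' ∧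
        -- the law of the limit is a fixed point of `T`
        contractionMap P (fun r ω => (Astar r ω).restrict hD'D)
          (fun ω => (bstar ω).restrict hD'D) (P'.map Z) = P'.map Z ∧
        -- local moments and centering at every point of `Δ`
        (∀ x : D', (x : ℂ) ∈ Δ → ∃ V ∈ 𝓝 x,
          (∫⁻ ω, ⨆ z ∈ V, ‖Z ω z‖ₑ ^ σ x ∂P') < ⊤ ∧
          (1 < σ x → ∀ z ∈ V, ∫ ω, Z ω z ∂P' = 0)) ∧
        -- uniqueness, under the weakened condition at a single point of `Δ`
        (∀ ν : Measure (HolSpace D'), IsProbabilityMeasure ν →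
          contractionMap P (fun r ω => (Astar r ω).restrict hD'D)
            (fun ω => (bstar ω).restrict hD'D) ν = ν →
          (∃ x : D', (x : ℂ) ∈ Δ ∧ ∃ V ∈ 𝓝 x,
            (⨆ z ∈ V, ∫⁻ f, ‖f z‖ₑ ^ σ x ∂ν) < ⊤ ∧
            (1 < σ x → ∀ z ∈ V, ∫ f, f z ∂ν = 0)) →
          ν = P'.map Z) := by
  classical
  have hball : ∀ x : Δ, ∃ R, 0 < R ∧ Metric.ball (x : ℂ) (2 * R) ⊆ D ∧
      IsContractiveOn P X A b I Astar bstar (σ x) (Metric.ball ⟨x, hΔD x.2⟩ (2 * R)) := by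
    intro x
    obtain ⟨U, hU, hUA, hUb, hUfin, hUlt, hUI⟩ := hlocal ⟨x, hΔD x.2⟩ x.2
    obtain ⟨hσ0, hσs⟩ := hσ x x.2
    have hc : 1 < σ x → ∀ n, ∀ z : D, ∫ ω, X n ω z ∂P = 0 := fun h => hcent (h.trans_le hσs)
    obtain ⟨R, hR, hRD, hRU, hmom, hlt⟩ := hrec.exists_ball_moments hAstar hbstar hσ0
      (hσs.trans hs2) (fun n => (hX n).mono hσ0.le hσs) (fun n hn => (hb n hn).mono hσ0.le hσs)
      hc hU hUA hUb hUfin hUlt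
    exact ⟨R, hR, hRD,
      { pos := hσ0
        le_two := hσs.trans hs2
        exists_moment := hmom
        centered := fun h n z _ => hc h n z
        tendsto_A := fun r z hz => tendsto_of_tendsto_biSup (hUA r) (hRU hz)
        tendsto_b := fun z hz => tendsto_of_tendsto_biSup hUb (hRU hz)
        lt_one := hlt
        tendsto_small := fun ℓ r z hz => tendsto_of_tendsto_biSup (hUI ℓ r) (hRU hz) }⟩
  choose R hR hRD hcontr using hball
  -- Contraction and moments are available on the discs of radius `2R`; only radius `R` is kept,
  -- since tightness spends a factor 2 on moving the supremum inside the expectation.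
  let D' : Opens ℂ := ⟨⋃ x : Δ, Metric.ball (x : ℂ) (R x), isOpen_iUnion fun x => Metric.isOpen_ball⟩
  have hsubD' : ∀ x : Δ, Metric.ball (x : ℂ) (R x) ⊆ D' := fun x => Set.subset_iUnion_of_subset x
    subset_rfl
  have hR2 : ∀ x : Δ, Metric.ball (x : ℂ) (R x) ⊆ Metric.ball (x : ℂ) (2 * R x) := fun x =>
    Metric.ball_subset_ball (by linarith [hR x])
  have hD'D : D' ≤ D := Set.iUnion_subset fun x => (hR2 x).trans (hRD x)
  have hD'conn : IsConnected (D' : Set ℂ) := isConnected_iUnion_ball hΔ R hR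
  have hΔD' : Δ ⊆ D' := fun x hx => hsubD' ⟨x, hx⟩ (Metric.mem_ball_self (hR _))
  have hA' : ∀ r, Measurable fun ω => (Astar r ω).restrict hD'D := fun r =>
    (HolSpace.measurable_restrict hD'D).comp (hAstar r)
  have hb' : Measurable fun ω => (bstar ω).restrict hD'D :=
    (HolSpace.measurable_restrict hD'D).comp hbstar
  have htight := hrec.isTightMeasureSet_restrictLaw (Astar := Astar) (bstar := bstar) hD'D
    fun y => by
      obtain ⟨x, hx⟩ := Set.mem_iUnion.1 y.2
      exact ⟨⟨x, hΔD x.2⟩, R x, σ x, hR x, hx, hRD x, hcontr x⟩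
  obtain ⟨x₀, hx₀⟩ := hΔ.nonempty
  obtain ⟨ν, hν, hfix⟩ := hrec.exists_tendsto_restrictLaw hAstar hbstar hD'D hD'conn htight
    (hcontr ⟨x₀, hx₀⟩) Metric.isOpen_ball
    ⟨⟨x₀, hΔD' hx₀⟩, Metric.mem_ball_self (by linarith [hR ⟨x₀, hx₀⟩])⟩
  have hmap : (ν : Measure (HolSpace D')).map id = ν := Measure.map_id
  -- The limit is realized canonically, as the identity on the function space under `ν`.
  refine ⟨D', hD'D, hD'conn, hΔD', HolSpace D', inferInstance, ν, inferInstance, id, measurable_id,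
    ⟨fun n => ((HolSpace.measurable_restrict hD'D).comp (hrec.measurable_X n)).aemeasurable,
      aemeasurable_id, ?_⟩, by rw [hmap]; exact hfix, fun x hx => ?_, fun ν' hprob hfix' h => ?_⟩
  · have hlim : (⟨(ν : Measure (HolSpace D')).map id,
        Measure.isProbabilityMeasure_map aemeasurable_id⟩ : ProbabilityMeasure (HolSpace D')) = ν :=
      Subtype.ext hmap
    rw [hlim]
    exact hν
  · have hcx := hcontr ⟨x, hx⟩
    have hRx := hR ⟨x, hx⟩
    obtain ⟨M, hM, hνM⟩ := hrec.lintegral_limit_le hD'D hν hcx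
    -- Radius `R / 2` ensures that the doubled disc stays inside the disc of radius `R`, hence
    -- inside `D'`.
    have hmem : ∀ z ∈ Metric.ball x (2 * (R ⟨x, hx⟩ / 2)),
        HolSpace.incl hD'D z ∈ Metric.ball (⟨x, hΔD hx⟩ : D) (2 * R ⟨x, hx⟩) := fun z hz =>
      Metric.ball_subset_ball (by linarith) hz
    refine ⟨Metric.ball x (R ⟨x, hx⟩ / 2), Metric.ball_mem_nhds _ (by linarith), ?_,
      fun h1 z hz => hrec.integral_limit_eq_zero hAstar hbstar hD'D hν hcx h1
        (hmem z (Metric.ball_subset_ball (by linarith) hz))⟩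
    refine (HolSpace.lintegral_iSup_ball_le (by linarith) hcx.pos (fun z hz => ?_)
      measurable_id).trans_lt (ENNReal.mul_lt_top (by norm_num)
        ((iSup₂_le fun z hz => hνM z (hmem z hz)).trans_lt hM.lt_top))
    exact hsubD' ⟨x, hx⟩ (Metric.ball_subset_ball (by linarith) hz)
  · obtain ⟨x, hx, V, hV, hVfin, hVc⟩ := h
    have hcx := hcontr ⟨x, hx⟩
    obtain ⟨M, hM, hνM⟩ := hrec.lintegral_limit_le hD'D hν hcx
    have hpre : HolSpace.incl hD'D ⁻¹' Metric.ball (⟨x, hΔD hx⟩ : D) (2 * R ⟨x, hx⟩) ∈ 𝓝 x :=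
      (HolSpace.continuous_incl hD'D).continuousAt
        (Metric.ball_mem_nhds _ (by linarith [hR ⟨x, hx⟩]))
    -- On an open `W` contained in both the given neighbourhood and the contractive disc, both fixed
    -- points have bounded moments of order `σ x`, and zero mean if `σ x > 1`.
    obtain ⟨W, hWsub, hW, hxW⟩ := mem_nhds_iff.1 (inter_mem hV hpre)
    rw [hmap]
    refine eq_of_contractionMap_eq hD'conn hA' hb' hcx.pos hcx.le_two hW ⟨x, hxW⟩
      ((lintegral_mono fun ω => Finset.sum_le_sum fun r _ => iSup₂_le fun z hz => ?_).trans_lt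
        hcx.lt_one) hfix' hfix (M := max (⨆ z ∈ V, ∫⁻ f, ‖f z‖ₑ ^ σ x ∂ν') M)
      (max_ne_top hVfin.ne hM) (fun z hz => ?_) (fun z hz => ?_)
      (fun h1 z hz => hVc h1 z (hWsub hz).1)
      fun h1 z hz => hrec.integral_limit_eq_zero hAstar hbstar hD'D hν hcx h1 (hWsub hz).2
    · exact le_iSup₂ (f := fun (z : D) (_ : z ∈ Metric.ball (⟨x, hΔD hx⟩ : D) (2 * R ⟨x, hx⟩)) =>
        ‖Astar r ω z‖ₑ ^ σ x) (HolSpace.incl hD'D z) (hWsub hz).2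
    · exact (le_iSup₂ (f := fun (z : D') (_ : z ∈ V) => ∫⁻ f, ‖f z‖ₑ ^ σ x ∂ν') z
        (hWsub hz).1).trans (le_max_left _ _)
    · exact (hνM z (hWsub hz).2).trans (le_max_right _ _)
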